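/- \textbf{Setting.} Let $I\subset\mathbb R$ be a compact interval of positive length, with Lebesgue measure; $\operatorname{einf}_Z$ is the essential infimum over $Z\subset I$, $\operatorname{einf}=\operatorname{einf}_I$, $\|\cdot\|_\infty$ is the essential supremum norm on $I$, and $\operatorname{var}(f)$ is the least variation on $I$ of a function equal to $f$ almost everywhere. Let $\sigma$ be an ergodic, invertible, measure-preserving transformation of a complete probability space $(\Omega,m)$. A \emph{random open map} consists of maps $T_\omega:I\to I$, holes $H_\omega\subset I$ and weights $g_\omega:I\to(0,\infty)$, all constant on the atoms of an at most countable measurable partition of $\Omega$, such that: $T_\omega$ is continuous and strictly monotone on each interval of some finite partition of $I$ (up to finitely many points); $H_\omega$ is a (possibly empty) finite union of intervals; $g_\omega$ has bounded variation; and at least one full branch of $T_\omega$ is contained in $X_\omega=I\setminus H_\omega$. It is \emph{closed} if $H_\omega=\emptyset$ for all $\omega$. Put $T_\omega^{(n)}=T_{\sigma^{n-1}\omega}\circ\dots\circ T_\omega$, $g_\omega^{(n)}=\prod_{j<n}g_{\sigma^j\omega}\circ T_\omega^{(j)}$ and $X_{\omega,n}=\{x\in I: T_\omega^{(j)}x\in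 X_{\sigma^j\omega}\text{ for }0\le j<n\}$. The branches of order $n$ are the maximal open intervals in $X_{\omega,n}$ on which $T^{(n)}_\omega$ is continuous and strictly monotone; a branch is \emph{full} if its image under $T^{(n)}_\omega$ is $I$ up to endpoints. Let $b^{(n)}_{\omega,f}$ be the number of full branches, and $\xi^{(n)}_\omega$ the largest number of contiguous non-full branches, i.e. of non-full branches such that the convex hull of their union contains no full branch. The potential $\{\log g_\omega\}$ is \emph{strongly contracting} if $\log\#\{\text{branches of order }1\}$, $\log\|g_\omega\|_\infty$, $\log\operatorname{einf}g_\omega$ and $\operatorname{var}(g_\omega)/\|g_\omega\|_\infty$ are in $L^1(m)$ (in particular $\operatorname{einf} g_\omega>0$ a.e.) and, for some $n\ge1$, $\int\log c_{\omega,n}\,dm<0$, where $$c_{\omega,n}=\Big(3+3\sum_{j<n}\tfrac{\operatorname{var}(g_{\sigma^j\omega})}{\|g_{\sigma^j\omega}\|_\infty}\Big)\,(1+2\xi_\omega^{(n)})\,\frac{\prod_{j<n}\|g_{\sigma^j\omega}\|_\infty}{b^{(n)}_{\omega,f}\,\operatorname{einf}_{X_{\omega,n}}g_\omega^{(n)}}.$$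 The transfer operator is $\mathcal L_\omega f=\sum_Z\mathbf 1_{T_\omega(Z)}\,(fg_\omega)\circ(T_\omega|_Z)^{-1}$, summed over the branches $Z$ of order $1$, and $\mathcal L^{(n)}_\omega=\mathcal L_{\sigma^{n-1}\omega}\circ\dots\circ\mathcal L_\omega$. The \emph{conformal measure} $\nu_\omega$ is the non-atomic probability measure with $\nu_\omega(X_\omega)=1$ and $\nu_\omega(f)=\lim_n \operatorname{einf}(\mathcal L_\omega^{(n)}f)/\operatorname{einf}(\mathcal L_\omega^{(n)}1)$ for all $f>0$ of bounded variation with $\operatorname{var}(f)\le\operatorname{einf}(f)$. Put $\lambda^+_\omega=\nu_{\sigma\omega}(\mathcal L_\omega1)$; the \emph{maximal Lyapunov exponent} is $\Lambda=\int\log\lambda^+_\omega\,dm$. \textbf{Statement.} Let $\{\log g_\omega\}$ be strongly contracting for the random closed map $\{T_\omega\}$. Let $\varepsilon_0>0$ and let $(H^\varepsilon_\omega)_{0\le\varepsilon\le\varepsilon_0}$ be such that each $\{(T_\omega,H^\varepsilon_\omega)\}$ with weights $g_\omega$ is a random open map, $H^0_\omega=\emptyset$, and $H^{\varepsilon'}_\omega\subset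 H^{\varepsilon}_\omega$ for $\varepsilon'<\varepsilon$. Objects belonging to $\{(T_\omega,H^\varepsilon_\omega)\}$ carry a superscript $\varepsilon$. Suppose there are $b_\omega,\xi_\omega>0$ such that $b^{\varepsilon,(1)}_{\omega,f}\ge b_\omega$ and $\xi^{\varepsilon,(1)}_\omega\le\xi_\omega$ for all $\omega$ and all $0\le\varepsilon\le\varepsilon_0$, and $$\int \log\|g_\omega\|_\infty-\log\operatorname{einf}(g_\omega)+\log(2+\xi_\omega)-\log b_\omega\;dm<0.$$ Then: \begin{enumerate} \item for each $0<\varepsilon\le\varepsilon_0$, $\{\log g_\omega\}$ is strongly contracting for $\{(T_\omega,H^\varepsilon_\omega)\}$; \item for each $0\le\varepsilon\le\varepsilon_0$: for $m$-a.e. $\omega$ the conformal measure $\nu^\varepsilon_\omega$ exists and is unique, $\lambda_\omega^{\varepsilon,+}>0$, and $\nu^\varepsilon_{\sigma\omega}(\mathcal L^\varepsilon_\omega f)=\lambda^{\varepsilon,+}_\omega\nu^\varepsilon_\omega(f)$ for all $f$ of bounded variation; moreover $\log\lambda^{\varepsilon,+}_\omega\in L^1(m)$ and $\Lambda^\varepsilon=\lim_n\frac1n\log\operatorname{einf}(\mathcal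 L_\omega^{\varepsilon,(n)}1)$ for $m$-a.e. $\omega$; \item $\varepsilon\mapsto\Lambda^\varepsilon$ is non-increasing on $[0,\varepsilon_0]$; \item for $0\le\varepsilon'<\varepsilon\le\varepsilon_0$, the escape rate of $\nu^{\varepsilon'}$ through $\{H^\varepsilon_\omega\}$ equals $\Lambda^{\varepsilon'}-\Lambda^\varepsilon$: for $m$-a.e. $\omega$, $\nu^{\varepsilon'}_\omega(X^\varepsilon_{\omega,n})>0$ for all $n$ and $$-\lim_{n\to\infty}\frac1n\log\nu^{\varepsilon'}_\omega(X^\varepsilon_{\omega,n})=\Lambda^{\varepsilon'}-\Lambda^\varepsilon .$$ \end{enumerate} -/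

import Mathlib

open MeasureTheory Set Filter Topology

/-- The maximal nonempty open intervals contained in `X` on which `f` is continuous and strictly
monotone. Modulo finitely many points, these are the atoms of the coarsest partition of `X` into
intervals on each of which `f` is continuous and strictly monotone. -/
def IsMonoInterval (X : Set ℝ) (f : ℝ → ℝ) (Z : Set ℝ) : Prop :=
  IsOpen Z ∧ Z.OrdConnected ∧ Z.Nonempty ∧ Z ⊆ X ∧ ContinuousOn f Z ∧
    (StrictMonoOn f Z ∨ StrictAntiOn f Z)

/-- See `IsMonoInterval`. -/
def monoIntervals (X : Set ℝ) (f : ℝ → ℝ) : Set (Set ℝ) :=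
  {Z | Maximal (IsMonoInterval X f) Z}

/-- Raw data of a random interval map with weights: an interval `[lo, hi]`, an invertible driving
map `σ`, fibre maps `T ω` and weights `g ω` (only their values on `[lo, hi]` matter). The standing
assumptions on these data and on the holes are collected in `RandomMap.IsRandomOpenMap`. -/
structure RandomMap (Ω : Type*) [MeasurableSpace Ω] where
  lo : ℝ
  hi : ℝ
  σ : Ω ≃ᵐ Ω
  T : Ω → ℝ → ℝ
  g : Ω → ℝ → ℝ

namespace RandomMap

variable {Ω : Type*} [MeasurableSpace Ω]

/-- The compact interval of the system. -/
def I (S : RandomMap Ω) : Set ℝ := Icc S.lo S.hi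

/-- `T_ω^{(n)} = T_{σ^{n-1} ω} ∘ ⋯ ∘ T_ω`. -/
def iter (S : RandomMap Ω) : ℕ → Ω → ℝ → ℝ
  | 0, _, x => x
  | n + 1, ω, x => S.T (S.σ^[n] ω) (S.iter n ω x)

/-- `g_ω^{(n)}`, the product of the weights along the first `n` points of the orbit. -/
noncomputable def gprod (S : RandomMap Ω) (n : ℕ) (ω : Ω) (x : ℝ) : ℝ :=
  ∏ j ∈ Finset.range n, S.g (S.σ^[j] ω) (S.iter j ω x)

/-- The `n`-step survivor set for the holes `H`. For `n = 1` it is `I \ H_ω`. -/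
def survivor (S : RandomMap Ω) (H : Ω → Set ℝ) (n : ℕ) (ω : Ω) : Set ℝ :=
  {x ∈ S.I | ∀ j < n, S.iter j ω x ∈ S.I \ H (S.σ^[j] ω)}

/-- The monotonicity intervals of `T_ω^{(n)}` restricted to the `n`-step survivor set. -/
def branches (S : RandomMap Ω) (H : Ω → Set ℝ) (n : ℕ) (ω : Ω) : Set (Set ℝ) :=
  monoIntervals (S.survivor H n ω) (S.iter n ω)

/-- The full branches. As branches are taken open, the image of a full branch is `I` up to the two
endpoints. -/
def fullBranches (S : RandomMap Ω) (H : Ω → Set ℝ) (n : ℕ) (ω : Ω) : Set (Set ℝ) :=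
  {Z ∈ S.branches H n ω | Ioo S.lo S.hi ⊆ S.iter n ω '' Z}

/-- The non-full branches. -/
def partialBranches (S : RandomMap Ω) (H : Ω → Set ℝ) (n : ℕ) (ω : Ω) : Set (Set ℝ) :=
  S.branches H n ω \ S.fullBranches H n ω

/-- `b_{ω,f}^{(n)}`, the number of full branches. -/
noncomputable def numFull (S : RandomMap Ω) (H : Ω → Set ℝ) (n : ℕ) (ω : Ω) : ℕ :=
  (S.fullBranches H n ω).ncard

/-- `ξ_ω^{(n)}`, the largest size of a collection of contiguous non-full branches, i.e. of non-full
branches such that the convex hull of their union contains no full branch. -/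
noncomputable def maxContiguous (S : RandomMap Ω) (H : Ω → Set ℝ) (n : ℕ) (ω : Ω) : ℕ :=
  sSup {k : ℕ | ∃ A : Finset (Set ℝ), A.card = k ∧ (∀ W ∈ A, W ∈ S.partialBranches H n ω) ∧
    ∀ Z ∈ S.fullBranches H n ω, ¬ Z ⊆ convexHull ℝ (⋃ W ∈ A, W)}

/-- Essential infimum over `Z` with respect to Lebesgue measure. -/
noncomputable def einfOn (Z : Set ℝ) (f : ℝ → ℝ) : ℝ := essInf f (volume.restrict Z)

/-- Essential infimum over the interval `I`. -/
noncomputable def einf (S : RandomMap Ω) (f : ℝ → ℝ) : ℝ := einfOn S.I f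

/-- `‖f‖_∞` on the interval `I`, with respect to Lebesgue measure. -/
noncomputable def supNorm (S : RandomMap Ω) (f : ℝ → ℝ) : ℝ :=
  essSup (fun x => |f x|) (volume.restrict S.I)

/-- The variation on `I` of the Lebesgue class of `f`: the least variation of a representative. -/
noncomputable def var (S : RandomMap Ω) (f : ℝ → ℝ) : ℝ :=
  (⨅ h : {h : ℝ → ℝ // h =ᵐ[volume.restrict S.I] f}, eVariationOn h.1 S.I).toReal

/-- The standing assumptions on a random open map `(T_ω, H_ω)` with weights `g_ω`. -/
structure IsRandomOpenMap (S : RandomMap Ω) (H : Ω → Set ℝ) : Prop where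
  lo_lt_hi : S.lo < S.hi
  mapsTo : ∀ ω, MapsTo (S.T ω) S.I S.I
  /-- `T_ω` is piecewise continuous and strictly monotone, with finitely many pieces. -/
  piecewise : ∀ ω, ∃ F : Finset ℝ, ∀ u v : ℝ, u < v → Ioo u v ⊆ S.I \ ↑F →
    ContinuousOn (S.T ω) (Ioo u v) ∧
      (StrictMonoOn (S.T ω) (Ioo u v) ∨ StrictAntiOn (S.T ω) (Ioo u v))
  /-- The hole is a (possibly empty) finite union of intervals. -/
  hole : ∀ ω, H ω ⊆ S.I ∧
    ∃ J : Set (Set ℝ), J.Finite ∧ (∀ K ∈ J, K.OrdConnected) ∧ H ω = ⋃₀ J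
  /-- Some full branch of the closed map `T_ω` does not meet the hole. -/
  exists_full : ∀ ω, ∃ Z ∈ monoIntervals S.I (S.T ω),
    Ioo S.lo S.hi ⊆ S.T ω '' Z ∧ Disjoint Z (H ω)
  g_pos : ∀ ω, ∀ x ∈ S.I, 0 < S.g ω x
  g_bv : ∀ ω, BoundedVariationOn (S.g ω) S.I
  /-- The map, the hole and the weight are constant on the atoms of an (at most) countable
  measurable partition of `Ω`. -/
  countable_partition : ∃ idx : Ω → ℕ, Measurable idx ∧
    ∀ ω ω', idx ω = idx ω' → S.T ω = S.T ω' ∧ H ω = H ω' ∧ S.g ω = S.g ω'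

/-- The contraction constant
`c_{ω,n} = (3 + 3 S̃_{n,ω}(g)) (1 + 2 ξ_ω^{(n)}) ‖g_ω‖_∞^{(n)} / (b_{ω,f}^{(n)} · einf_{X_{ω,n}} g_ω^{(n)})`,
where `S̃_{n,ω}(g) = ∑_{j<n} var(g_{σ^j ω}) / ‖g_{σ^j ω}‖_∞` and
`‖g_ω‖_∞^{(n)} = ∏_{j<n} ‖g_{σ^j ω}‖_∞`. -/
noncomputable def contractionConst (S : RandomMap Ω) (H : Ω → Set ℝ) (n : ℕ) (ω : Ω) : ℝ :=
  (3 + 3 * ∑ j ∈ Finset.range n, S.var (S.g (S.σ^[j] ω)) / S.supNorm (S.g (S.σ^[j] ω))) *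
    (1 + 2 * (S.maxContiguous H n ω : ℝ)) *
    (∏ j ∈ Finset.range n, S.supNorm (S.g (S.σ^[j] ω))) /
    ((S.numFull H n ω : ℝ) * einfOn (S.survivor H n ω) (S.gprod n ω))

/-- `log g` is a strongly contracting potential for the random open map `(T, H)`. The first field
says that `log (einf g_ω)` is a genuine real number. The strict inequality in the last field
includes the integrability of `log c_{ω,n}`, since the Bochner integral of a non-integrable function
is `0`. -/
structure StronglyContracting (S : RandomMap Ω) (m : Measure Ω) (H : Ω → Set ℝ) : Prop where
  einf_pos : ∀ᵐ ω ∂m, 0 < S.einf (S.g ω)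
  int_card : Integrable (fun ω => Real.log ((S.branches H 1 ω).ncard : ℝ)) m
  int_sup : Integrable (fun ω => Real.log (S.supNorm (S.g ω))) m
  int_inf : Integrable (fun ω => Real.log (S.einf (S.g ω))) m
  int_var : Integrable (fun ω => S.var (S.g ω) / S.supNorm (S.g ω)) m
  contracting : ∃ n : ℕ, 0 < n ∧ ∫ ω, Real.log (S.contractionConst H n ω) ∂m < 0

/-- The transfer operator `L_ω f = ∑_Z 1_{T_ω(Z)} · (f g_ω) ∘ (T_ω|_Z)⁻¹`, the sum being over the
branches `Z` of `T_ω` on `I \ H_ω`. -/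
noncomputable def transfer (S : RandomMap Ω) (H : Ω → Set ℝ) (ω : Ω) (f : ℝ → ℝ) : ℝ → ℝ :=
  fun x => ∑ᶠ Z ∈ S.branches H 1 ω, (S.T ω '' Z).indicator
    (fun y => f (Function.invFunOn (S.T ω) Z y) * S.g ω (Function.invFunOn (S.T ω) Z y)) x

/-- `L_ω^{(n)} = L_{σ^{n-1} ω} ∘ ⋯ ∘ L_ω`. -/
noncomputable def transferIter (S : RandomMap Ω) (H : Ω → Set ℝ) :
    ℕ → Ω → (ℝ → ℝ) → (ℝ → ℝ)
  | 0, _, f => f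
  | n + 1, ω, f => S.transfer H (S.σ^[n] ω) (S.transferIter H n ω f)

/-- The cone of positive functions `f` of bounded variation on `I` with `var f ≤ α · einf f`. -/
def cone (S : RandomMap Ω) (α : ℝ) : Set (ℝ → ℝ) :=
  {f | BoundedVariationOn f S.I ∧ (∀ x ∈ S.I, 0 < f x) ∧ S.var f ≤ α * S.einf f}

/-- `ν` is a non-atomic probability measure carried by `I \ H_ω` which represents the functional
`f ↦ lim_n einf (L_ω^{(n)} f) / einf (L_ω^{(n)} 1)` on the cone `{f > 0, var f ≤ einf f}`. -/
structure IsConformalMeasure (S : RandomMap Ω) (H : Ω → Set ℝ) (ω : Ω) (ν : Measure ℝ) :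
    Prop where
  prob : IsProbabilityMeasure ν
  noAtoms : ∀ x : ℝ, ν {x} = 0
  carried : ν (S.I \ H ω)ᶜ = 0
  limit : ∀ f ∈ S.cone 1,
    Tendsto (fun n : ℕ => S.einf (S.transferIter H n ω f) /
      S.einf (S.transferIter H n ω (fun _ => 1))) atTop (𝓝 (∫ x, f x ∂ν))

open Classical in
/-- The conformal measure `ν_ω`, i.e. the measure of `IsConformalMeasure` (`0` if there is none). -/
noncomputable def conformalMeasure (S : RandomMap Ω) (H : Ω → Set ℝ) (ω : Ω) : Measure ℝ :=
  if h : ∃ ν, S.IsConformalMeasure H ω ν then h.choose else 0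

/-- The multiplier `λ⁺_ω = ν_{σω}(L_ω 1)`. -/
noncomputable def multiplier (S : RandomMap Ω) (H : Ω → Set ℝ) (ω : Ω) : ℝ :=
  ∫ x, S.transfer H ω (fun _ => 1) x ∂(S.conformalMeasure H (S.σ ω))

/-- The maximal Lyapunov exponent (expected pressure) `Λ = ∫ log λ⁺_ω dm`. -/
noncomputable def lyapunov (S : RandomMap Ω) (m : Measure Ω) (H : Ω → Set ℝ) : ℝ :=
  ∫ ω, Real.log (S.multiplier H ω) ∂m

end RandomMap

/-! Everything rests on one contraction property of the transfer operators, proved for any system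
with integrable data and negative mean excess (`RandomMap.IsAdmissible`), whatever its holes. The
closed system and all the open ones are instances, with the same `b` and `ξ`.

Exceptional sets are countable throughout (filter `RandomMap.cc`), not Lebesgue null: the maps need
not respect null sets, whereas images of countable sets are countable, and so are preimages on each
piece of injectivity. Functions of bounded variation that agree almost everywhere differ only on a
countable set (`countable_ne_of_ae_eq`), so the essential bounds on `g` are still available.

Contraction. Consider positive `u` with `var u ≤ a · inf u`. In the Lasota–Yorke inequality
`eVariationOn_pieceTransfer_le`, the values of `u` on non-full pieces are compared with those on
neighbouring full pieces, which costs a factor `1 + 2k` if at most `k` non-full pieces are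
contiguous; the values on full pieces are controlled by the transferred function itself.
`IsRandomOpenMap.isContigBound` shows that for order `N` one may take `k = 2N ∏ (2 + ξ)`, and there
are at least `∏ b` full pieces. Hence `N` steps change `a` into at most `e^R (B + a)`, where `R` is
a Birkhoff sum of negative mean once `N` is large. This affine recursion is evaluated at the running
minima ("records") of a Birkhoff sum with some slack added: there it is bounded by a constant plus a
small multiple of the initial `a` (`IsRandomOpenMap.inCone_record`). So between distant records a
fixed cone is mapped into the cone of half its parameter. At each such time a definite proportion of
the remainder can be replaced by a multiple of the iterate of `1`, whence `L^{(n)} f / L^{(n)} 1`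
converges uniformly to a constant (`IsRandomOpenMap.exists_hasLim_of_inCone`).

Measure. The limit is a positive linear functional on functions of bounded variation. A piece of
order `n` has mass at most a quantity that becomes arbitrarily small, so the functional has a
continuous distribution function and is integration against a non-atomic measure, the conformal
measure. Equivariance comes from splitting off the first step of `L^{(n+1)}`.

Exponent. Records have density one in time, so the oscillation of `L^{(n)} 1` is subexponential
(`IsAdmissible.ae_growth`). As the product of the multipliers is the integral of `L^{(n)} 1`, the
ergodic theorem for `log λ` gives the growth rate of every sequence between the bounds for `L^{(n)}
1`. Larger holes delete terms from the operator, which gives monotonicity. Finally, transferring the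
indicator of the survivor set of the larger holes through the smaller holes produces the iterate of
`1` for the larger holes; so `ν^{ε'}(X^ε_n)` times the product of the `λ^{ε'}` grows at rate `Λ^ε`,
and this is the escape rate formula. -/

/-! ### The pointwise ergodic theorem. -/

/-- The running maxima `max_{1 ≤ k ≤ n + 1} S_k f` of the Birkhoff sums. -/
noncomputable def birkhoffMax {α : Type*} (T : α → α) (f : α → ℝ) : ℕ → α → ℝ
  | 0, x => f x
  | n + 1, x => f x + max 0 (birkhoffMax T f n (T x))

section Birkhoff

variable {α : Type*} {T : α → α}

theorem birkhoffMax_mono (f : α → ℝ) (n : ℕ) :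
    ∀ x, birkhoffMax T f n x ≤ birkhoffMax T f (n + 1) x := by
  induction n with
  | zero => intro x; simp [birkhoffMax]
  | succ n ih =>
    intro x
    show f x + max 0 _ ≤ f x + max 0 _
    gcongr
    exact ih _

theorem le_birkhoffMax (f : α → ℝ) (n : ℕ) (x : α) : f x ≤ birkhoffMax T f n x := by
  cases n with
  | zero => exact le_rfl
  | succ n => simp [birkhoffMax]

theorem birkhoffSum_le_birkhoffMax (f : α → ℝ) (n : ℕ) :
    ∀ x, birkhoffSum T f (n + 1) x ≤ birkhoffMax T f n x := by
  induction n with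
  | zero => intro x; simp [birkhoffMax]
  | succ n ih =>
    intro x
    rw [birkhoffSum_succ']
    show f x + _ ≤ f x + max 0 _
    gcongr
    exact (ih _).trans (le_max_right _ _)

variable [MeasurableSpace α] {μ : Measure α}

theorem measurable_birkhoffMax (hT : Measurable T) {f : α → ℝ} (hf : Measurable f) (n : ℕ) :
    Measurable (birkhoffMax T f n) := by
  induction n with
  | zero => exact hf
  | succ n ih => exact hf.add (measurable_const.max (ih.comp hT))

theorem integrable_birkhoffMax (hT : MeasurePreserving T μ μ) {f : α → ℝ} (hf : Integrable f μ)
    (n : ℕ) : Integrable (birkhoffMax T f n) μ := by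
  induction n with
  | zero => exact hf
  | succ n ih =>
    exact hf.add ((integrable_zero _ _ _).sup (hT.integrable_comp_of_integrable ih))

/-- If `∫ f < 0`, the Birkhoff sums of `f` are bounded above almost everywhere. -/
theorem ae_bddAbove_birkhoffSum [IsProbabilityMeasure μ] (hT : Ergodic T μ) {f : α → ℝ}
    (hfm : Measurable f) (hf : Integrable f μ) (hneg : ∫ x, f x ∂μ < 0) :
    ∀ᵐ x ∂μ, ∃ M, ∀ n, birkhoffSum T f n x ≤ M := by
  set F := birkhoffMax T f
  have hFm := measurable_birkhoffMax hT.measurable hfm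
  -- The set where the running maxima are unbounded is invariant, so by ergodicity only the case of
  -- full measure has to be excluded.
  set A : Set α := {x | ∀ M : ℕ, ∃ n, (M : ℝ) < F n x} with hA
  have hAm : MeasurableSet A := by
    have : A = ⋂ M : ℕ, ⋃ n, {x | (M : ℝ) < F n x} := by ext x; simp [hA]
    rw [this]
    exact MeasurableSet.iInter fun M => MeasurableSet.iUnion fun n =>
      measurableSet_lt measurable_const (hFm n)
  have hmem : ∀ x, x ∈ A ↔ ∀ M : ℝ, ∃ n, M < F n x := fun x =>
    ⟨fun h M => (h ⌈M⌉₊).imp fun n hn => (Nat.le_ceil M).trans_lt hn, fun h M => h M⟩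
  have hinv : T ⁻¹' A = A := by
    ext x
    rw [mem_preimage, hmem, hmem]
    constructor
    · intro h M
      obtain ⟨n, hn⟩ := h (M - f x)
      refine ⟨n + 1, ?_⟩
      show M < f x + max 0 _
      have := le_max_right 0 (F n (T x))
      linarith
    · intro h M
      obtain ⟨n, hn⟩ := h (f x + max 0 M)
      have h2 := hn.trans_le (birkhoffMax_mono f n x)
      have h3 : f x + max 0 M < f x + max 0 (F n (T x)) := h2
      have h4 : max 0 M < max 0 (F n (T x)) := by linarith
      refine ⟨n, ?_⟩
      rcases lt_max_iff.1 h4 with h5 | h5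
      · exact absurd h5 (not_lt.2 (le_max_left _ _))
      · exact (le_max_right _ _).trans_lt h5
  rcases hT.toPreErgodic.prob_eq_zero_or_one hAm hinv with h0 | h1
  · have : ∀ᵐ x ∂μ, x ∉ A := measure_eq_zero_iff_ae_notMem.1 h0
    filter_upwards [this] with x hx
    rw [hmem] at hx
    push Not at hx
    obtain ⟨M, hM⟩ := hx
    refine ⟨max 0 M, fun n => ?_⟩
    cases n with
    | zero => simp
    | succ n => exact (birkhoffSum_le_birkhoffMax f n x).trans ((hM n).trans (le_max_right _ _))
  · exfalso
    have hAe : ∀ᵐ x ∂μ, x ∈ A := (prob_compl_eq_zero_iff hAm).2 h1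
    have hFi := integrable_birkhoffMax hT.toMeasurePreserving hf
    -- On `A` the integrand `F (n+1) - F n ∘ T = f + max 0 (-F n ∘ T)` is eventually `f`. Its
    -- integrals are nonnegative since `F` increases and `μ` is invariant, and it is dominated
    -- because `F n ∘ T ≥ f ∘ T`. So `∫ f ≥ 0`, a contradiction.
    have key : ∀ n, 0 ≤ ∫ x, (F (n + 1) x - F n (T x)) ∂μ := by
      intro n
      have hci : Integrable (fun x => F n (T x)) μ :=
        hT.toMeasurePreserving.integrable_comp_of_integrable (hFi n)
      rw [integral_sub (hFi (n + 1)) hci]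
      have : ∫ x, F n (T x) ∂μ = ∫ x, F n x ∂μ := by
        conv_rhs => rw [← hT.toMeasurePreserving.map_eq]
        rw [integral_map hT.measurable.aemeasurable (hFm n).aestronglyMeasurable]
      rw [this, sub_nonneg]
      exact integral_mono (hFi n) (hFi _) (birkhoffMax_mono f n)
    have hlim : Tendsto (fun n => ∫ x, (F (n + 1) x - F n (T x)) ∂μ) atTop (𝓝 (∫ x, f x ∂μ)) := by
      refine tendsto_integral_of_dominated_convergence (fun x => |f x| + |f (T x)|) (fun n => ?_)
        ?_ (fun n => ?_) ?_
      · exact ((hFm _).sub ((hFm n).comp hT.measurable)).aestronglyMeasurable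
      · exact hf.abs.add (hT.toMeasurePreserving.integrable_comp_of_integrable hf.abs)
      · refine Eventually.of_forall fun x => ?_
        have h1 : F (n + 1) x = f x + max 0 (F n (T x)) := rfl
        have h2 := le_birkhoffMax (T := T) f n (T x)
        rw [Real.norm_eq_abs, h1]
        have h3 : |max 0 (F n (T x)) - F n (T x)| ≤ |f (T x)| := by
          rcases le_total 0 (F n (T x)) with h | h
          · simp [max_eq_right h]
          · rw [max_eq_left h, zero_sub, abs_neg, abs_of_nonpos h]
            exact (neg_le_neg h2).trans (neg_le_abs _)
        calc |f x + max 0 (F n (T x)) - F n (T x)|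
            = |f x + (max 0 (F n (T x)) - F n (T x))| := by ring_nf
          _ ≤ |f x| + |max 0 (F n (T x)) - F n (T x)| := abs_add_le _ _
          _ ≤ _ := by gcongr
      · filter_upwards [hAe] with x hx
        rw [← hinv, mem_preimage, hmem] at hx
        obtain ⟨n, hn⟩ := hx 0
        refine tendsto_const_nhds.congr' ?_
        filter_upwards [eventually_ge_atTop n] with k hk
        have h1 : F (k + 1) x = f x + max 0 (F k (T x)) := rfl
        have h2 : F n (T x) ≤ F k (T x) :=
          monotone_nat_of_le_succ (f := fun n => F n (T x)) (fun n => birkhoffMax_mono f n (T x)) hk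
        rw [h1, max_eq_right (hn.le.trans h2)]
        ring
    exact absurd (ge_of_tendsto' hlim key) (not_le.2 hneg)

/-- Subtracting from `f` slightly more than its mean makes the mean negative. Used for `f` and `-f`,
this gives both halves of the ergodic theorem. -/
theorem ae_birkhoffSum_le [IsProbabilityMeasure μ] (hT : Ergodic T μ) {f : α → ℝ}
    (hfm : Measurable f) (hf : Integrable f μ) :
    ∀ᵐ x ∂μ, ∀ δ > 0, ∃ M, ∀ n : ℕ, birkhoffSum T f n x ≤ n * (∫ x, f x ∂μ + δ) + M := by
  have h : ∀ k : ℕ, ∀ᵐ x ∂μ, ∃ M, ∀ n : ℕ,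
      birkhoffSum T f n x ≤ n * (∫ x, f x ∂μ + 1 / ((k : ℝ) + 1)) + M := by
    intro k
    have hk : (0 : ℝ) < 1 / ((k : ℝ) + 1) := by positivity
    set c := ∫ x, f x ∂μ + 1 / ((k : ℝ) + 1) with hc
    have := ae_bddAbove_birkhoffSum hT (f := fun x => f x - c) (hfm.sub_const c)
      (hf.sub (integrable_const c)) (by
        rw [integral_sub hf (integrable_const c)]; simp [hc]; positivity)
    filter_upwards [this] with x hx
    obtain ⟨M, hM⟩ := hx
    refine ⟨M, fun n => ?_⟩
    have := hM n
    simp only [birkhoffSum, Finset.sum_sub_distrib, Finset.sum_const, Finset.card_range,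
      nsmul_eq_mul] at this ⊢
    linarith
  filter_upwards [ae_all_iff.2 h] with x hx δ hδ
  obtain ⟨k, hk⟩ := exists_nat_one_div_lt hδ
  obtain ⟨M, hM⟩ := hx k
  refine ⟨M, fun n => (hM n).trans ?_⟩
  gcongr

/-- The pointwise ergodic theorem for an ergodic transformation. -/
theorem ae_tendsto_birkhoffSum_div [IsProbabilityMeasure μ] (hT : Ergodic T μ) {f : α → ℝ}
    (hf : Integrable f μ) :
    ∀ᵐ x ∂μ, Tendsto (fun n : ℕ => (∑ j ∈ Finset.range n, f (T^[j] x)) / n) atTop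
      (𝓝 (∫ x, f x ∂μ)) := by
  set g := hf.1.mk f
  have hgm : Measurable g := hf.1.stronglyMeasurable_mk.measurable
  have hfg : f =ᵐ[μ] g := hf.1.ae_eq_mk
  have hg : Integrable g μ := hf.congr hfg
  have h1 := ae_birkhoffSum_le hT hgm hg
  have h2 := ae_birkhoffSum_le hT hgm.neg hg.neg
  have h3 : ∀ᵐ x ∂μ, ∀ n, birkhoffSum T f n x = birkhoffSum T g n x :=
    ae_all_iff.2 fun n =>
      hT.toMeasurePreserving.quasiMeasurePreserving.birkhoffSum_ae_eq_of_ae_eq hfg n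
  filter_upwards [h1, h2, h3] with x hx1 hx2 hx3
  rw [integral_congr_ae hfg, Metric.tendsto_atTop]
  intro δ hδ
  obtain ⟨M, hM⟩ := hx1 (δ / 2) (by positivity)
  obtain ⟨M', hM'⟩ := hx2 (δ / 2) (by positivity)
  obtain ⟨N, hN⟩ := exists_nat_gt (max (max M M') 0 / (δ / 2))
  refine ⟨N + 1, fun n hn => ?_⟩
  have hn0 : (0 : ℝ) < n := by exact_mod_cast (by omega : 0 < n)
  have hb : max (max M M') 0 < (δ / 2) * n := by
    rw [div_lt_iff₀ (by positivity)] at hN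
    have : (N : ℝ) ≤ n := by exact_mod_cast (by omega : N ≤ n)
    nlinarith
  have hMl : M < δ / 2 * n := ((le_max_left _ _).trans (le_max_left _ _)).trans_lt hb
  have hMl' : M' < δ / 2 * n := ((le_max_right _ _).trans (le_max_left _ _)).trans_lt hb
  have e1 := hM n
  have e2 := hM' n
  have e3 : birkhoffSum T (-g) n x = - birkhoffSum T g n x := by
    simp [birkhoffSum, Finset.sum_neg_distrib]
  have e4 : ∫ x, (-g) x ∂μ = - ∫ x, g x ∂μ := by simp [integral_neg]
  rw [e3, e4] at e2
  have e5 : ∑ j ∈ Finset.range n, f (T^[j] x) = birkhoffSum T g n x := hx3 n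
  rw [e5, Real.dist_eq, abs_lt]
  constructor
  · rw [lt_sub_iff_add_lt, lt_div_iff₀ hn0]; nlinarith
  · rw [sub_lt_iff_lt_add, div_lt_iff₀ hn0]; nlinarith

end Birkhoff

/-! ### Variation of functions on subsets of the line. -/

section Variation

variable {s : Set ℝ}

theorem eVariationOn_add_le (u v : ℝ → ℝ) (s : Set ℝ) :
    eVariationOn (fun x => u x + v x) s ≤ eVariationOn u s + eVariationOn v s := by
  refine iSup_le fun p => ?_
  refine le_trans ?_ (add_le_add (eVariationOn.sum_le (f := u) (n := p.1) p.2.2.1 p.2.2.2)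
    (eVariationOn.sum_le (f := v) (n := p.1) p.2.2.1 p.2.2.2))
  rw [← Finset.sum_add_distrib]
  exact Finset.sum_le_sum fun i _ => edist_add_add_le _ _ _ _

theorem eVariationOn_sum_le {ι : Type*} (R : Finset ι) (u : ι → ℝ → ℝ) (s : Set ℝ) :
    eVariationOn (fun x => ∑ i ∈ R, u i x) s ≤ ∑ i ∈ R, eVariationOn (u i) s := by
  classical
  induction R using Finset.induction_on with
  | empty =>
    simp only [Finset.sum_empty, nonpos_iff_eq_zero]
    exact eVariationOn.constant_on (subsingleton_singleton.anti
      (by rintro _ ⟨x, -, rfl⟩; exact mem_singleton (0 : ℝ)))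
  | insert a R ha ih =>
    simp only [Finset.sum_insert ha]
    exact (eVariationOn_add_le _ _ _).trans (add_le_add le_rfl ih)

theorem eVariationOn_mul_le {u v : ℝ → ℝ} {A B : ℝ} (hu : ∀ x ∈ s, |u x| ≤ A)
    (hv : ∀ x ∈ s, |v x| ≤ B) :
    eVariationOn (fun x => u x * v x) s ≤
      ENNReal.ofReal B * eVariationOn u s + ENNReal.ofReal A * eVariationOn v s := by
  refine iSup_le fun p => ?_
  refine le_trans ?_ (add_le_add
    (mul_le_mul_right (eVariationOn.sum_le (f := u) (n := p.1) p.2.2.1 p.2.2.2) _)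
    (mul_le_mul_right (eVariationOn.sum_le (f := v) (n := p.1) p.2.2.1 p.2.2.2) _))
  rw [Finset.mul_sum, Finset.mul_sum, ← Finset.sum_add_distrib]
  refine Finset.sum_le_sum fun i _ => ?_
  set x := (p.2 : ℕ → ℝ) i
  set y := (p.2 : ℕ → ℝ) (i + 1)
  have hx : x ∈ s := p.2.2.2 i
  have hy : y ∈ s := p.2.2.2 (i + 1)
  have hA : 0 ≤ A := (abs_nonneg _).trans (hu x hx)
  have hB : 0 ≤ B := (abs_nonneg _).trans (hv x hx)
  rw [edist_dist, edist_dist, edist_dist, ← ENNReal.ofReal_mul hB, ← ENNReal.ofReal_mul hA,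
    ← ENNReal.ofReal_add (by positivity) (by positivity)]
  apply ENNReal.ofReal_le_ofReal
  simp only [Real.dist_eq]
  calc |u y * v y - u x * v x| = |v y * (u y - u x) + u x * (v y - v x)| := by ring_nf
    _ ≤ |v y| * |u y - u x| + |u x| * |v y - v x| := by
        rw [← abs_mul, ← abs_mul]; exact abs_add_le _ _
    _ ≤ B * |u y - u x| + A * |v y - v x| := by
        gcongr
        · exact hv y hy
        · exact hu x hx

/-- The indices of the sample points in `K` form an interval `[a, b]`, so outside it there are only
two jumps, on entering and on leaving `K`, each of size at most `M`. -/
theorem eVariationOn_indicator_le {K : Set ℝ} (hK : K.OrdConnected) {h : ℝ → ℝ} {M : ENNReal}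
    (hM : ∀ x ∈ K, ENNReal.ofReal |h x| ≤ M) (s : Set ℝ) :
    eVariationOn (K.indicator h) s ≤ eVariationOn h K + 2 * M := by
  classical
  refine iSup_le fun p => ?_
  obtain ⟨n, x, hx, hxs⟩ := p
  simp only
  by_cases hne : ∃ i ≤ n, x i ∈ K
  swap
  · push Not at hne
    rw [Finset.sum_eq_zero]
    · exact zero_le
    · intro i hi
      have hi := Finset.mem_range.1 hi
      rw [indicator_of_notMem (hne i hi.le), indicator_of_notMem (hne (i + 1) hi), edist_self]
  set P : Finset ℕ := (Finset.range (n + 1)).filter fun i => x i ∈ K with hP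
  have hPm : ∀ i, i ∈ P ↔ i ≤ n ∧ x i ∈ K := fun i => by simp [hP]
  have hPne : P.Nonempty := by
    obtain ⟨i, hi, hiK⟩ := hne
    exact ⟨i, (hPm i).2 ⟨hi, hiK⟩⟩
  set a := P.min' hPne
  set b := P.max' hPne
  have ha := (hPm a).1 (P.min'_mem hPne)
  have hb := (hPm b).1 (P.max'_mem hPne)
  have hmid : ∀ i ∈ Icc a b, x i ∈ K := fun i hi =>
    hK.out ha.2 hb.2 ⟨hx hi.1, hx hi.2⟩
  have hle : ∀ i ≤ n, x i ∈ K → i ∈ Icc a b := fun i hi hiK =>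
    ⟨P.min'_le i ((hPm i).2 ⟨hi, hiK⟩), P.le_max' i ((hPm i).2 ⟨hi, hiK⟩)⟩
  have hterm : ∀ i ∈ Finset.range n,
      edist (K.indicator h (x (i + 1))) (K.indicator h (x i)) ≤
        (if i ∈ Finset.Ico a b then edist (h (x (i + 1))) (h (x i)) else 0)
        + ((if i + 1 = a then M else 0) + (if i = b then M else 0)) := by
    intro i hi
    have hi := Finset.mem_range.1 hi
    by_cases h1 : x i ∈ K <;> by_cases h2 : x (i + 1) ∈ K
    · have m1 := hle i hi.le h1
      have m2 := hle (i + 1) hi h2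
      rw [indicator_of_mem h1, indicator_of_mem h2,
        if_pos (Finset.mem_Ico.2 ⟨m1.1, Nat.lt_of_succ_le m2.2⟩)]
      exact le_self_add
    · have m1 := hle i hi.le h1
      have hib : i = b := by
        by_contra hne
        exact h2 (hmid (i + 1) ⟨m1.1.trans (Nat.le_succ _),
          Nat.succ_le_of_lt (lt_of_le_of_ne m1.2 hne)⟩)
      rw [indicator_of_mem h1, indicator_of_notMem h2, if_pos hib, edist_dist, Real.dist_eq,
        zero_sub, abs_neg]
      exact (hM _ h1).trans (le_add_self.trans le_add_self)
    · have m2 := hle (i + 1) hi h2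
      have hia : i + 1 = a := by
        by_contra hne
        exact h1 (hmid i ⟨by have := m2.1; omega, by have := m2.2; omega⟩)
      rw [indicator_of_mem h2, indicator_of_notMem h1, if_pos hia, edist_dist, Real.dist_eq,
        sub_zero]
      exact (hM _ h2).trans (le_self_add.trans le_add_self)
    · rw [indicator_of_notMem h1, indicator_of_notMem h2, edist_self]
      exact zero_le
  refine (Finset.sum_le_sum hterm).trans ?_
  rw [Finset.sum_add_distrib, Finset.sum_add_distrib, two_mul]
  gcongr
  · rw [← Finset.sum_filter]
    refine le_trans (Finset.sum_le_sum_of_subset (t := Finset.Ico a b) ?_)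
      (eVariationOn.sum_le_of_monotoneOn_Icc (hx.monotoneOn _) hmid)
    intro i hi
    exact (Finset.mem_filter.1 hi).2
  -- For `a = 0` there is no entering jump; the truncated subtraction only enlarges the bound.
  · calc _ ≤ ∑ i ∈ Finset.range n, (if i = a - 1 then M else 0) := by
          refine Finset.sum_le_sum fun i _ => ?_
          split_ifs <;> first | exact le_rfl | exact zero_le | omega
      _ ≤ M := by rw [Finset.sum_ite_eq']; split_ifs <;> simp
  · rw [Finset.sum_ite_eq']; split_ifs <;> simp

/-- The variations over disjoint intervals add up to at most the total variation. -/
theorem sum_eVariationOn_le (u : ℝ → ℝ) {J : Set ℝ} (R : Finset (Set ℝ))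
    (hconn : ∀ Z ∈ R, Z.OrdConnected) (hne : ∀ Z ∈ R, Z.Nonempty) (hsub : ∀ Z ∈ R, Z ⊆ J)
    (hdisj : ∀ Z ∈ R, ∀ Z' ∈ R, Z ≠ Z' → Disjoint Z Z') :
    ∑ Z ∈ R, eVariationOn u Z ≤ eVariationOn u J := by
  classical
  set p : Set ℝ → ℝ := fun Z => if h : Z.Nonempty then h.choose else 0 with hp
  have hpm : ∀ Z : Set ℝ, Z.Nonempty → p Z ∈ Z := fun Z hZ => by
    simp only [hp, dif_pos hZ]; exact hZ.choose_spec
  suffices h : ∑ Z ∈ R, eVariationOn u Z ≤ eVariationOn u (⋃ Z ∈ R, Z) from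
    h.trans (eVariationOn.mono u (iUnion₂_subset hsub))
  clear hsub
  -- Intervals are added from left to right, so each new one lies to the right of the union and the
  -- variations add.
  induction R using Finset.induction_on_max_value p with
  | empty => simp
  | insert Z R hZ hmax ih =>
    have hmem : ∀ W ∈ R, W ∈ insert Z R := fun W hW => Finset.mem_insert_of_mem hW
    rw [Finset.sum_insert hZ, Finset.set_biUnion_insert, union_comm, add_comm]
    refine le_trans (add_le_add (ih (fun W hW => hconn W (hmem W hW))
      (fun W hW => hne W (hmem W hW))
      (fun W hW W' hW' => hdisj W (hmem W hW) W' (hmem W' hW'))) le_rfl)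
      (eVariationOn.add_le_union u ?_)
    intro x hx y hy
    obtain ⟨W, hW, hxW⟩ := mem_iUnion₂.1 hx
    have hWZ : W ≠ Z := fun h => hZ (h ▸ hW)
    have hd := hdisj W (hmem W hW) Z (Finset.mem_insert_self _ _) hWZ
    have hpW := hpm W (hne W (hmem W hW))
    have hpZ := hpm Z (hne Z (Finset.mem_insert_self _ _))
    by_contra hlt
    push Not at hlt
    have hcW := hconn W (hmem W hW)
    have hcZ := hconn Z (Finset.mem_insert_self _ _)
    rcases le_total (p W) y with h1 | h1
    · exact Set.disjoint_left.1 hd (hcW.out hpW hxW ⟨h1, hlt.le⟩) hy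
    · exact Set.disjoint_left.1 hd hpW (hcZ.out hy hpZ ⟨h1, hmax W hW⟩)

theorem countable_not_continuousWithinAt_of_boundedVariationOn {f : ℝ → ℝ}
    (hf : BoundedVariationOn f s) : {x ∈ s | ¬ ContinuousWithinAt f s x}.Countable := by
  obtain ⟨p, q, hp, hq, rfl⟩ := hf.locallyBoundedVariationOn.exists_monotoneOn_sub_monotoneOn
  refine (hp.countable_not_continuousWithinAt.union hq.countable_not_continuousWithinAt).mono ?_
  rintro x ⟨hx, hc⟩
  by_contra h
  simp only [mem_union, mem_ofPred_eq, not_or, not_and, not_not] at h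
  exact hc ((h.1 hx).sub (h.2 hx))

/-- Two functions of bounded variation that agree almost everywhere on an interval agree there
outside a countable set. -/
theorem countable_ne_of_ae_eq {a b : ℝ} (hab : a < b) {f g : ℝ → ℝ}
    (hf : BoundedVariationOn f (Icc a b)) (hg : BoundedVariationOn g (Icc a b))
    (hfg : f =ᵐ[volume.restrict (Icc a b)] g) : {x ∈ Icc a b | f x ≠ g x}.Countable := by
  refine ((countable_not_continuousWithinAt_of_boundedVariationOn hf).union
    (countable_not_continuousWithinAt_of_boundedVariationOn hg)).mono ?_
  rintro x ⟨hx, hne⟩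
  by_contra h
  simp only [mem_union, mem_ofPred_eq, not_or, not_and, not_not] at h
  -- At a common continuity point a nonzero difference persists on a neighbourhood, which meets the
  -- open interval in positive measure.
  have hc : ContinuousWithinAt (fun y => f y - g y) (Icc a b) x := (h.1 hx).sub (h.2 hx)
  have hev : ∀ᶠ y in 𝓝[Icc a b] x, f y - g y ≠ 0 :=
    hc.eventually_ne (sub_ne_zero.2 hne)
  obtain ⟨U, hU, hxU, hUs⟩ := mem_nhdsWithin.1 hev
  have hxcl : x ∈ closure (Ioo a b) := by rwa [closure_Ioo hab.ne]
  obtain ⟨z, hzU, hz⟩ := mem_closure_iff.1 hxcl U hU hxU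
  have hpos : 0 < volume (U ∩ Ioo a b) := (hU.inter isOpen_Ioo).measure_pos _ ⟨z, hzU, hz⟩
  have hzero : volume (U ∩ Ioo a b) = 0 := by
    rw [Filter.EventuallyEq, ae_restrict_iff' measurableSet_Icc] at hfg
    refine measure_mono_null ?_ hfg
    rintro y ⟨hyU, hy⟩ hcon
    exact hUs ⟨hyU, Ioo_subset_Icc_self hy⟩ (sub_eq_zero.2 (hcon (Ioo_subset_Icc_self hy)))
  exact hpos.ne' hzero

end Variation

namespace RandomMap

variable {Ω : Type*} [MeasurableSpace Ω]

/-- A nearly minimal representative is truncated between `a` and `b`; truncation is 1-Lipschitz and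
does not increase variation. -/
theorem exists_good_representative (S : RandomMap Ω) (hS : S.lo < S.hi) {f : ℝ → ℝ}
    (hf : BoundedVariationOn f S.I) {a b δ : ℝ} (hab : a ≤ b) (hδ : 0 < δ)
    (hfa : ∀ᵐ x ∂volume.restrict S.I, a ≤ f x) (hfb : ∀ᵐ x ∂volume.restrict S.I, f x ≤ b) :
    ∃ u : ℝ → ℝ, {x ∈ S.I | f x ≠ u x}.Countable ∧ (∀ x ∈ S.I, a ≤ u x ∧ u x ≤ b) ∧
      eVariationOn u S.I ≤ ENNReal.ofReal (S.var f + δ) := by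
  set v := ⨅ h : {h : ℝ → ℝ // h =ᵐ[volume.restrict S.I] f}, eVariationOn h.1 S.I with hv
  have hvtop : v ≠ ⊤ := ne_top_of_le_ne_top hf (iInf_le_of_le ⟨f, ae_eq_refl f⟩ le_rfl)
  have hlt : v < v + ENNReal.ofReal δ := ENNReal.lt_add_right hvtop (by simpa using hδ)
  obtain ⟨⟨h, hh⟩, hh2⟩ := iInf_lt_iff.1 hlt
  simp only at hh2
  have hvar : v + ENNReal.ofReal δ = ENNReal.ofReal (S.var f + δ) := by
    rw [RandomMap.var, ENNReal.ofReal_add ENNReal.toReal_nonneg hδ.le]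
    congr 1
    exact (ENNReal.ofReal_toReal hvtop).symm
  set c : ℝ → ℝ := fun y => max a (min b y)
  have hc : LipschitzWith 1 c := LipschitzWith.const_max (LipschitzWith.const_min LipschitzWith.id _) _
  have hvu : eVariationOn (c ∘ h) S.I ≤ eVariationOn h S.I := by
    have := (hc.lipschitzOnWith (s := univ)).comp_eVariationOn_le (g := h) (s := S.I)
      (mapsTo_univ _ _)
    simpa using this
  have hu : eVariationOn (c ∘ h) S.I ≤ ENNReal.ofReal (S.var f + δ) :=
    hvu.trans (hvar ▸ hh2.le)
  refine ⟨c ∘ h, ?_, fun x _ => ⟨le_max_left _ _, max_le hab (min_le_left _ _)⟩, hu⟩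
  refine countable_ne_of_ae_eq hS hf (ne_top_of_le_ne_top ENNReal.ofReal_ne_top hu) ?_
  filter_upwards [hh, hfa, hfb] with x h1 h2 h3
  simp [c, h1, h2, h3]

end RandomMap

/-! ### Sums over marked and unmarked points of the line. -/

section Counting

variable {ι : Type*} [DecidableEq ι]

/-- Layer-cake argument. A level `t` lies in `(w i, w (φ i)]` for at most `k` indices: a marked `b`
between two such indices `a`, `a'` would give `t ≤ w (φ a) ≤ w b ≤ w a' < t`. Integrating over `t ∈
(0, V]` bounds the sum of the lengths of these intervals. -/
theorem sum_sub_le_of_contiguous {D M : Finset ι} {p w : ι → ℝ} {φ : ι → ι} {k V : ℝ}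
    (hw : ∀ i ∈ D ∪ M, ∀ j ∈ D ∪ M, p i ≤ p j → w i ≤ w j) (hw0 : ∀ i ∈ D ∪ M, 0 ≤ w i)
    (hwV : ∀ i ∈ D ∪ M, w i ≤ V) (hk0 : 0 ≤ k) (hV : 0 ≤ V) (hφM : ∀ i ∈ D, φ i ∈ M)
    (hφ : ∀ i ∈ D, p i < p (φ i)) (hφmin : ∀ i ∈ D, ∀ b ∈ M, p i < p b → p (φ i) ≤ p b)
    (hk : ∀ A ⊆ D, (∀ b ∈ M, ∀ a ∈ A, ∀ a' ∈ A, ¬ (p a < p b ∧ p b < p a')) → (A.card : ℝ) ≤ k) :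
    ∑ i ∈ D, (w (φ i) - w i) ≤ k * V := by
  have hD : ∀ i ∈ D, i ∈ D ∪ M := fun i hi => Finset.mem_union_left _ hi
  have hM : ∀ i ∈ M, i ∈ D ∪ M := fun i hi => Finset.mem_union_right _ hi
  have hle : ∀ i ∈ D, 0 ≤ w (φ i) - w i := fun i hi =>
    sub_nonneg.2 (hw i (hD i hi) _ (hM _ (hφM i hi)) (hφ i hi).le)
  have hcount : ∀ t : ℝ, (∑ i ∈ D, (Ioc (w i) (w (φ i))).indicator (1 : ℝ → ENNReal) t) ≤
      (Ioc 0 V).indicator (fun _ => ENNReal.ofReal k) t := by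
    intro t
    simp only [indicator_apply, Pi.one_apply]
    rw [Finset.sum_ite, Finset.sum_const_zero, add_zero, Finset.sum_const, nsmul_one]
    set A := D.filter fun i => t ∈ Ioc (w i) (w (φ i)) with hA
    split_ifs with ht
    · have hc : (A.card : ℝ) ≤ k := by
        refine hk A (Finset.filter_subset _ _) fun b hb a ha a' ha' h => ?_
        obtain ⟨ha, hta⟩ := Finset.mem_filter.1 ha
        obtain ⟨ha', hta'⟩ := Finset.mem_filter.1 ha'
        have h1 : w (φ a) ≤ w b := hw _ (hM _ (hφM a ha)) b (hM b hb) (hφmin a ha b hb h.1)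
        have h2 : w b ≤ w a' := hw b (hM b hb) a' (hD a' ha') h.2.le
        linarith [hta.2, hta'.1]
      rw [← ENNReal.ofReal_natCast]
      exact ENNReal.ofReal_le_ofReal hc
    · have : A = ∅ := by
        rw [Finset.eq_empty_iff_forall_notMem]
        intro i hi
        obtain ⟨hi, hti⟩ := Finset.mem_filter.1 hi
        exact ht ⟨(hw0 i (hD i hi)).trans_lt hti.1, hti.2.trans (hwV _ (hM _ (hφM i hi)))⟩
      simp [this]
  have hint := lintegral_mono (μ := volume) hcount
  rw [lintegral_finsetSum _ (fun i _ => measurable_one.indicator measurableSet_Ioc),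
    lintegral_indicator measurableSet_Ioc, setLIntegral_const, Real.volume_Ioc, sub_zero,
    ← ENNReal.ofReal_mul hk0] at hint
  have : ∀ i ∈ D, ∫⁻ t, (Ioc (w i) (w (φ i))).indicator (1 : ℝ → ENNReal) t
      = ENNReal.ofReal (w (φ i) - w i) := fun i _ => by
    rw [lintegral_indicator_one measurableSet_Ioc, Real.volume_Ioc]
  rw [Finset.sum_congr rfl this, ← ENNReal.ofReal_sum_of_nonneg hle] at hint
  exact (ENNReal.ofReal_le_ofReal_iff (by positivity)).1 hint

/-- Each unmarked `i` is moved to the nearest marked element `φ i` on its right. A marked element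
receives at most `k` indices, and the error `w (φ i) - w i` is summed by `sum_sub_le_of_contiguous`.
-/
theorem sum_le_of_contiguous_right {D M : Finset ι} {p w v : ι → ℝ} {k V : ℝ}
    (hw : ∀ i ∈ D ∪ M, ∀ j ∈ D ∪ M, p i ≤ p j → w i ≤ w j) (hw0 : ∀ i ∈ D ∪ M, 0 ≤ w i)
    (hwV : ∀ i ∈ D ∪ M, w i ≤ V) (hk0 : 0 ≤ k) (hV : 0 ≤ V) (hv0 : ∀ i ∈ M, 0 ≤ v i)
    (hv : ∀ i ∈ D ∪ M, ∀ j ∈ D ∪ M, p i ≤ p j → v i ≤ v j + (w j - w i))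
    (hright : ∀ i ∈ D, ∃ b ∈ M, p i < p b)
    (hk : ∀ A ⊆ D, (∀ b ∈ M, ∀ a ∈ A, ∀ a' ∈ A, ¬ (p a < p b ∧ p b < p a')) → (A.card : ℝ) ≤ k) :
    ∑ i ∈ D, v i ≤ k * ∑ b ∈ M, v b + k * V := by
  have hex : ∀ i ∈ D, ∃ b ∈ M, p i < p b ∧ ∀ b' ∈ M, p i < p b' → p b ≤ p b' := by
    intro i hi
    obtain ⟨b, hb, hib⟩ := hright i hi
    obtain ⟨c, hc, hmin⟩ := (M.filter fun b => p i < p b).exists_min_image p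
      ⟨b, Finset.mem_filter.2 ⟨hb, hib⟩⟩
    obtain ⟨hcM, hic⟩ := Finset.mem_filter.1 hc
    exact ⟨c, hcM, hic, fun b' hb' h => hmin b' (Finset.mem_filter.2 ⟨hb', h⟩)⟩
  set φ : ι → ι := fun i => if h : i ∈ D then (hex i h).choose else i with hφdef
  have hspec : ∀ i (h : i ∈ D), φ i ∈ M ∧ p i < p (φ i) ∧ ∀ b' ∈ M, p i < p b' → p (φ i) ≤ p b' :=
    fun i h => by simp only [hφdef, dif_pos h]; exact (hex i h).choose_spec
  have hD : ∀ i ∈ D, i ∈ D ∪ M := fun i hi => Finset.mem_union_left _ hi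
  have hM : ∀ i ∈ M, i ∈ D ∪ M := fun i hi => Finset.mem_union_right _ hi
  have h1 := sum_sub_le_of_contiguous (φ := φ) hw hw0 hwV hk0 hV (fun i hi => (hspec i hi).1)
    (fun i hi => (hspec i hi).2.1) (fun i hi => (hspec i hi).2.2) hk
  have h2 : ∑ i ∈ D, v (φ i) ≤ k * ∑ b ∈ M, v b := by
    rw [← Finset.sum_fiberwise_of_maps_to (t := M) (g := φ) (fun i hi => (hspec i hi).1),
      Finset.mul_sum]
    refine Finset.sum_le_sum fun b hb => ?_
    have : ∀ i ∈ D.filter (fun i => φ i = b), v (φ i) = v b := fun i hi => by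
      rw [(Finset.mem_filter.1 hi).2]
    rw [Finset.sum_congr rfl this, Finset.sum_const, nsmul_eq_mul]
    refine mul_le_mul_of_nonneg_right (hk _ (Finset.filter_subset _ _) ?_) (hv0 b hb)
    rintro c hc a ha a' ha' ⟨hac, hca'⟩
    obtain ⟨ha, hab⟩ := Finset.mem_filter.1 ha
    obtain ⟨ha', hab'⟩ := Finset.mem_filter.1 ha'
    have e1 := (hspec a ha).2.2 c hc hac
    have e2 := (hspec a' ha').2.1
    rw [hab] at e1
    rw [hab'] at e2
    linarith
  have h3 : ∑ i ∈ D, v i ≤ ∑ i ∈ D, (v (φ i) + (w (φ i) - w i)) :=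
    Finset.sum_le_sum fun i hi => hv i (hD i hi) _ (hM _ (hspec i hi).1) (hspec i hi).2.1.le
  rw [Finset.sum_add_distrib] at h3
  linarith

/-- If marked elements separate the others into groups of at most `k`, then the sum of `v` is
controlled by the sum of `v` over the marked elements and by the total increase of `w`. -/
theorem sum_le_of_contiguous {R M : Finset ι} {p w v : ι → ℝ} {k V : ℝ} (hMR : M ⊆ R)
    (hMne : M.Nonempty) (hp : Set.InjOn p R)
    (hw : ∀ i ∈ R, ∀ j ∈ R, p i ≤ p j → w i ≤ w j) (hw0 : ∀ i ∈ R, 0 ≤ w i)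
    (hwV : ∀ i ∈ R, w i ≤ V) (hk0 : 0 ≤ k) (hV : 0 ≤ V) (hv0 : ∀ i ∈ R, 0 ≤ v i)
    (hv : ∀ i ∈ R, ∀ j ∈ R, |v i - v j| ≤ |w i - w j|)
    (hk : ∀ A ⊆ R \ M, (∀ b ∈ M, ∀ a ∈ A, ∀ a' ∈ A, ¬ (p a < p b ∧ p b < p a')) →
      (A.card : ℝ) ≤ k) :
    ∑ i ∈ R, v i ≤ (1 + 2 * k) * ∑ b ∈ M, v b + 2 * k * V := by
  set D₁ := (R \ M).filter fun i => ∃ b ∈ M, p i < p b with hD₁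
  set D₂ := (R \ M).filter fun i => ¬ ∃ b ∈ M, p i < p b with hD₂
  have hsub₁ : D₁ ⊆ R \ M := Finset.filter_subset _ _
  have hsub₂ : D₂ ⊆ R \ M := Finset.filter_subset _ _
  have hR₁ : ∀ i ∈ D₁ ∪ M, i ∈ R := fun i hi => by
    rcases Finset.mem_union.1 hi with h | h
    · exact (Finset.mem_sdiff.1 (hsub₁ h)).1
    · exact hMR h
  have hR₂ : ∀ i ∈ D₂ ∪ M, i ∈ R := fun i hi => by
    rcases Finset.mem_union.1 hi with h | h
    · exact (Finset.mem_sdiff.1 (hsub₂ h)).1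
    · exact hMR h
  have hsplit : ∑ i ∈ R, v i = ∑ i ∈ D₁, v i + ∑ i ∈ D₂, v i + ∑ b ∈ M, v b := by
    rw [Finset.sum_filter_add_sum_filter_not, Finset.sum_sdiff hMR]
  have h1 : ∑ i ∈ D₁, v i ≤ k * ∑ b ∈ M, v b + k * V := by
    refine sum_le_of_contiguous_right (p := p) (w := w)
      (fun i hi j hj => hw i (hR₁ i hi) j (hR₁ j hj)) (fun i hi => hw0 i (hR₁ i hi))
      (fun i hi => hwV i (hR₁ i hi)) hk0 hV (fun i hi => hv0 i (hMR hi))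
      (fun i hi j hj hij => ?_) (fun i hi => (Finset.mem_filter.1 hi).2)
      (fun A hA => hk A (hA.trans hsub₁))
    have e1 := hv i (hR₁ i hi) j (hR₁ j hj)
    have e2 := hw i (hR₁ i hi) j (hR₁ j hj) hij
    rw [abs_sub_comm (w i), abs_of_nonneg (sub_nonneg.2 e2)] at e1
    linarith [le_abs_self (v i - v j)]
  -- Elements with nothing marked on their right have a marked element on their left; the reflection
  -- `p ↦ -p`, `w ↦ V - w` reduces to the previous case.
  have h2 : ∑ i ∈ D₂, v i ≤ k * ∑ b ∈ M, v b + k * V := by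
    refine sum_le_of_contiguous_right (p := fun i => - p i) (w := fun i => V - w i)
      (fun i hi j hj hij => ?_) (fun i hi => sub_nonneg.2 (hwV i (hR₂ i hi)))
      (fun i hi => sub_le_self _ (hw0 i (hR₂ i hi))) hk0 hV (fun i hi => hv0 i (hMR hi))
      (fun i hi j hj hij => ?_) (fun i hi => ?_)
      (fun A hA h => hk A (hA.trans hsub₂) fun b hb a ha a' ha' hc =>
        h b hb a' ha' a ha ⟨neg_lt_neg hc.2, neg_lt_neg hc.1⟩)
    · exact sub_le_sub_left (hw j (hR₂ j hj) i (hR₂ i hi) (neg_le_neg_iff.1 hij)) _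
    · have e1 := hv i (hR₂ i hi) j (hR₂ j hj)
      have e2 := hw j (hR₂ j hj) i (hR₂ i hi) (neg_le_neg_iff.1 hij)
      rw [abs_of_nonneg (sub_nonneg.2 e2)] at e1
      linarith [le_abs_self (v i - v j)]
    · obtain ⟨hi, hnot⟩ := Finset.mem_filter.1 hi
      obtain ⟨hiR, hiM⟩ := Finset.mem_sdiff.1 hi
      obtain ⟨b, hb⟩ := hMne
      push Not at hnot
      refine ⟨b, hb, neg_lt_neg (lt_of_le_of_ne (hnot b hb) fun h => hiM ?_)⟩
      rwa [← hp (hMR hb) hiR h]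
  rw [hsplit]
  linarith

end Counting

/-! ### The Lasota–Yorke inequality for a single map. -/

section LasotaYorke

/-- `w x` is the variation of `u` over the part of `J` to the left of `x`. -/
theorem exists_monotone_variation {u : ℝ → ℝ} {J : Set ℝ} {V : ℝ}
    (hu : eVariationOn u J ≤ ENNReal.ofReal V) (hV : 0 ≤ V) :
    ∃ w : ℝ → ℝ, Monotone w ∧ (∀ x, 0 ≤ w x) ∧ (∀ x, w x ≤ V) ∧
      ∀ x ∈ J, ∀ y ∈ J, |u x - u y| ≤ |w x - w y| := by
  have hfin : ∀ x, eVariationOn u (J ∩ Iic x) ≤ ENNReal.ofReal V := fun x =>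
    (eVariationOn.mono u inter_subset_left).trans hu
  have hne : ∀ x, eVariationOn u (J ∩ Iic x) ≠ ⊤ := fun x =>
    ne_top_of_le_ne_top ENNReal.ofReal_ne_top (hfin x)
  have hmono : Monotone fun x => (eVariationOn u (J ∩ Iic x)).toReal := fun x y hxy =>
    ENNReal.toReal_mono (hne y) (eVariationOn.mono u (inter_subset_inter_right _ (Iic_subset_Iic.2 hxy)))
  refine ⟨fun x => (eVariationOn u (J ∩ Iic x)).toReal, hmono, fun x => ENNReal.toReal_nonneg,
    fun x => ENNReal.toReal_le_of_le_ofReal hV (hfin x), ?_⟩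
  have key : ∀ x ∈ J, ∀ y ∈ J, x ≤ y → |u x - u y| ≤
      (eVariationOn u (J ∩ Iic y)).toReal - (eVariationOn u (J ∩ Iic x)).toReal := by
    intro x hx y hy hxy
    have h1 : eVariationOn u (J ∩ Iic x) + eVariationOn u {x, y} ≤ eVariationOn u (J ∩ Iic y) := by
      refine (eVariationOn.add_le_union u ?_).trans (eVariationOn.mono u ?_)
      · rintro a ⟨-, ha⟩ b (rfl | rfl)
        · exact ha
        · exact le_trans ha hxy
      · rintro a (⟨h1, h2⟩ | rfl | rfl)
        · exact ⟨h1, le_trans h2 hxy⟩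
        · exact ⟨hx, hxy⟩
        · exact ⟨hy, mem_Iic.2 le_rfl⟩
    rw [eVariationOn.pair, edist_dist, Real.dist_eq] at h1
    have h2 := ENNReal.toReal_mono (hne y) h1
    rw [ENNReal.toReal_add (hne x) ENNReal.ofReal_ne_top, ENNReal.toReal_ofReal (abs_nonneg _)] at h2
    linarith
  intro x hx y hy
  rcases le_total x y with h | h
  · rw [abs_sub_comm, abs_sub_comm _ (ENNReal.toReal _)]
    rw [abs_sub_comm]
    exact (key x hx y hy h).trans (le_abs_self _)
  · rw [abs_sub_comm]
    exact (key y hy x hx h).trans (le_abs_self _)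

/-- The transfer operator of a map `τ` with weight `G` along a finite family of injectivity
intervals. -/
noncomputable def pieceTransfer (R : Finset (Set ℝ)) (τ w : ℝ → ℝ) (x : ℝ) : ℝ :=
  ∑ Z ∈ R, (τ '' Z).indicator (fun y => w (Function.invFunOn τ Z y)) x

theorem eVariationOn_comp_invFunOn_le {τ w : ℝ → ℝ} {Z : Set ℝ}
    (hmono : StrictMonoOn τ Z ∨ StrictAntiOn τ Z) :
    eVariationOn (fun y => w (Function.invFunOn τ Z y)) (τ '' Z) ≤ eVariationOn w Z := by
  have hmaps : MapsTo (Function.invFunOn τ Z) (τ '' Z) Z := fun y hy =>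
    Function.invFunOn_mem hy
  have hinv : ∀ y ∈ τ '' Z, τ (Function.invFunOn τ Z y) = y := fun y hy =>
    Function.invFunOn_eq hy
  rcases hmono with h | h
  · refine eVariationOn.comp_le_of_monotoneOn w _ (fun x hx y hy hxy => ?_) hmaps
    by_contra hlt
    push Not at hlt
    have := h (hmaps hy) (hmaps hx) hlt
    rw [hinv x hx, hinv y hy] at this
    exact absurd hxy (not_le.2 this)
  · refine eVariationOn.comp_le_of_antitoneOn w _ (fun x hx y hy hxy => ?_) hmaps
    by_contra hlt
    push Not at hlt
    have := h (hmaps hx) (hmaps hy) hlt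
    rw [hinv x hx, hinv y hy] at this
    exact absurd hxy (not_le.2 this)

theorem ordConnected_image {τ : ℝ → ℝ} {Z : Set ℝ} (hZ : Z.OrdConnected) (hc : ContinuousOn τ Z) :
    (τ '' Z).OrdConnected :=
  (hZ.isPreconnected.image τ hc).ordConnected

/-- Keeping only the terms of the full pieces bounds the values of `u` at the preimages of `x` in
these pieces by the operator at `x`. -/
theorem le_pieceTransfer {J : Set ℝ} {R M : Finset (Set ℝ)} {τ G u : ℝ → ℝ} {a : ℝ}
    (hMR : M ⊆ R) (hsub : ∀ Z ∈ R, Z ⊆ J) (hfull : ∀ Z ∈ M, J ⊆ τ '' Z) (ha : 0 ≤ a)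
    (hG : ∀ Z ∈ R, ∀ x ∈ Z, a ≤ G x) (hu0 : ∀ x ∈ J, 0 ≤ u x) {x : ℝ} (hx : x ∈ J) :
    a * ∑ Z ∈ M, u (Function.invFunOn τ Z x) ≤ pieceTransfer R τ (fun y => u y * G y) x := by
  rw [Finset.mul_sum]
  refine le_trans (Finset.sum_le_sum fun Z hZ => ?_)
    (Finset.sum_le_sum_of_subset_of_nonneg hMR fun Z hZ _ => ?_)
  · rw [indicator_of_mem (hfull Z hZ hx), mul_comm]
    have hm := Function.invFunOn_mem (hfull Z hZ hx)
    exact mul_le_mul_of_nonneg_left (hG Z (hMR hZ) _ hm) (hu0 _ (hsub Z (hMR hZ) hm))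
  · refine indicator_apply_nonneg fun h => ?_
    have hm := Function.invFunOn_mem h
    exact mul_nonneg (hu0 _ (hsub Z hZ hm)) (ha.trans (hG Z hZ _ hm))

/-- A Lasota–Yorke inequality. -/
theorem eVariationOn_pieceTransfer_le {J : Set ℝ} {R M : Finset (Set ℝ)} {τ G u : ℝ → ℝ}
    {a b s k V : ℝ} (hMR : M ⊆ R) (hMne : M.Nonempty)
    (hconn : ∀ Z ∈ R, Z.OrdConnected) (hne : ∀ Z ∈ R, Z.Nonempty) (hsub : ∀ Z ∈ R, Z ⊆ J)
    (hdisj : ∀ Z ∈ R, ∀ Z' ∈ R, Z ≠ Z' → Disjoint Z Z')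
    (hcont : ∀ Z ∈ R, ContinuousOn τ Z)
    (hmono : ∀ Z ∈ R, StrictMonoOn τ Z ∨ StrictAntiOn τ Z)
    (hfull : ∀ Z ∈ M, J ⊆ τ '' Z) (ha : 0 < a) (hs : 0 ≤ s) (hk0 : 0 ≤ k) (hV : 0 ≤ V)
    (hG : ∀ Z ∈ R, ∀ x ∈ Z, a ≤ G x ∧ G x ≤ b)
    (hGvar : ∀ Z ∈ R, eVariationOn G Z ≤ ENNReal.ofReal (b * s))
    (hk : ∀ A ⊆ R \ M, (∀ Z ∈ M, ∀ W ∈ A, ∀ W' ∈ A, ¬ ((∀ x ∈ W, ∀ y ∈ Z, x < y) ∧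
      ∀ x ∈ Z, ∀ y ∈ W', x < y)) → (A.card : ℝ) ≤ k)
    (hu0 : ∀ x ∈ J, 0 ≤ u x) (hu : eVariationOn u J ≤ ENNReal.ofReal V) (x : ℝ) (hx : x ∈ J) :
    eVariationOn (pieceTransfer R τ fun y => u y * G y) J ≤
      ENNReal.ofReal (b * (s + 3) * (1 + 2 * k) *
        (pieceTransfer R τ (fun y => u y * G y) x / a + V)) := by
  classical
  have hb : 0 ≤ b := by
    obtain ⟨Z, hZ⟩ := hMne
    obtain ⟨y, hy⟩ := hne Z (hMR hZ)
    have := hG Z (hMR hZ) y hy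
    linarith
  -- a point in each piece, over `x` in the marked ones
  set p : Set ℝ → ℝ := fun Z => if Z ∈ M then Function.invFunOn τ Z x else
    if h : Z.Nonempty then h.choose else 0 with hp
  have hpM : ∀ Z ∈ M, p Z = Function.invFunOn τ Z x := fun Z hZ => by simp [hp, hZ]
  have hpZ : ∀ Z ∈ R, p Z ∈ Z := fun Z hZ => by
    by_cases hZM : Z ∈ M
    · rw [hpM Z hZM]; exact Function.invFunOn_mem (hfull Z hZM hx)
    · simp only [hp, hZM, if_false, dif_pos (hne Z hZ)]
      exact (hne Z hZ).choose_spec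
  obtain ⟨w, hwm, hw0, hwV, hwu⟩ := exists_monotone_variation hu hV
  have hsep : ∀ Z ∈ R, ∀ W ∈ R, p Z < p W → ∀ x ∈ Z, ∀ y ∈ W, x < y := by
    intro Z hZ W hW hlt x hx y hy
    have hd := hdisj Z hZ W hW (fun h => hlt.ne (by rw [h]))
    by_contra hle
    push Not at hle
    rcases le_total (p Z) y with h1 | h1
    · exact Set.disjoint_left.1 hd ((hconn Z hZ).out (hpZ Z hZ) hx ⟨h1, hle⟩) hy
    · exact Set.disjoint_left.1 hd (hpZ Z hZ) ((hconn W hW).out hy (hpZ W hW) ⟨h1, hlt.le⟩)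
  have hpJ : ∀ Z ∈ R, p Z ∈ J := fun Z hZ => hsub Z hZ (hpZ Z hZ)
  have hsum : ∑ Z ∈ R, u (p Z) ≤ (1 + 2 * k) * ∑ Z ∈ M, u (p Z) + 2 * k * V := by
    refine sum_le_of_contiguous (p := p) (w := fun Z => w (p Z)) hMR hMne ?_
      (fun i _ j _ h => hwm h) (fun i _ => hw0 _) (fun i _ => hwV _) hk0 hV
      (fun i hi => hu0 _ (hpJ i hi)) (fun i hi j hj => hwu _ (hpJ i hi) _ (hpJ j hj)) ?_
    · intro Z hZ W hW h
      by_contra hne'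
      exact Set.disjoint_left.1 (hdisj Z hZ W hW hne') (hpZ Z hZ) (h ▸ hpZ W hW)
    · intro A hA hsepA
      refine hk A hA fun Z hZ W hW W' hW' h => hsepA Z hZ W hW W' hW' ?_
      have hWR := (Finset.mem_sdiff.1 (hA hW)).1
      have hWR' := (Finset.mem_sdiff.1 (hA hW')).1
      exact ⟨h.1 _ (hpZ W hWR) _ (hpZ Z (hMR hZ)), h.2 _ (hpZ Z (hMR hZ)) _ (hpZ W' hWR')⟩
  -- The marked points lie over `x`, so their contribution is controlled by the value at `x`. Since
  -- `x` is arbitrary, the final bound involves only the infimum of the transferred function.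
  have hQ : a * ∑ Z ∈ M, u (p Z) ≤ pieceTransfer R τ (fun y => u y * G y) x := by
    rw [Finset.sum_congr rfl fun Z hZ => congrArg u (hpM Z hZ)]
    exact le_pieceTransfer hMR hsub hfull ha.le (fun Z hZ x hx => (hG Z hZ x hx).1) hu0 hx
  set Q := pieceTransfer R τ (fun y => u y * G y) x
  have huZ : ∀ Z ∈ R, eVariationOn u Z ≠ ⊤ := fun Z hZ =>
    ne_top_of_le_ne_top ENNReal.ofReal_ne_top ((eVariationOn.mono u (hsub Z hZ)).trans hu)
  set vz : Set ℝ → ℝ := fun Z => (eVariationOn u Z).toReal with hvz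
  have hvz0 : ∀ Z, 0 ≤ vz Z := fun Z => ENNReal.toReal_nonneg
  have hvzsum : ∑ Z ∈ R, vz Z ≤ V := by
    rw [hvz, ← ENNReal.toReal_sum huZ]
    exact ENNReal.toReal_le_of_le_ofReal hV
      ((sum_eVariationOn_le u R hconn hne hsub hdisj).trans hu)
  have hsup : ∀ Z ∈ R, ∀ y ∈ Z, |u y| ≤ u (p Z) + vz Z := by
    intro Z hZ y hy
    rw [abs_of_nonneg (hu0 y (hsub Z hZ hy))]
    have := BoundedVariationOn.sub_le (huZ Z hZ) hy (hpZ Z hZ)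
    linarith
  -- The variation of `u * G` inside the piece gives `b * vz Z` and `b * s * (u (p Z) + vz Z)`; the
  -- two jumps at the ends of the image give `2 * b * (u (p Z) + vz Z)`.
  have hpiece : ∀ Z ∈ R, eVariationOn ((τ '' Z).indicator (fun y => u (Function.invFunOn τ Z y) *
      G (Function.invFunOn τ Z y))) J ≤
      ENNReal.ofReal (b * (vz Z + (s + 2) * (u (p Z) + vz Z))) := by
    intro Z hZ
    have hup : 0 ≤ u (p Z) + vz Z := add_nonneg (hu0 _ (hpJ Z hZ)) (hvz0 Z)
    have hGa : ∀ y ∈ Z, |G y| ≤ b := fun y hy => by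
      rw [abs_of_nonneg (ha.le.trans (hG Z hZ y hy).1)]; exact (hG Z hZ y hy).2
    refine (eVariationOn_indicator_le (ordConnected_image (hconn Z hZ) (hcont Z hZ))
      (M := ENNReal.ofReal ((u (p Z) + vz Z) * b)) ?_ J).trans ?_
    · intro y hy
      have hm := Function.invFunOn_mem hy
      apply ENNReal.ofReal_le_ofReal
      rw [abs_mul]
      exact mul_le_mul (hsup Z hZ _ hm) (hGa _ hm) (abs_nonneg _) hup
    · have h1 := (eVariationOn_comp_invFunOn_le (w := fun y => u y * G y) (hmono Z hZ)).trans
        (eVariationOn_mul_le (hsup Z hZ) hGa)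
      rw [← ENNReal.ofReal_toReal (huZ Z hZ)] at h1
      have h2 := h1.trans (add_le_add le_rfl (mul_le_mul_right (hGvar Z hZ) _))
      rw [← ENNReal.ofReal_mul hb, ← ENNReal.ofReal_mul hup,
        ← ENNReal.ofReal_add (mul_nonneg hb (hvz0 Z)) (by positivity)] at h2
      refine (add_le_add h2 le_rfl).trans ?_
      rw [two_mul, ← ENNReal.ofReal_add (by positivity) (by positivity),
        ← ENNReal.ofReal_add (by have := hvz0 Z; positivity) (by positivity)]
      apply ENNReal.ofReal_le_ofReal
      show b * vz Z + _ + _ ≤ _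
      linarith
  have htot : eVariationOn (pieceTransfer R τ fun y => u y * G y) J ≤
      ∑ Z ∈ R, ENNReal.ofReal (b * (vz Z + (s + 2) * (u (p Z) + vz Z))) :=
    (eVariationOn_sum_le R (fun Z => (τ '' Z).indicator (fun y => u (Function.invFunOn τ Z y) *
      G (Function.invFunOn τ Z y))) J).trans (Finset.sum_le_sum hpiece)
  refine htot.trans ?_
  rw [← ENNReal.ofReal_sum_of_nonneg fun Z hZ => by
    have := hvz0 Z; have := hu0 _ (hpJ Z hZ); positivity]
  apply ENNReal.ofReal_le_ofReal
  rw [← Finset.mul_sum, Finset.sum_add_distrib, ← Finset.mul_sum, Finset.sum_add_distrib]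
  have hsM : 0 ≤ ∑ Z ∈ M, u (p Z) := Finset.sum_nonneg fun Z hZ => hu0 _ (hpJ Z (hMR hZ))
  have hQ' : ∑ Z ∈ M, u (p Z) ≤ Q / a := by rw [le_div_iff₀ ha]; linarith
  set q := ∑ Z ∈ M, u (p Z)
  calc b * (∑ Z ∈ R, vz Z + (s + 2) * (∑ Z ∈ R, u (p Z) + ∑ Z ∈ R, vz Z))
      ≤ b * (V + (s + 2) * (((1 + 2 * k) * q + 2 * k * V) + V)) := by gcongr
    _ ≤ b * ((s + 3) * (1 + 2 * k) * (Q / a + V)) := by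
        gcongr
        have e1 : (1 + 2 * k) * q ≤ (1 + 2 * k) * (Q / a) := by gcongr
        have e2 : 0 ≤ (1 + 2 * k) * (Q / a) := le_trans (by positivity) e1
        nlinarith [mul_nonneg hs (sub_nonneg.2 e1), mul_nonneg hk0 hV]
    _ = _ := by ring

end LasotaYorke

/-! ### Maximal intervals of monotonicity. -/

section MonoIntervals

variable {X : Set ℝ} {f : ℝ → ℝ} {Y Z : Set ℝ}

theorem IsOpen.exists_pair_lt {U : Set ℝ} (hU : IsOpen U) {x : ℝ} (hx : x ∈ U) :
    ∃ y ∈ U, ∃ z ∈ U, y < x ∧ x < z := by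
  obtain ⟨ε, hε, h⟩ := Metric.isOpen_iff.1 hU x hx
  refine ⟨x - ε / 2, h ?_, x + ε / 2, h ?_, by linarith, by linarith⟩ <;>
    simp [abs_of_pos, hε]

theorem StrictMonoOn.union_of_ordConnected {f : ℝ → ℝ} {s t : Set ℝ} (hs : s.OrdConnected)
    (ht : t.OrdConnected) (hst : (s ∩ t).Nonempty) (hfs : StrictMonoOn f s)
    (hft : StrictMonoOn f t) : StrictMonoOn f (s ∪ t) := by
  obtain ⟨c, hcs, hct⟩ := hst
  have key : ∀ {s t : Set ℝ}, s.OrdConnected → t.OrdConnected → c ∈ s → c ∈ t →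
      StrictMonoOn f s → StrictMonoOn f t → ∀ x ∈ s, ∀ y ∈ t, x < y → f x < f y := by
    intro s t hs ht hcs hct hfs hft x hx y hy hxy
    rcases lt_trichotomy x c with h | h | h
    · rcases lt_trichotomy y c with h' | h' | h'
      · exact hfs hx (hs.out hx hcs ⟨hxy.le, h'.le⟩) hxy
      · exact h' ▸ hfs hx hcs h
      · exact (hfs hx hcs h).trans (hft hct hy h')
    · exact hft (h ▸ hct) hy hxy
    · exact hft (ht.out hct hy ⟨h.le, hxy.le⟩) hy hxy
  rintro x (hx | hx) y (hy | hy) hxy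
  · exact hfs hx hy hxy
  · exact key hs ht hcs hct hfs hft x hx y hy hxy
  · exact key ht hs hct hcs hft hfs x hx y hy hxy
  · exact hft hx hy hxy

theorem IsMonoInterval.injOn (hZ : IsMonoInterval X f Z) : InjOn f Z :=
  hZ.2.2.2.2.2.elim StrictMonoOn.injOn StrictAntiOn.injOn

theorem IsMonoInterval.not_countable (hZ : IsMonoInterval X f Z) : ¬ Z.Countable := by
  intro h
  have := hZ.1.measure_pos volume hZ.2.2.1
  exact this.ne' (h.measure_zero _)

/-- The overlap is open, hence contains two points, and these force the same direction of
monotonicity on both intervals. -/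
theorem IsMonoInterval.strictMonoOn_union (hY : IsMonoInterval X f Y) (hZ : IsMonoInterval X f Z)
    (h : (Y ∩ Z).Nonempty) : (StrictMonoOn f Y → StrictMonoOn f (Y ∪ Z)) ∧
      (StrictAntiOn f Y → StrictAntiOn f (Y ∪ Z)) := by
  obtain ⟨x, hx⟩ := h
  obtain ⟨y, hy, z, hz, hyx, hxz⟩ := (hY.1.inter hZ.1).exists_pair_lt hx
  constructor
  · intro hm
    rcases hZ.2.2.2.2.2 with h' | h'
    · exact hm.union_of_ordConnected hY.2.1 hZ.2.1 ⟨x, hx⟩ h'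
    · exact absurd (hm hy.1 hx.1 hyx) (h' hy.2 hx.2 hyx).not_gt
  · intro hm
    rcases hZ.2.2.2.2.2 with h' | h'
    · exact absurd (hm hy.1 hx.1 hyx) (h' hy.2 hx.2 hyx).not_gt
    · have := hm.neg.union_of_ordConnected hY.2.1 hZ.2.1 ⟨x, hx⟩ h'.neg
      simpa using this.neg

theorem IsMonoInterval.union (hY : IsMonoInterval X f Y) (hZ : IsMonoInterval X f Z)
    (h : (Y ∩ Z).Nonempty) : IsMonoInterval X f (Y ∪ Z) := by
  refine ⟨hY.1.union hZ.1, ?_, hY.2.2.1.mono subset_union_left,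
    union_subset hY.2.2.2.1 hZ.2.2.2.1,
    hY.2.2.2.2.1.union_of_isOpen hZ.2.2.2.2.1 hY.1 hZ.1, ?_⟩
  · exact (IsPreconnected.union' h hY.2.1.isPreconnected hZ.2.1.isPreconnected).ordConnected
  · obtain ⟨h1, h2⟩ := hY.strictMonoOn_union hZ h
    exact hY.2.2.2.2.2.imp h1 h2

theorem subset_of_mem_monoIntervals (hY : Y ∈ monoIntervals X f) (hZ : IsMonoInterval X f Z)
    (h : (Y ∩ Z).Nonempty) : Z ⊆ Y :=
  subset_union_right.trans (hY.2 (hY.1.union hZ h) subset_union_left)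

theorem disjoint_of_mem_monoIntervals (hY : Y ∈ monoIntervals X f) (hZ : Z ∈ monoIntervals X f)
    (h : Y ≠ Z) : Disjoint Y Z := by
  rw [Set.disjoint_iff_inter_eq_empty]
  by_contra hne
  have hne := nonempty_iff_ne_empty.2 hne
  exact h ((subset_of_mem_monoIntervals hZ hY.1 (by rwa [inter_comm])).antisymm
    (subset_of_mem_monoIntervals hY hZ.1 hne))

/-- The union of all monotonicity intervals containing `Z` is again one. -/
theorem IsMonoInterval.exists_subset_mem_monoIntervals (hZ : IsMonoInterval X f Z) :
    ∃ Y ∈ monoIntervals X f, Z ⊆ Y := by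
  set C : Set (Set ℝ) := {Y | IsMonoInterval X f Y ∧ Z ⊆ Y} with hC
  have hZC : Z ∈ C := ⟨hZ, Subset.rfl⟩
  obtain ⟨x, hx⟩ := hZ.2.2.1
  have hov : ∀ Y ∈ C, ∀ Y' ∈ C, (Y ∩ Y').Nonempty := fun Y hY Y' hY' =>
    ⟨x, hY.2 hx, hY'.2 hx⟩
  have hU : IsMonoInterval X f (⋃₀ C) := by
    refine ⟨isOpen_sUnion fun Y hY => hY.1.1, ?_, ⟨x, Z, hZC, hx⟩, sUnion_subset fun Y hY =>
      hY.1.2.2.2.1, ?_, ?_⟩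
    · exact (isPreconnected_sUnion x C (fun Y hY => hY.2 hx)
        (fun Y hY => hY.1.2.1.isPreconnected)).ordConnected
    · rintro y ⟨Y, hY, hyY⟩
      exact (hY.1.2.2.2.2.1.continuousAt (hY.1.1.mem_nhds hyY)).continuousWithinAt
    · refine hZ.2.2.2.2.2.imp (fun hm => ?_) (fun hm => ?_)
      · rintro a ⟨A, hA, haA⟩ b ⟨B, hB, hbB⟩ hab
        have h1 := (hZ.strictMonoOn_union hA.1 ⟨x, hx, hA.2 hx⟩).1 hm
        rw [union_eq_self_of_subset_left hA.2] at h1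
        exact (hA.1.strictMonoOn_union hB.1 (hov A hA B hB)).1 h1 (Or.inl haA) (Or.inr hbB) hab
      · rintro a ⟨A, hA, haA⟩ b ⟨B, hB, hbB⟩ hab
        have h1 := (hZ.strictMonoOn_union hA.1 ⟨x, hx, hA.2 hx⟩).2 hm
        rw [union_eq_self_of_subset_left hA.2] at h1
        exact (hA.1.strictMonoOn_union hB.1 (hov A hA B hB)).2 h1 (Or.inl haA) (Or.inr hbB) hab
  refine ⟨⋃₀ C, ⟨hU, fun Y hY hle => subset_sUnion_of_mem ⟨hY, ?_⟩⟩, subset_sUnion_of_mem hZC⟩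
  exact (subset_sUnion_of_mem hZC).trans hle

theorem IsMonoInterval.mapsTo_Ioo {a b : ℝ} (hZ : IsMonoInterval X f Z)
    (hf : MapsTo f X (Icc a b)) : MapsTo f Z (Ioo a b) := by
  intro x hx
  obtain ⟨y, hy, z, hz, hyx, hxz⟩ := hZ.1.exists_pair_lt hx
  have hm : ∀ w ∈ Z, f w ∈ Icc a b := fun w hw => hf (hZ.2.2.2.1 hw)
  rcases hZ.2.2.2.2.2 with h | h
  · exact ⟨(hm y hy).1.trans_lt (h hy hx hyx), (h hx hz hxz).trans_le (hm z hz).2⟩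
  · exact ⟨(hm z hz).1.trans_lt (h hx hz hxz), (h hy hx hyx).trans_le (hm y hy).2⟩

/-- A larger interval still maps injectively into the open interval, which `Z` already covers, so it
has no further points. Thus fullness implies maximality, even after a change of holes or of order.
-/
theorem IsMonoInterval.mem_monoIntervals_of_full {a b : ℝ} (hZ : IsMonoInterval X f Z)
    (hf : MapsTo f X (Icc a b)) (hfull : Ioo a b ⊆ f '' Z) : Z ∈ monoIntervals X f := by
  refine ⟨hZ, fun Y hY hZY y hy => ?_⟩
  obtain ⟨z, hz, hzy⟩ := hfull (hY.mapsTo_Ioo hf hy)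
  exact hY.injOn (hZY hz) hy hzy ▸ hz

end MonoIntervals

/-! ### Branches of order one. -/

namespace RandomMap

variable {Ω : Type*} [MeasurableSpace Ω] {S : RandomMap Ω} {H : Ω → Set ℝ}

theorem iter_one (ω : Ω) : S.iter 1 ω = S.T ω := rfl

theorem survivor_zero (ω : Ω) : S.survivor H 0 ω = S.I := by
  ext x; simp [survivor]

theorem survivor_succ (n : ℕ) (ω : Ω) : S.survivor H (n + 1) ω =
    {x ∈ S.survivor H n ω | S.iter n ω x ∈ S.I \ H (S.σ^[n] ω)} := by
  ext x
  constructor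
  · rintro ⟨h1, h2⟩
    exact ⟨⟨h1, fun j hj => h2 j (hj.trans (Nat.lt_succ_self n))⟩, h2 n (Nat.lt_succ_self n)⟩
  · rintro ⟨⟨h1, h2⟩, h3⟩
    refine ⟨h1, fun j hj => ?_⟩
    rcases Nat.lt_succ_iff_lt_or_eq.1 hj with h | h
    · exact h2 j h
    · exact h ▸ h3

theorem survivor_one (ω : Ω) : S.survivor H 1 ω = S.I \ H ω := by
  rw [survivor_succ, survivor_zero]
  ext x
  simp only [iter, Function.iterate_zero, id]
  exact ⟨fun h => h.2, fun h => ⟨h.1, h⟩⟩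

/-- `E` collects the break points of the map, the ends of `I` and the ends of the components of the
hole; `(u, v)` is the gap of `E` around `x`. The last clause says that a gap is determined by the
points of `E` to its left. -/
theorem IsRandomOpenMap.exists_isMonoInterval_Ioo (hS : S.IsRandomOpenMap H) (ω : Ω) :
    ∃ E : Finset ℝ, ∀ x ∈ S.I \ H ω, x ∉ E → ∃ u v : ℝ,
      x ∈ Ioo u v ∧ IsMonoInterval (S.I \ H ω) (S.T ω) (Ioo u v) ∧
      ∀ y, y ∉ E → E.filter (· < y) = E.filter (· < x) → y ∈ Ioo u v := by
  classical
  obtain ⟨F, hF⟩ := hS.piecewise ω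
  obtain ⟨hHI, J, hJfin, hJconn, hHJ⟩ := hS.hole ω
  set E : Finset ℝ := F ∪ {S.lo, S.hi} ∪ hJfin.toFinset.image sInf ∪ hJfin.toFinset.image sSup
    with hE
  have hloE : S.lo ∈ E := by simp [hE]
  have hhiE : S.hi ∈ E := by simp [hE]
  have hFE : ∀ e ∈ F, e ∈ E := fun e he => by simp [hE, he]
  have hinfE : ∀ K ∈ J, sInf K ∈ E := fun K hK => by
    simp only [hE, Finset.mem_union]
    exact Or.inl (Or.inr (Finset.mem_image_of_mem _ (hJfin.mem_toFinset.2 hK)))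
  have hsupE : ∀ K ∈ J, sSup K ∈ E := fun K hK => by
    simp only [hE, Finset.mem_union]
    exact Or.inr (Finset.mem_image_of_mem _ (hJfin.mem_toFinset.2 hK))
  refine ⟨E, fun x hx hxE => ?_⟩
  have hlox : S.lo < x := lt_of_le_of_ne hx.1.1 fun h => hxE (h ▸ hloE)
  have hxhi : x < S.hi := lt_of_le_of_ne hx.1.2 fun h => hxE (h ▸ hhiE)
  have hneu : (E.filter (· < x)).Nonempty := ⟨S.lo, Finset.mem_filter.2 ⟨hloE, hlox⟩⟩
  have hnev : (E.filter (fun e => ¬ e < x)).Nonempty :=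
    ⟨S.hi, Finset.mem_filter.2 ⟨hhiE, hxhi.le.not_gt⟩⟩
  set u := (E.filter (· < x)).max' hneu with hu
  set v := (E.filter (fun e => ¬ e < x)).min' hnev with hv
  have huE := Finset.mem_filter.1 ((E.filter (· < x)).max'_mem hneu)
  have hvE := Finset.mem_filter.1 ((E.filter (fun e => ¬ e < x)).min'_mem hnev)
  rw [← hu] at huE
  rw [← hv] at hvE
  have hxv : x < v := lt_of_le_of_ne (not_lt.1 hvE.2) fun h => hxE (h ▸ hvE.1)
  have hno : ∀ e ∈ E, e ∉ Ioo u v := by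
    intro e he h
    by_cases hex : e < x
    · exact h.1.not_ge (Finset.le_max' _ e (Finset.mem_filter.2 ⟨he, hex⟩))
    · exact h.2.not_ge (Finset.min'_le _ e (Finset.mem_filter.2 ⟨he, hex⟩))
  have hlou : S.lo ≤ u := Finset.le_max' _ _ (Finset.mem_filter.2 ⟨hloE, hlox⟩)
  have hvhi : v ≤ S.hi := Finset.min'_le _ _ (Finset.mem_filter.2 ⟨hhiE, hxhi.le.not_gt⟩)
  have hsubI : Ioo u v ⊆ S.I := fun y hy => ⟨hlou.trans hy.1.le, hy.2.le.trans hvhi⟩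
  have hsubX : Ioo u v ⊆ S.I \ H ω := by
    intro y hy
    refine ⟨hsubI hy, fun hyH => ?_⟩
    rw [hHJ] at hyH
    obtain ⟨K, hK, hyK⟩ := hyH
    have hKI : K ⊆ S.I := (subset_sUnion_of_mem hK).trans (hHJ ▸ hHI)
    have hxK : x ∉ K := fun h => hx.2 (hHJ ▸ ⟨K, hK, h⟩)
    have hbb : BddBelow K := ⟨S.lo, fun z hz => (hKI hz).1⟩
    have hba : BddAbove K := ⟨S.hi, fun z hz => (hKI hz).2⟩
    rcases lt_trichotomy y x with h | h | h
    · refine hno _ (hsupE K hK) ⟨hy.1.trans_le (le_csSup hba hyK), ?_⟩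
      refine lt_of_le_of_lt (csSup_le ⟨y, hyK⟩ fun z hz => ?_) hxv
      by_contra hzx
      exact hxK ((hJconn K hK).out hyK hz ⟨h.le, (not_le.1 hzx).le⟩)
    · exact hxK (h ▸ hyK)
    · refine hno _ (hinfE K hK) ⟨?_, (csInf_le hbb hyK).trans_lt hy.2⟩
      refine lt_of_lt_of_le huE.2 (le_csInf ⟨y, hyK⟩ fun z hz => ?_)
      by_contra hzx
      exact hxK ((hJconn K hK).out hz hyK ⟨(not_le.1 hzx).le, h.le⟩)
  obtain ⟨hc, hm⟩ := hF u v (huE.2.trans hxv) fun y hy =>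
    ⟨hsubI hy, fun hyF => hno y (hFE y hyF) hy⟩
  refine ⟨u, v, ⟨huE.2, hxv⟩, ⟨isOpen_Ioo, ordConnected_Ioo, ⟨x, huE.2, hxv⟩, hsubX, hc, hm⟩, ?_⟩
  intro y hyE hfil
  have h1 : u < y := by
    have : u ∈ E.filter (· < y) := by rw [hfil]; exact Finset.mem_filter.2 huE
    exact (Finset.mem_filter.1 this).2
  have h2 : ¬ v < y := by
    intro h
    have : v ∈ E.filter (· < x) := by rw [← hfil]; exact Finset.mem_filter.2 ⟨hvE.1, h⟩
    exact hvE.2 (Finset.mem_filter.1 this).2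
  exact ⟨h1, lt_of_le_of_ne (not_lt.1 h2) fun h => hyE (h ▸ hvE.1)⟩

theorem mem_branches_one {ω : Ω} {Z : Set ℝ} :
    Z ∈ S.branches H 1 ω ↔ Z ∈ monoIntervals (S.I \ H ω) (S.T ω) := by
  rw [branches, survivor_one, iter_one]

/-- A branch contains a point outside the finite set `E`, and the set of elements of `E` to the left
of that point determines the branch. -/
theorem IsRandomOpenMap.finite_branches_one (hS : S.IsRandomOpenMap H) (ω : Ω) :
    (S.branches H 1 ω).Finite := by
  classical
  obtain ⟨E, hE⟩ := hS.exists_isMonoInterval_Ioo ω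
  have hex : ∀ Z ∈ S.branches H 1 ω, ∃ x ∈ Z, x ∉ E := fun Z hZ => by
    by_contra h
    push Not at h
    exact (mem_branches_one.1 hZ).1.not_countable (E.finite_toSet.countable.mono h)
  choose! x hxZ hxE using hex
  refine Set.Finite.of_finite_image (f := fun Z => E.filter (· < x Z)) ?_ ?_
  · exact (E.powerset.finite_toSet).subset (by
      rintro _ ⟨Z, -, rfl⟩
      exact Finset.mem_coe.2 (Finset.mem_powerset.2 (Finset.filter_subset _ _)))
  · intro Z hZ W hW h
    obtain ⟨u, v, hxuv, hmono, hy⟩ := hE (x Z) ((mem_branches_one.1 hZ).1.2.2.2.1 (hxZ Z hZ))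
      (hxE Z hZ)
    have hWuv := hy (x W) (hxE W hW) h.symm
    by_contra hne
    have h1 := subset_of_mem_monoIntervals (mem_branches_one.1 hZ) hmono ⟨_, hxZ Z hZ, hxuv⟩
    exact Set.disjoint_left.1 (disjoint_of_mem_monoIntervals (mem_branches_one.1 hZ)
      (mem_branches_one.1 hW) hne) (h1 hWuv) (hxZ W hW)

theorem IsRandomOpenMap.countable_diff_branches_one (hS : S.IsRandomOpenMap H) (ω : Ω) :
    ((S.I \ H ω) \ ⋃₀ S.branches H 1 ω).Countable := by
  obtain ⟨E, hE⟩ := hS.exists_isMonoInterval_Ioo ω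
  refine E.finite_toSet.countable.mono fun x hx => ?_
  by_contra hxE
  obtain ⟨u, v, hxuv, hmono, -⟩ := hE x hx.1 hxE
  obtain ⟨Y, hY, hsub⟩ := hmono.exists_subset_mem_monoIntervals
  exact hx.2 ⟨Y, mem_branches_one.2 hY, hsub hxuv⟩

theorem mem_fullBranches_one {ω : Ω} {Z : Set ℝ} : Z ∈ S.fullBranches H 1 ω ↔
    Z ∈ monoIntervals (S.I \ H ω) (S.T ω) ∧ Ioo S.lo S.hi ⊆ S.T ω '' Z := by
  rw [fullBranches, mem_sep_iff, mem_branches_one, iter_one]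

theorem IsRandomOpenMap.fullBranches_one_nonempty (hS : S.IsRandomOpenMap H) (ω : Ω) :
    (S.fullBranches H 1 ω).Nonempty := by
  obtain ⟨Z, hZ, hfull, hdisj⟩ := hS.exists_full ω
  have hm : IsMonoInterval (S.I \ H ω) (S.T ω) Z := by
    obtain ⟨h1, h2, h3, h4, h5⟩ := hZ.1
    exact ⟨h1, h2, h3, subset_sdiff.2 ⟨h4, hdisj⟩, h5⟩
  exact ⟨Z, mem_fullBranches_one.2 ⟨hm.mem_monoIntervals_of_full
    ((hS.mapsTo ω).mono_left sdiff_subset) hfull, hfull⟩⟩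

end RandomMap

/-! ### Order of intervals, and the pieces of order `n`. -/

/-- Every point of `Y` lies to the left of every point of `Z`. -/
def SetBefore (Y Z : Set ℝ) : Prop := ∀ x ∈ Y, ∀ y ∈ Z, x < y

theorem SetBefore.mono {Y Z Y' Z' : Set ℝ} (h : SetBefore Y Z) (hY : Y' ⊆ Y) (hZ : Z' ⊆ Z) :
    SetBefore Y' Z' := fun x hx y hy => h x (hY hx) y (hZ hy)

theorem SetBefore.trans {X Y Z : Set ℝ} (h : SetBefore X Y) (h' : SetBefore Y Z)
    (hY : Y.Nonempty) : SetBefore X Z := fun x hx z hz => by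
  obtain ⟨y, hy⟩ := hY
  exact (h x hx y hy).trans (h' y hy z hz)

theorem setBefore_or {Y Z : Set ℝ} (hY : Y.OrdConnected) (hZ : Z.OrdConnected)
    (h : Disjoint Y Z) : SetBefore Y Z ∨ SetBefore Z Y := by
  by_contra hcon
  simp only [SetBefore, not_or, not_forall, not_lt] at hcon
  obtain ⟨⟨a, ha, b, hb, hba⟩, c, hc, d, hd, hdc⟩ := hcon
  have hdis := fun x (hx : x ∈ Y) (hx' : x ∈ Z) => Set.disjoint_left.1 h hx hx'
  rcases le_total b d with hbd | hbd
  · exact hdis d hd (hZ.out hb hc ⟨hbd, hdc⟩)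
  · exact hdis b (hY.out hd ha ⟨hbd, hba⟩) hb

/-- Of three disjoint intervals one is in the middle. If it is full it separates the other two,
which limits certain families below to two members. -/
theorem exists_setBefore_triple {B : Finset (Set ℝ)} (hB : 2 < B.card)
    (hconn : ∀ Z ∈ B, Z.OrdConnected)
    (hdisj : ∀ Z ∈ B, ∀ Z' ∈ B, Z ≠ Z' → Disjoint Z Z') :
    ∃ X ∈ B, ∃ Y ∈ B, ∃ Z ∈ B, SetBefore X Y ∧ SetBefore Y Z := by
  obtain ⟨X, Y, Z, hX, hY, hZ, hXY, hXZ, hYZ⟩ := Finset.two_lt_card_iff.1 hB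
  rcases setBefore_or (hconn X hX) (hconn Y hY) (hdisj X hX Y hY hXY) with h1 | h1 <;>
  rcases setBefore_or (hconn X hX) (hconn Z hZ) (hdisj X hX Z hZ hXZ) with h2 | h2 <;>
  rcases setBefore_or (hconn Y hY) (hconn Z hZ) (hdisj Y hY Z hZ hYZ) with h3 | h3
  · exact ⟨X, hX, Y, hY, Z, hZ, h1, h3⟩
  · exact ⟨X, hX, Z, hZ, Y, hY, h2, h3⟩
  · exact ⟨X, hX, Y, hY, Z, hZ, h1, h3⟩
  · exact ⟨Z, hZ, X, hX, Y, hY, h2, h1⟩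
  · exact ⟨Y, hY, X, hX, Z, hZ, h1, h2⟩
  · exact ⟨Y, hY, X, hX, Z, hZ, h1, h2⟩
  · exact ⟨Y, hY, Z, hZ, X, hX, h3, h2⟩
  · exact ⟨Z, hZ, Y, hY, X, hX, h3, h1⟩

namespace RandomMap

variable {Ω : Type*} [MeasurableSpace Ω]

/-- The nonempty intersections `Z₀ ∩ T_ω⁻¹ Z₁ ∩ ⋯` of preimages of branches of order one. -/
def pieces (S : RandomMap Ω) (H : Ω → Set ℝ) : ℕ → Ω → Set (Set ℝ)
  | 0, _ => {Ioo S.lo S.hi}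
  | n + 1, ω => {Y | Y.Nonempty ∧ ∃ Z ∈ S.pieces H n ω, ∃ W ∈ S.branches H 1 (S.σ^[n] ω),
      Y = Z ∩ S.iter n ω ⁻¹' W}

/-- The pieces with full image. -/
def fullPieces (S : RandomMap Ω) (H : Ω → Set ℝ) (n : ℕ) (ω : Ω) : Set (Set ℝ) :=
  {Y ∈ S.pieces H n ω | Ioo S.lo S.hi ⊆ S.iter n ω '' Y}

/-- A collection of non-full pieces that are not separated by full ones has at most `k` members. -/
def IsContigBound (S : RandomMap Ω) (H : Ω → Set ℝ) (n : ℕ) (ω : Ω) (k : ℝ) : Prop :=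
  ∀ A : Finset (Set ℝ), (∀ Y ∈ A, Y ∈ S.pieces H n ω \ S.fullPieces H n ω) →
    (∀ Z ∈ S.fullPieces H n ω, ∀ W ∈ A, ∀ W' ∈ A, ¬ (SetBefore W Z ∧ SetBefore Z W')) →
    (A.card : ℝ) ≤ k

variable {S : RandomMap Ω} {H : Ω → Set ℝ}

theorem iter_succ (n : ℕ) (ω : Ω) : S.iter (n + 1) ω = S.T (S.σ^[n] ω) ∘ S.iter n ω := rfl

theorem IsRandomOpenMap.mapsTo_iter (hS : S.IsRandomOpenMap H) (n : ℕ) (ω : Ω) :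
    MapsTo (S.iter n ω) S.I S.I := by
  induction n with
  | zero => exact fun x hx => hx
  | succ n ih => exact fun x hx => hS.mapsTo _ (ih hx)

theorem survivor_subset (n : ℕ) (ω : Ω) : S.survivor H n ω ⊆ S.I := fun _ hx => hx.1

theorem IsRandomOpenMap.mapsTo_iter_survivor (hS : S.IsRandomOpenMap H) (n : ℕ) (ω : Ω) :
    MapsTo (S.iter n ω) (S.survivor H n ω) (Icc S.lo S.hi) :=
  (hS.mapsTo_iter n ω).mono_left (survivor_subset n ω)

theorem strict_comp {f g : ℝ → ℝ} {s t : Set ℝ} (hg : StrictMonoOn g t ∨ StrictAntiOn g t)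
    (hf : StrictMonoOn f s ∨ StrictAntiOn f s) (hst : MapsTo f s t) :
    StrictMonoOn (g ∘ f) s ∨ StrictAntiOn (g ∘ f) s := by
  rcases hg with hg | hg <;> rcases hf with hf | hf
  · exact Or.inl (hg.comp hf hst)
  · exact Or.inr (hg.comp_strictAntiOn hf hst)
  · exact Or.inr (hg.comp_strictMonoOn hf hst)
  · exact Or.inl (hg.comp hf hst)

/-- On a piece all intermediate iterates are continuous and monotone. This is needed to bound the
variation of the product weight. -/
theorem IsRandomOpenMap.isMonoInterval_of_mem_pieces (hS : S.IsRandomOpenMap H) {n : ℕ} {ω : Ω} :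
    ∀ {Y : Set ℝ}, Y ∈ S.pieces H n ω →
      IsMonoInterval (S.survivor H n ω) (S.iter n ω) Y ∧ Y ⊆ Ioo S.lo S.hi ∧
      ∀ j ≤ n, ContinuousOn (S.iter j ω) Y ∧
        (StrictMonoOn (S.iter j ω) Y ∨ StrictAntiOn (S.iter j ω) Y) := by
  induction n with
  | zero =>
    rintro Y (rfl : Y = _)
    have h : ContinuousOn (S.iter 0 ω) (Ioo S.lo S.hi) ∧
        (StrictMonoOn (S.iter 0 ω) (Ioo S.lo S.hi) ∨
          StrictAntiOn (S.iter 0 ω) (Ioo S.lo S.hi)) :=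
      ⟨continuousOn_id, Or.inl fun _ _ _ _ h => h⟩
    refine ⟨⟨isOpen_Ioo, ordConnected_Ioo, nonempty_Ioo.2 hS.lo_lt_hi, ?_, h⟩, Subset.rfl, ?_⟩
    · rw [survivor_zero]; exact Ioo_subset_Icc_self
    · intro j hj; obtain rfl : j = 0 := Nat.le_zero.1 hj; exact h
  | succ n ih =>
    rintro Y ⟨hne, Z, hZ, W, hW, rfl⟩
    obtain ⟨⟨h1, h2, h3, h4, h5, h6⟩, h7, h8⟩ := ih hZ
    obtain ⟨w1, w2, w3, w4, w5, w6⟩ := (mem_branches_one.1 hW).1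
    have hmt : MapsTo (S.iter n ω) (Z ∩ S.iter n ω ⁻¹' W) W := fun x hx => hx.2
    have hcm : ContinuousOn (S.iter (n + 1) ω) (Z ∩ S.iter n ω ⁻¹' W) ∧
        (StrictMonoOn (S.iter (n + 1) ω) (Z ∩ S.iter n ω ⁻¹' W) ∨
          StrictAntiOn (S.iter (n + 1) ω) (Z ∩ S.iter n ω ⁻¹' W)) := by
      rw [iter_succ]
      refine ⟨w5.comp (h5.mono inter_subset_left) hmt, strict_comp w6 ?_ hmt⟩
      exact h6.imp (fun h => h.mono inter_subset_left) (fun h => h.mono inter_subset_left)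
    refine ⟨⟨h5.isOpen_inter_preimage h1 w1, ⟨fun x hx y hy z hz => ?_⟩, hne, ?_, hcm⟩,
      inter_subset_left.trans h7, fun j hj => ?_⟩
    · have hzZ : z ∈ Z := h2.out hx.1 hy.1 hz
      refine ⟨hzZ, ?_⟩
      rcases h6 with h | h
      · exact w2.out hx.2 hy.2 ⟨h.monotoneOn hx.1 hzZ hz.1, h.monotoneOn hzZ hy.1 hz.2⟩
      · exact w2.out hy.2 hx.2 ⟨h.antitoneOn hzZ hy.1 hz.2, h.antitoneOn hx.1 hzZ hz.1⟩
    · rw [survivor_succ]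
      exact fun x hx => ⟨h4 hx.1, w4 hx.2⟩
    · rcases Nat.le_succ_iff.1 hj with h | rfl
      · obtain ⟨a, b⟩ := h8 j h
        exact ⟨a.mono inter_subset_left, b.imp (fun h => h.mono inter_subset_left)
          (fun h => h.mono inter_subset_left)⟩
      · exact hcm

theorem disjoint_pieces {n : ℕ} {ω : Ω} :
    ∀ {Y Y' : Set ℝ}, Y ∈ S.pieces H n ω → Y' ∈ S.pieces H n ω → Y ≠ Y' → Disjoint Y Y' := by
  induction n with
  | zero => rintro Y Y' (rfl : Y = _) (rfl : Y' = _) h; exact absurd rfl h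
  | succ n ih =>
    rintro Y Y' ⟨-, Z, hZ, W, hW, rfl⟩ ⟨-, Z', hZ', W', hW', rfl⟩ h
    by_cases hZZ : Z = Z'
    · subst hZZ
      have hWW : W ≠ W' := fun e => h (by rw [e])
      have hd := disjoint_of_mem_monoIntervals (mem_branches_one.1 hW) (mem_branches_one.1 hW') hWW
      exact (hd.preimage _).mono inter_subset_right inter_subset_right
    · exact (ih hZ hZ' hZZ).mono inter_subset_left inter_subset_left

theorem pieces_succ_subset (n : ℕ) (ω : Ω) : S.pieces H (n + 1) ω ⊆
    (fun p : Set ℝ × Set ℝ => p.1 ∩ S.iter n ω ⁻¹' p.2) ''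
      (S.pieces H n ω ×ˢ S.branches H 1 (S.σ^[n] ω)) := by
  rintro Y ⟨-, Z, hZ, W, hW, rfl⟩
  exact ⟨(Z, W), ⟨hZ, hW⟩, rfl⟩

theorem IsRandomOpenMap.finite_pieces (hS : S.IsRandomOpenMap H) (n : ℕ) (ω : Ω) :
    (S.pieces H n ω).Finite := by
  induction n with
  | zero => exact finite_singleton _
  | succ n ih =>
    exact ((ih.prod (hS.finite_branches_one _)).image _).subset (pieces_succ_subset n ω)

theorem IsRandomOpenMap.ncard_pieces_le (hS : S.IsRandomOpenMap H) (n : ℕ) (ω : Ω) :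
    (S.pieces H n ω).ncard ≤ ∏ j ∈ Finset.range n, (S.branches H 1 (S.σ^[j] ω)).ncard := by
  induction n with
  | zero => simp [pieces]
  | succ n ih =>
    rw [Finset.prod_range_succ]
    have hfin := (hS.finite_pieces n ω).prod (hS.finite_branches_one (S.σ^[n] ω))
    calc _ ≤ _ := ncard_le_ncard (pieces_succ_subset n ω) (hfin.image _)
      _ ≤ _ := ncard_image_le hfin
      _ = (S.pieces H n ω).ncard * (S.branches H 1 (S.σ^[n] ω)).ncard := ncard_prod
      _ ≤ _ := Nat.mul_le_mul_right _ ih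

/-- The points lost at a new step are preimages of a countable set under an iterate that is
injective on each of finitely many pieces. -/
theorem IsRandomOpenMap.countable_diff_pieces (hS : S.IsRandomOpenMap H) (n : ℕ) (ω : Ω) :
    (S.survivor H n ω \ ⋃₀ S.pieces H n ω).Countable := by
  induction n with
  | zero =>
    refine (Set.toFinite {S.lo, S.hi}).countable.mono fun x hx => ?_
    rw [survivor_zero] at hx
    by_contra h
    simp only [mem_insert_iff, mem_singleton_iff, not_or] at h
    exact hx.2 ⟨_, rfl, lt_of_le_of_ne hx.1.1 (Ne.symm h.1), lt_of_le_of_ne hx.1.2 h.2⟩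
  | succ n ih =>
    have hE := hS.countable_diff_branches_one (S.σ^[n] ω)
    set E := (S.I \ H (S.σ^[n] ω)) \ ⋃₀ S.branches H 1 (S.σ^[n] ω)
    have hc : (⋃ Z ∈ S.pieces H n ω, Z ∩ S.iter n ω ⁻¹' E).Countable :=
      (hS.finite_pieces n ω).countable.biUnion fun Z hZ =>
        MapsTo.countable_of_injOn (f := S.iter n ω) (fun x hx => hx.2)
          ((hS.isMonoInterval_of_mem_pieces hZ).1.injOn.mono inter_subset_left) hE
    refine (ih.union hc).mono fun x hx => ?_
    rw [survivor_succ] at hx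
    by_cases hxZ : x ∈ ⋃₀ S.pieces H n ω
    · right
      obtain ⟨Z, hZ, hxZ⟩ := hxZ
      refine mem_iUnion₂.2 ⟨Z, hZ, hxZ, hx.1.2, fun ⟨W, hW, hxW⟩ => hx.2 ?_⟩
      exact ⟨Z ∩ S.iter n ω ⁻¹' W, ⟨⟨x, hxZ, hxW⟩, Z, hZ, W, hW, rfl⟩, hxZ, hxW⟩
    · exact Or.inl ⟨hx.1.1, hxZ⟩

theorem fullPieces_subset (n : ℕ) (ω : Ω) : S.fullPieces H n ω ⊆ S.pieces H n ω := sep_subset _ _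

theorem inter_preimage_mem_fullPieces {n : ℕ} {ω : Ω} {Z W : Set ℝ} (hlt : S.lo < S.hi)
    (hZ : Z ∈ S.pieces H n ω) (hW : W ∈ S.fullBranches H 1 (S.σ^[n] ω))
    (hsub : W ⊆ S.iter n ω '' Z) : Z ∩ S.iter n ω ⁻¹' W ∈ S.fullPieces H (n + 1) ω := by
  have himg : Ioo S.lo S.hi ⊆ S.iter (n + 1) ω '' (Z ∩ S.iter n ω ⁻¹' W) := by
    intro x hx
    obtain ⟨w, hw, rfl⟩ := (mem_fullBranches_one.1 hW).2 hx
    obtain ⟨z, hz, rfl⟩ := hsub hw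
    exact ⟨z, ⟨hz, hw⟩, rfl⟩
  refine ⟨⟨?_, Z, hZ, W, hW.1, rfl⟩, himg⟩
  exact ((nonempty_Ioo.2 hlt).mono himg).of_image

theorem subset_Ioo_of_mem_branches {ω : Ω} {W : Set ℝ}
    (hW : W ∈ S.branches H 1 ω) : W ⊆ Ioo S.lo S.hi := by
  intro x hx
  have h := (mem_branches_one.1 hW).1
  obtain ⟨y, hy, z, hz, hyx, hxz⟩ := h.1.exists_pair_lt hx
  exact ⟨(h.2.2.2.1 hy).1.1.trans_lt hyx, hxz.trans_le (h.2.2.2.1 hz).1.2⟩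

/-- A full piece intersected with the preimage of a full branch is full, and distinct pairs give
distinct pieces. -/
theorem IsRandomOpenMap.prod_numFull_le (hS : S.IsRandomOpenMap H) (n : ℕ) (ω : Ω) :
    ∏ j ∈ Finset.range n, S.numFull H 1 (S.σ^[j] ω) ≤ (S.fullPieces H n ω).ncard := by
  induction n with
  | zero =>
    have : S.fullPieces H 0 ω = {Ioo S.lo S.hi} := by
      ext Y
      refine ⟨fun h => h.1, ?_⟩
      rintro (rfl : Y = _)
      exact ⟨rfl, fun x hx => ⟨x, hx, rfl⟩⟩
    simp [this]
  | succ n ih =>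
    rw [Finset.prod_range_succ]
    calc _ ≤ (S.fullPieces H n ω).ncard * S.numFull H 1 (S.σ^[n] ω) := Nat.mul_le_mul_right _ ih
      _ = (S.fullPieces H n ω ×ˢ S.fullBranches H 1 (S.σ^[n] ω)).ncard := ncard_prod.symm
      _ ≤ _ := ?_
    have hmem : ∀ p ∈ S.fullPieces H n ω ×ˢ S.fullBranches H 1 (S.σ^[n] ω),
        p.1 ∩ S.iter n ω ⁻¹' p.2 ∈ S.fullPieces H (n + 1) ω := fun p hp =>
      inter_preimage_mem_fullPieces hS.lo_lt_hi hp.1.1 hp.2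
        ((subset_Ioo_of_mem_branches hp.2.1).trans hp.1.2)
    refine ncard_le_ncard_of_injOn (fun p => p.1 ∩ S.iter n ω ⁻¹' p.2) hmem ?_
      ((hS.finite_pieces _ _).subset (fullPieces_subset _ _))
    rintro ⟨Z, W⟩ hp ⟨Z', W'⟩ hp' h
    obtain ⟨x, hx⟩ := (hmem _ hp).1.1
    have hx' : x ∈ Z' ∩ S.iter n ω ⁻¹' W' := by
      have h' : Z ∩ S.iter n ω ⁻¹' W = Z' ∩ S.iter n ω ⁻¹' W' := h
      rw [← h']; exact hx
    have e1 : Z = Z' := by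
      by_contra hne
      exact Set.disjoint_left.1 (disjoint_pieces hp.1.1 hp'.1.1 hne) hx.1 hx'.1
    have e2 : W = W' := by
      by_contra hne
      exact Set.disjoint_left.1 (disjoint_of_mem_monoIntervals (mem_branches_one.1 hp.2.1)
        (mem_branches_one.1 hp'.2.1) hne) hx.2 hx'.2
    rw [e1, e2]

theorem IsRandomOpenMap.numFull_one_pos (hS : S.IsRandomOpenMap H) (ω : Ω) :
    0 < S.numFull H 1 ω :=
  (ncard_pos ((hS.finite_branches_one ω).subset (sep_subset _ _))).2
    (hS.fullBranches_one_nonempty ω)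

theorem IsRandomOpenMap.ncard_fullPieces_pos (hS : S.IsRandomOpenMap H) (n : ℕ) (ω : Ω) :
    0 < (S.fullPieces H n ω).ncard :=
  (Finset.prod_pos fun _ _ => hS.numFull_one_pos _).trans_le (hS.prod_numFull_le n ω)

/-! ### Contiguous pieces -/

/-- The hull condition in terms of order: a full branch inside the hull is disjoint from the members
of `A`, hence lies between two of them. -/
theorem IsRandomOpenMap.card_le_of_maxContiguous (hS : S.IsRandomOpenMap H) {ω : Ω}
    {A : Finset (Set ℝ)} (hA : ∀ W ∈ A, W ∈ S.partialBranches H 1 ω)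
    (h : ∀ Z ∈ S.fullBranches H 1 ω, ∀ W ∈ A, ∀ W' ∈ A, ¬ (SetBefore W Z ∧ SetBefore Z W')) :
    A.card ≤ S.maxContiguous H 1 ω := by
  classical
  refine le_csSup ?_ ⟨A, rfl, hA, fun Z hZ hsub => ?_⟩
  · refine ⟨(hS.finite_branches_one ω).toFinset.card, ?_⟩
    rintro k ⟨B, rfl, hB, -⟩
    exact Finset.card_le_card fun W hW => (hS.finite_branches_one ω).mem_toFinset.2 (hB W hW).1
  · have hZm := mem_branches_one.1 hZ.1
    have hd : ∀ W ∈ A, Disjoint W Z := fun W hW =>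
      disjoint_of_mem_monoIntervals (mem_branches_one.1 (hA W hW).1) hZm
        fun e => (hA W hW).2 (e ▸ hZ)
    obtain ⟨z, hz⟩ := hZm.1.2.2.1
    have hconv : Convex ℝ {p : ℝ | (∃ W ∈ A, ∃ x ∈ W, x ≤ p) ∧ ∃ W ∈ A, ∃ x ∈ W, p ≤ x} := by
      refine Set.OrdConnected.convex ⟨?_⟩
      rintro p ⟨⟨W, hW, x, hx, hxp⟩, -⟩ q ⟨-, W', hW', y, hy, hqy⟩ r hr
      exact ⟨⟨W, hW, x, hx, hxp.trans hr.1⟩, W', hW', y, hy, hr.2.trans hqy⟩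
    have hle := convexHull_min (s := ⋃ W ∈ A, W) (by
      intro x hx
      obtain ⟨W, hW, hxW⟩ := mem_iUnion₂.1 hx
      exact ⟨⟨W, hW, x, hxW, le_rfl⟩, W, hW, x, hxW, le_rfl⟩) hconv
    obtain ⟨⟨W, hW, x, hx, hxz⟩, W', hW', y, hy, hzy⟩ := hle (hsub hz)
    have hc : ∀ W ∈ A, W.OrdConnected := fun W hW => (mem_branches_one.1 (hA W hW).1).1.2.1
    refine h Z hZ W hW W' hW' ⟨?_, ?_⟩
    · exact (setBefore_or (hc W hW) hZm.1.2.1 (hd W hW)).resolve_right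
        fun hb => (hb z hz x hx).not_ge hxz
    · exact (setBefore_or hZm.1.2.1 (hc W' hW') (hd W' hW').symm).resolve_right
        fun hb => (hb y hy z hz).not_ge hzy

theorem setBefore_of_comp {f : ℝ → ℝ} {Y F W B Z : Set ℝ} (hY : Y ⊆ Z ∩ f ⁻¹' W)
    (hF : F ⊆ Z ∩ f ⁻¹' B) (h : SetBefore W B) :
    (StrictMonoOn f Z → SetBefore Y F) ∧ (StrictAntiOn f Z → SetBefore F Y) := by
  constructor
  · intro hm x hx y hy
    exact (hm.lt_iff_lt (hY hx).1 (hF hy).1).1 (h _ (hY hx).2 _ (hF hy).2)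
  · intro hm x hx y hy
    exact (hm.lt_iff_gt (hY hy).1 (hF hx).1).1 (h _ (hY hy).2 _ (hF hx).2)

/-- Group the family by parent piece of order `n`. At most two parents are full, since a middle one
would contain a separating full piece of order `n + 1`; at most `k` are not full. Under each parent
at most `ξ` members come from non-full branches. Members from full branches do not occur under a
full parent and number at most two under a non-full one, because the middle of three full branches
is covered by the image of the parent and would give a full piece. The total is `2 * ξ + k * (ξ +
2)`. -/
theorem IsRandomOpenMap.isContigBound_succ (hS : S.IsRandomOpenMap H) {n : ℕ} {ω : Ω} {k ξ : ℝ}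
    (hk : S.IsContigBound H n ω k) (hξ : (S.maxContiguous H 1 (S.σ^[n] ω) : ℝ) ≤ ξ) :
    S.IsContigBound H (n + 1) ω (k * (ξ + 2) + 2 * ξ) := by
  classical
  intro A hA hsep
  have hξ0 : 0 ≤ ξ := (Nat.cast_nonneg _).trans hξ
  have hex : ∀ Y ∈ A, ∃ Z W, Z ∈ S.pieces H n ω ∧ W ∈ S.branches H 1 (S.σ^[n] ω) ∧
      Y = Z ∩ S.iter n ω ⁻¹' W := fun Y hY => by
    obtain ⟨-, Z, hZ, W, hW, h⟩ := (hA Y hY).1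
    exact ⟨Z, W, hZ, hW, h⟩
  choose! z w hz hw hzw using hex
  have hYne : ∀ Y ∈ A, Y.Nonempty := fun Y hY =>
    (hS.isMonoInterval_of_mem_pieces (hA Y hY).1).1.2.2.1
  have hYz : ∀ Y ∈ A, Y ⊆ z Y := fun Y hY => by
    conv_lhs => rw [hzw Y hY]
    exact inter_subset_left
  have hmono := fun Z (hZ : Z ∈ S.pieces H n ω) => hS.isMonoInterval_of_mem_pieces hZ
  -- a full piece of order `n` contains a full piece of order `n + 1`
  have hfullsub : ∀ F ∈ S.fullPieces H n ω, ∃ F' ∈ S.fullPieces H (n + 1) ω, F' ⊆ F := by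
    intro F hF
    obtain ⟨B, hB⟩ := hS.fullBranches_one_nonempty (S.σ^[n] ω)
    exact ⟨_, inter_preimage_mem_fullPieces hS.lo_lt_hi hF.1 hB
      ((subset_Ioo_of_mem_branches hB.1).trans hF.2), inter_subset_left⟩
  set Zs := A.image z with hZs
  have hZsm : ∀ Z ∈ Zs, Z ∈ S.pieces H n ω := fun Z hZ => by
    obtain ⟨Y, hY, rfl⟩ := Finset.mem_image.1 hZ; exact hz Y hY
  have hnosep : ∀ F ∈ S.fullPieces H n ω, ∀ Z ∈ Zs, ∀ Z' ∈ Zs,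
      ¬ (SetBefore Z F ∧ SetBefore F Z') := by
    intro F hF Z hZ Z' hZ' h
    obtain ⟨Y, hY, rfl⟩ := Finset.mem_image.1 hZ
    obtain ⟨Y', hY', rfl⟩ := Finset.mem_image.1 hZ'
    obtain ⟨F', hF', hsub⟩ := hfullsub F hF
    exact hsep F' hF' Y hY Y' hY' ⟨h.1.mono (hYz Y hY) hsub, h.2.mono hsub (hYz Y' hY')⟩
  set Zf := Zs.filter (· ∈ S.fullPieces H n ω) with hZf
  set Zp := Zs.filter (¬ · ∈ S.fullPieces H n ω) with hZp
  have hZfcard : Zf.card ≤ 2 := by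
    by_contra hlt
    have hm : ∀ Z ∈ Zf, Z ∈ S.pieces H n ω := fun Z hZ => hZsm Z (Finset.mem_filter.1 hZ).1
    obtain ⟨X, hX, Y, hY, Z, hZ, h1, h2⟩ := exists_setBefore_triple (not_le.1 hlt)
      (fun Z hZ => (hmono Z (hm Z hZ)).1.2.1)
      (fun Z hZ Z' hZ' => disjoint_pieces (hm Z hZ) (hm Z' hZ'))
    exact hnosep Y (Finset.mem_filter.1 hY).2 X (Finset.mem_filter.1 hX).1 Z
      (Finset.mem_filter.1 hZ).1 ⟨h1, h2⟩
  have hZpcard : (Zp.card : ℝ) ≤ k :=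
    hk Zp (fun Z hZ => ⟨hZsm Z (Finset.mem_filter.1 hZ).1, (Finset.mem_filter.1 hZ).2⟩)
      fun F hF Z hZ Z' hZ' => hnosep F hF Z (Finset.mem_filter.1 hZ).1 Z'
        (Finset.mem_filter.1 hZ').1
  -- branches between two branches met by the image of a piece
  have hbetween : ∀ Y ∈ A, ∀ Y' ∈ A, z Y = z Y' → ∀ B : Set ℝ, SetBefore (w Y) B →
      SetBefore B (w Y') → B ⊆ S.iter n ω '' z Y := by
    intro Y hY Y' hY' hzz B h1 h2 b hb
    obtain ⟨y, hy⟩ := hYne Y hY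
    obtain ⟨y', hy'⟩ := hYne Y' hY'
    have hyz := hYz Y hY hy
    have hyz' := hYz Y' hY' hy'
    rw [hzw Y hY] at hy
    rw [hzw Y' hY'] at hy'
    rw [← hzz] at hyz'
    have hc := ordConnected_image (hmono _ (hz Y hY)).1.2.1 (hmono _ (hz Y hY)).1.2.2.2.2.1
    exact hc.out (mem_image_of_mem _ hyz) (mem_image_of_mem _ hyz')
      ⟨(h1 _ hy.2 _ hb).le, (h2 _ hb _ hy'.2).le⟩
  have hfib : ∀ Z ∈ Zs,
      ((A.filter (fun Y => z Y = Z ∧ w Y ∉ S.fullBranches H 1 (S.σ^[n] ω))).card : ℝ) ≤ ξ := by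
    intro Z hZ
    set C := A.filter (fun Y => z Y = Z ∧ w Y ∉ S.fullBranches H 1 (S.σ^[n] ω)) with hC
    have hCm : ∀ Y ∈ C, Y ∈ A ∧ z Y = Z ∧ w Y ∉ S.fullBranches H 1 (S.σ^[n] ω) := fun Y hY =>
      Finset.mem_filter.1 hY
    have hinj : Set.InjOn w C := fun Y hY Y' hY' h => by
      rw [hzw Y (hCm Y hY).1, hzw Y' (hCm Y' hY').1, (hCm Y hY).2.1, (hCm Y' hY').2.1, h]
    rw [← Finset.card_image_of_injOn hinj]
    refine le_trans (Nat.cast_le.2 (hS.card_le_of_maxContiguous ?_ ?_)) hξ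
    · intro W hW
      obtain ⟨Y, hY, rfl⟩ := Finset.mem_image.1 hW
      exact ⟨hw Y (hCm Y hY).1, (hCm Y hY).2.2⟩
    · rintro B hB W hW W' hW' ⟨h1, h2⟩
      obtain ⟨Y, hY, rfl⟩ := Finset.mem_image.1 hW
      obtain ⟨Y', hY', rfl⟩ := Finset.mem_image.1 hW'
      obtain ⟨hYA, hYZ, -⟩ := hCm Y hY
      obtain ⟨hYA', hYZ', -⟩ := hCm Y' hY'
      have hsub := hbetween Y hYA Y' hYA' (hYZ.trans hYZ'.symm) B h1 h2
      have hF := inter_preimage_mem_fullPieces hS.lo_lt_hi (hz Y hYA) hB hsub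
      have c1 := setBefore_of_comp (hzw Y hYA).subset
        (Subset.rfl : z Y ∩ S.iter n ω ⁻¹' B ⊆ z Y ∩ S.iter n ω ⁻¹' B) h1
      have c2 := setBefore_of_comp
        (Subset.rfl : z Y ∩ S.iter n ω ⁻¹' B ⊆ z Y ∩ S.iter n ω ⁻¹' B)
        ((hzw Y' hYA').trans (by rw [hYZ, hYZ'])).subset h2
      rcases (hmono _ (hz Y hYA)).1.2.2.2.2.2 with hm | hm
      · exact hsep _ hF Y hYA Y' hYA' ⟨c1.1 hm, c2.1 hm⟩
      · exact hsep _ hF Y' hYA' Y hYA ⟨c2.2 hm, c1.2 hm⟩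
  have hfibfull : ∀ Z ∈ Zs,
      (A.filter (fun Y => z Y = Z ∧ w Y ∈ S.fullBranches H 1 (S.σ^[n] ω))).card ≤ 2 := by
    intro Z hZ
    set C := A.filter (fun Y => z Y = Z ∧ w Y ∈ S.fullBranches H 1 (S.σ^[n] ω)) with hC
    have hCm : ∀ Y ∈ C, Y ∈ A ∧ z Y = Z ∧ w Y ∈ S.fullBranches H 1 (S.σ^[n] ω) := fun Y hY =>
      Finset.mem_filter.1 hY
    have hinj : Set.InjOn w C := fun Y hY Y' hY' h => by
      rw [hzw Y (hCm Y hY).1, hzw Y' (hCm Y' hY').1, (hCm Y hY).2.1, (hCm Y' hY').2.1, h]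
    rw [← Finset.card_image_of_injOn hinj]
    by_contra hlt
    have hm : ∀ W ∈ C.image w, W ∈ monoIntervals (S.I \ H (S.σ^[n] ω)) (S.T (S.σ^[n] ω)) := by
      intro W hW
      obtain ⟨Y, hY, rfl⟩ := Finset.mem_image.1 hW
      exact mem_branches_one.1 (hw Y (hCm Y hY).1)
    obtain ⟨W₁, hW₁, W₂, hW₂, W₃, hW₃, h1, h2⟩ := exists_setBefore_triple (not_le.1 hlt)
      (fun W hW => (hm W hW).1.2.1)
      (fun W hW W' hW' => disjoint_of_mem_monoIntervals (hm W hW) (hm W' hW'))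
    obtain ⟨Y₁, hY₁, rfl⟩ := Finset.mem_image.1 hW₁
    obtain ⟨Y₂, hY₂, rfl⟩ := Finset.mem_image.1 hW₂
    obtain ⟨Y₃, hY₃, rfl⟩ := Finset.mem_image.1 hW₃
    obtain ⟨hA₁, hZ₁, -⟩ := hCm Y₁ hY₁
    obtain ⟨hA₂, hZ₂, hf₂⟩ := hCm Y₂ hY₂
    obtain ⟨hA₃, hZ₃, -⟩ := hCm Y₃ hY₃
    have hsub := hbetween Y₁ hA₁ Y₃ hA₃ (hZ₁.trans hZ₃.symm) _ h1 h2
    have hF := inter_preimage_mem_fullPieces hS.lo_lt_hi (hz Y₁ hA₁) hf₂ hsub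
    rw [hZ₁, ← hZ₂, ← hzw Y₂ hA₂] at hF
    exact (hA Y₂ hA₂).2 hF
  have hfibsplit : ∀ Z, (A.filter (fun Y => z Y = Z)).card =
      (A.filter (fun Y => z Y = Z ∧ w Y ∈ S.fullBranches H 1 (S.σ^[n] ω))).card +
      (A.filter (fun Y => z Y = Z ∧ w Y ∉ S.fullBranches H 1 (S.σ^[n] ω))).card := fun Z => by
    rw [← Finset.filter_filter, ← Finset.filter_filter, Finset.card_filter_add_card_filter_not]
  have hfibZf : ∀ Z ∈ Zf, ((A.filter (fun Y => z Y = Z)).card : ℝ) ≤ ξ := by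
    intro Z hZ
    obtain ⟨hZ, hfull⟩ := Finset.mem_filter.1 hZ
    have h0 : A.filter (fun Y => z Y = Z ∧ w Y ∈ S.fullBranches H 1 (S.σ^[n] ω)) = ∅ := by
      rw [Finset.filter_eq_empty_iff]
      rintro Y hY ⟨rfl, hfb⟩
      have hF := inter_preimage_mem_fullPieces hS.lo_lt_hi (hz Y hY) hfb
        ((subset_Ioo_of_mem_branches hfb.1).trans hfull.2)
      rw [← hzw Y hY] at hF
      exact (hA Y hY).2 hF
    rw [hfibsplit, h0, Finset.card_empty, zero_add]
    exact hfib Z hZ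
  have hfibZp : ∀ Z ∈ Zp, ((A.filter (fun Y => z Y = Z)).card : ℝ) ≤ ξ + 2 := by
    intro Z hZ
    have hZ := (Finset.mem_filter.1 hZ).1
    rw [hfibsplit]
    push_cast
    have h1 := hfib Z hZ
    have h2 : ((A.filter (fun Y => z Y = Z ∧ w Y ∈ S.fullBranches H 1 (S.σ^[n] ω))).card : ℝ) ≤ 2 :=
      by exact_mod_cast hfibfull Z hZ
    linarith
  have hcard : (A.card : ℝ) = ∑ Z ∈ Zs, ((A.filter (fun Y => z Y = Z)).card : ℝ) := by
    rw [Finset.card_eq_sum_card_image z A]; push_cast; rfl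
  rw [hcard, ← Finset.sum_filter_add_sum_filter_not Zs (· ∈ S.fullPieces H n ω)]
  have s1 : ∑ Z ∈ Zf, ((A.filter (fun Y => z Y = Z)).card : ℝ) ≤ 2 * ξ := by
    refine (Finset.sum_le_card_nsmul _ _ ξ hfibZf).trans ?_
    rw [nsmul_eq_mul]
    have : (Zf.card : ℝ) ≤ 2 := by exact_mod_cast hZfcard
    gcongr
  have s2 : ∑ Z ∈ Zp, ((A.filter (fun Y => z Y = Z)).card : ℝ) ≤ k * (ξ + 2) := by
    refine (Finset.sum_le_card_nsmul _ _ (ξ + 2) hfibZp).trans ?_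
    rw [nsmul_eq_mul]
    gcongr
  linarith

/-- The recursion of `isContigBound_succ` starts from `0`, the only piece of order `0` being full.
Each step multiplies by `2 + ξ` and adds `2 * ξ`, at most twice the new product; hence the factor `2
* n`. -/
theorem IsRandomOpenMap.isContigBound (hS : S.IsRandomOpenMap H) {ξ : Ω → ℝ}
    (hξ : ∀ ω, (S.maxContiguous H 1 ω : ℝ) ≤ ξ ω) (n : ℕ) (ω : Ω) :
    S.IsContigBound H n ω (2 * n * ∏ j ∈ Finset.range n, (2 + ξ (S.σ^[j] ω))) := by
  have hξ0 : ∀ ω, 0 ≤ ξ ω := fun ω => (Nat.cast_nonneg _).trans (hξ ω)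
  induction n with
  | zero =>
    intro A hA _
    have : A = ∅ := by
      rw [Finset.eq_empty_iff_forall_notMem]
      intro Y hY
      refine (hA Y hY).2 ⟨(hA Y hY).1, ?_⟩
      have : Y = Ioo S.lo S.hi := (hA Y hY).1
      rw [this]
      exact fun x hx => ⟨x, hx, rfl⟩
    simp [this]
  | succ n ih =>
    have hP : 1 ≤ ∏ j ∈ Finset.range n, (2 + ξ (S.σ^[j] ω)) := by
      rw [← Finset.prod_const_one (s := Finset.range n)]
      exact Finset.prod_le_prod (fun _ _ => zero_le_one) fun j _ => by linarith [hξ0 (S.σ^[j] ω)]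
    intro A hA hsep
    refine (hS.isContigBound_succ ih (hξ (S.σ^[n] ω)) A hA hsep).trans ?_
    rw [Finset.prod_range_succ]
    have := hξ0 (S.σ^[n] ω)
    push_cast
    nlinarith [mul_le_mul_of_nonneg_right hP (by linarith : 0 ≤ 2 + ξ (S.σ^[n] ω))]

/-! ### The branches of order `n` -/

theorem IsRandomOpenMap.fullPieces_subset_fullBranches (hS : S.IsRandomOpenMap H) (n : ℕ) (ω : Ω) :
    S.fullPieces H n ω ⊆ S.fullBranches H n ω := fun _ hY =>
  ⟨(hS.isMonoInterval_of_mem_pieces hY.1).1.mem_monoIntervals_of_full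
    (hS.mapsTo_iter_survivor n ω) hY.2, hY.2⟩

theorem IsRandomOpenMap.exists_piece_subset (hS : S.IsRandomOpenMap H) {n : ℕ} {ω : Ω} {Y : Set ℝ}
    (hY : Y ∈ S.branches H n ω) : ∃ Z ∈ S.pieces H n ω, Z ⊆ Y := by
  have h : ∃ x ∈ Y, x ∈ ⋃₀ S.pieces H n ω := by
    by_contra hcon
    push Not at hcon
    have hsub : Y ⊆ S.survivor H n ω \ ⋃₀ S.pieces H n ω := fun x hx =>
      ⟨hY.1.2.2.2.1 hx, hcon x hx⟩
    exact hY.1.not_countable ((hS.countable_diff_pieces n ω).mono hsub)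
  obtain ⟨x, hxY, Z, hZ, hxZ⟩ := h
  exact ⟨Z, hZ, subset_of_mem_monoIntervals hY (hS.isMonoInterval_of_mem_pieces hZ).1
    ⟨x, hxY, hxZ⟩⟩

/-- A branch of order `n` may consist of several pieces, since a composition can be continuous and
monotone across an end of a piece. Choosing one piece inside each branch transfers the counting
results. -/
theorem IsRandomOpenMap.exists_injOn_pieces (hS : S.IsRandomOpenMap H) (n : ℕ) (ω : Ω) :
    ∃ r : Set ℝ → Set ℝ, (∀ Y ∈ S.branches H n ω, r Y ∈ S.pieces H n ω ∧ r Y ⊆ Y) ∧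
      InjOn r (S.branches H n ω) := by
  have hex := fun Y (hY : Y ∈ S.branches H n ω) => hS.exists_piece_subset hY
  choose! r hr hrY using hex
  refine ⟨r, fun Y hY => ⟨hr Y hY, hrY Y hY⟩, fun Y hY Y' hY' h => ?_⟩
  by_contra hne
  obtain ⟨x, hx⟩ := (hS.isMonoInterval_of_mem_pieces (hr Y hY)).1.2.2.1
  exact Set.disjoint_left.1 (disjoint_of_mem_monoIntervals hY hY' hne) (hrY Y hY hx)
    (hrY Y' hY' (h ▸ hx))

theorem IsRandomOpenMap.finite_branches (hS : S.IsRandomOpenMap H) (n : ℕ) (ω : Ω) :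
    (S.branches H n ω).Finite := by
  obtain ⟨r, hr, hinj⟩ := hS.exists_injOn_pieces n ω
  exact Set.Finite.of_finite_image ((hS.finite_pieces n ω).subset
    (image_subset_iff.2 fun Y hY => (hr Y hY).1)) hinj

theorem IsRandomOpenMap.numFull_le (hS : S.IsRandomOpenMap H) (n : ℕ) (ω : Ω) :
    S.numFull H n ω ≤ ∏ j ∈ Finset.range n, (S.branches H 1 (S.σ^[j] ω)).ncard := by
  obtain ⟨r, hr, hinj⟩ := hS.exists_injOn_pieces n ω
  refine le_trans ?_ (hS.ncard_pieces_le n ω)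
  exact (ncard_le_ncard (sep_subset _ _) (hS.finite_branches n ω)).trans
    (ncard_le_ncard_of_injOn r (fun Y hY => (hr Y hY).1) hinj (hS.finite_pieces n ω))

theorem IsRandomOpenMap.prod_numFull_le_numFull (hS : S.IsRandomOpenMap H) (n : ℕ) (ω : Ω) :
    ∏ j ∈ Finset.range n, S.numFull H 1 (S.σ^[j] ω) ≤ S.numFull H n ω :=
  (hS.prod_numFull_le n ω).trans (ncard_le_ncard (hS.fullPieces_subset_fullBranches n ω)
    ((hS.finite_branches n ω).subset (sep_subset _ _)))

/-- The piece chosen in a non-full branch is not full, and a full piece between two chosen pieces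
would be a full branch inside the hull. -/
theorem IsRandomOpenMap.maxContiguous_le (hS : S.IsRandomOpenMap H) {n : ℕ} {ω : Ω} {k : ℝ}
    (hk : S.IsContigBound H n ω k) : (S.maxContiguous H n ω : ℝ) ≤ k := by
  classical
  obtain ⟨r, hr, hinj⟩ := hS.exists_injOn_pieces n ω
  have hfin : ∀ N : ℕ, (∃ A : Finset (Set ℝ), A.card = N ∧
      (∀ W ∈ A, W ∈ S.partialBranches H n ω) ∧
      ∀ Z ∈ S.fullBranches H n ω, ¬ Z ⊆ convexHull ℝ (⋃ W ∈ A, W)) → (N : ℝ) ≤ k := by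
    rintro N ⟨A, rfl, hA, hno⟩
    have hAb : ∀ W ∈ A, W ∈ S.branches H n ω := fun W hW => (hA W hW).1
    rw [← Finset.card_image_of_injOn (hinj.mono fun W hW => hAb W hW)]
    refine hk _ ?_ ?_
    · intro Y hY
      obtain ⟨W, hW, rfl⟩ := Finset.mem_image.1 hY
      refine ⟨(hr W (hAb W hW)).1, fun hfull => (hA W hW).2 ⟨hAb W hW, ?_⟩⟩
      exact hfull.2.trans (image_mono (hr W (hAb W hW)).2)
    · rintro Z hZ Y hY Y' hY' ⟨h1, h2⟩
      obtain ⟨W, hW, rfl⟩ := Finset.mem_image.1 hY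
      obtain ⟨W', hW', rfl⟩ := Finset.mem_image.1 hY'
      refine hno Z (hS.fullPieces_subset_fullBranches n ω hZ) fun x hx => ?_
      have hrW := hr W (hAb W hW)
      have hrW' := hr W' (hAb W' hW')
      obtain ⟨y, hy⟩ := (hS.isMonoInterval_of_mem_pieces hrW.1).1.2.2.1
      obtain ⟨y', hy'⟩ := (hS.isMonoInterval_of_mem_pieces hrW'.1).1.2.2.1
      have hyh : y ∈ convexHull ℝ (⋃ W ∈ A, W) :=
        subset_convexHull ℝ _ (mem_iUnion₂.2 ⟨W, hW, hrW.2 hy⟩)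
      have hyh' : y' ∈ convexHull ℝ (⋃ W ∈ A, W) :=
        subset_convexHull ℝ _ (mem_iUnion₂.2 ⟨W', hW', hrW'.2 hy'⟩)
      exact (convex_convexHull ℝ _).ordConnected.out hyh hyh'
        ⟨(h1 y hy x hx).le, (h2 x hx y' hy').le⟩
  have hempty : ∃ A : Finset (Set ℝ), A.card = 0 ∧
      (∀ W ∈ A, W ∈ S.partialBranches H n ω) ∧
      ∀ Z ∈ S.fullBranches H n ω, ¬ Z ⊆ convexHull ℝ (⋃ W ∈ A, W) :=
    ⟨∅, rfl, by simp, fun Z hZ h => by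
      have hne := hZ.1.1.2.2.1.mono h
      simp at hne⟩
  set K : Set ℕ := {k : ℕ | ∃ A : Finset (Set ℝ), A.card = k ∧
      (∀ W ∈ A, W ∈ S.partialBranches H n ω) ∧
      ∀ Z ∈ S.fullBranches H n ω, ¬ Z ⊆ convexHull ℝ (⋃ W ∈ A, W)} with hK
  -- Nonempty and bounded: the supremum is then attained and is not the default value `0`.
  have hbdd : BddAbove K := by
    refine ⟨⌈k⌉₊, fun N hN => ?_⟩
    exact_mod_cast (hfin N hN).trans (Nat.le_ceil k)
  have hmem : sSup K ∈ K := Nat.sSup_mem ⟨0, hempty⟩ hbdd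
  exact hfin _ hmem

end RandomMap

/-! ### Transfer operators as sums over fibres, up to countable sets. -/

/-- Each point of the fibre lies in exactly one interval of `R`, so the sum depends only on the
union of `R`. This makes sums over branches, over pieces and for different holes comparable. -/
theorem exists_finset_pieceTransfer_eq {R : Finset (Set ℝ)} {τ : ℝ → ℝ}
    (hinj : ∀ Z ∈ R, InjOn τ Z) (hdisj : ∀ Z ∈ R, ∀ Z' ∈ R, Z ≠ Z' → Disjoint Z Z') (x : ℝ) :
    ∃ F : Finset ℝ, (∀ y, y ∈ F ↔ (∃ Z ∈ R, y ∈ Z) ∧ τ y = x) ∧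
      ∀ w : ℝ → ℝ, pieceTransfer R τ w x = ∑ y ∈ F, w y := by
  classical
  have hm : ∀ Z ∈ R.filter (fun Z => x ∈ τ '' Z), Z ∈ R ∧ Function.invFunOn τ Z x ∈ Z ∧
      τ (Function.invFunOn τ Z x) = x := fun Z hZ => by
    obtain ⟨h1, h2⟩ := Finset.mem_filter.1 hZ
    exact ⟨h1, Function.invFunOn_mem h2, Function.invFunOn_eq h2⟩
  refine ⟨(R.filter (fun Z => x ∈ τ '' Z)).image (fun Z => Function.invFunOn τ Z x),
    fun y => ⟨?_, ?_⟩, fun w => ?_⟩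
  · intro h
    obtain ⟨Z, hZ, rfl⟩ := Finset.mem_image.1 h
    obtain ⟨h1, h2, h3⟩ := hm Z hZ
    exact ⟨⟨Z, h1, h2⟩, h3⟩
  · rintro ⟨⟨Z, hZ, hy⟩, rfl⟩
    have hZf : Z ∈ R.filter (fun Z => τ y ∈ τ '' Z) :=
      Finset.mem_filter.2 ⟨hZ, mem_image_of_mem _ hy⟩
    refine Finset.mem_image.2 ⟨Z, hZf, ?_⟩
    exact hinj Z hZ (hm Z hZf).2.1 hy (hm Z hZf).2.2
  · rw [Finset.sum_image]
    · rw [Finset.sum_filter]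
      exact Finset.sum_congr rfl fun Z _ => by rw [indicator_apply]
    · intro Z hZ Z' hZ' h
      by_contra hne
      have h1 := hm Z hZ
      have h2 := hm Z' hZ'
      have h' : Function.invFunOn τ Z x = Function.invFunOn τ Z' x := h
      exact Set.disjoint_left.1 (hdisj Z h1.1 Z' h2.1 hne) h1.2.1 (h' ▸ h2.2.1)

namespace RandomMap

variable {Ω : Type*} [MeasurableSpace Ω]

/-- The filter of subsets containing all but countably many points of the open interval. -/
noncomputable def cc (S : RandomMap Ω) : Filter ℝ := cocountable ⊓ 𝓟 (Ioo S.lo S.hi)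

variable {S : RandomMap Ω} {H : Ω → Set ℝ}

theorem eventually_cc {p : ℝ → Prop} :
    (∀ᶠ x in S.cc, p x) ↔ {x ∈ Ioo S.lo S.hi | ¬ p x}.Countable := by
  rw [cc, eventually_inf_principal, Filter.Eventually, mem_cocountable]
  refine Eq.to_iff (congrArg _ ?_)
  ext x
  simp [and_assoc]

theorem eventually_cc_mem : ∀ᶠ x in S.cc, x ∈ Ioo S.lo S.hi := by
  rw [eventually_cc]
  convert countable_empty (α := ℝ)
  ext x; simp only [mem_ofPred_eq, mem_empty_iff_false, iff_false]; tauto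

theorem eventually_cc_of_forall {p : ℝ → Prop} (h : ∀ x ∈ Ioo S.lo S.hi, p x) :
    ∀ᶠ x in S.cc, p x := eventually_cc_mem.mono h

theorem eventually_cc_notMem {C : Set ℝ} (hC : C.Countable) : ∀ᶠ x in S.cc, x ∉ C := by
  rw [eventually_cc]
  exact hC.mono fun x hx => not_not.1 hx.2

theorem cc_neBot (h : S.lo < S.hi) : S.cc.NeBot := by
  refine ⟨fun hbot => ?_⟩
  have : ∀ᶠ _ in S.cc, False := by rw [hbot]; exact eventually_bot
  rw [eventually_cc] at this
  simp only [not_false_eq_true, and_true, ofPred_mem_eq] at this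
  exact (isOpen_Ioo.measure_pos volume (nonempty_Ioo.2 h)).ne' (this.measure_zero _)

theorem countable_of_eventually_cc {p : ℝ → Prop} (h : ∀ᶠ x in S.cc, p x) :
    {x ∈ S.I | ¬ p x}.Countable := by
  rw [eventually_cc] at h
  refine (h.union (Set.toFinite {S.lo, S.hi}).countable).mono fun x hx => ?_
  by_contra hcon
  simp only [mem_union, mem_insert_iff, mem_singleton_iff, not_or] at hcon
  exact hcon.1 ⟨⟨lt_of_le_of_ne hx.1.1 (Ne.symm hcon.2.1), lt_of_le_of_ne hx.1.2 hcon.2.2⟩, hx.2⟩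

theorem ae_of_eventually_cc {p : ℝ → Prop} (h : ∀ᶠ x in S.cc, p x) :
    ∀ᵐ x ∂volume.restrict S.I, p x := by
  rw [RandomMap.I, ae_restrict_iff' measurableSet_Icc]
  refine measure_mono_null ?_ ((countable_of_eventually_cc h).measure_zero volume)
  intro x hx
  simp only [mem_compl_iff, mem_ofPred_eq, Classical.not_imp] at hx
  exact hx

/-- A property valid off a countable set is valid on the fibres over all but countably many
points. -/
theorem eventually_cc_fiber {p : ℝ → Prop} (h : ∀ᶠ x in S.cc, p x) (n : ℕ) (ω : Ω) :
    ∀ᶠ x in S.cc, ∀ y ∈ S.I, S.iter n ω y = x → p y := by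
  -- This is where countable exceptional sets are needed: the image of a null set may have positive
  -- measure.
  have hC := (countable_of_eventually_cc h).image (S.iter n ω)
  filter_upwards [eventually_cc_notMem hC] with x hx y hy hyx
  by_contra hp
  exact hx ⟨y, ⟨hy, hp⟩, hyx⟩

theorem eventually_cc_ne (a : ℝ) : ∀ᶠ x in S.cc, x ≠ a :=
  eventually_cc_notMem (countable_singleton a)

theorem gprod_succ (n : ℕ) (ω : Ω) (x : ℝ) : S.gprod (n + 1) ω x =
    S.gprod n ω x * S.g (S.σ^[n] ω) (S.iter n ω x) := Finset.prod_range_succ _ _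

theorem IsRandomOpenMap.gprod_pos (hS : S.IsRandomOpenMap H) (n : ℕ) (ω : Ω) {x : ℝ}
    (hx : x ∈ S.I) : 0 < S.gprod n ω x :=
  Finset.prod_pos fun j _ => hS.g_pos _ _ (hS.mapsTo_iter j ω hx)

theorem IsRandomOpenMap.transfer_eq_pieceTransfer (hS : S.IsRandomOpenMap H) (ω : Ω) (f : ℝ → ℝ)
    (x : ℝ) : S.transfer H ω f x = pieceTransfer (hS.finite_branches_one ω).toFinset (S.T ω)
      (fun y => f y * S.g ω y) x := by
  rw [transfer, finsum_mem_eq_finite_toFinset_sum _ (hS.finite_branches_one ω)]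
  rfl

theorem IsRandomOpenMap.exists_fiber_transfer (hS : S.IsRandomOpenMap H) (ω : Ω) :
    ∃ C : Set ℝ, C.Countable ∧ ∀ x ∉ C, ∃ F : Finset ℝ,
      (∀ y, y ∈ F ↔ y ∈ S.I \ H ω ∧ S.T ω y = x) ∧
      ∀ f, S.transfer H ω f x = ∑ y ∈ F, f y * S.g ω y := by
  refine ⟨_, (hS.countable_diff_branches_one ω).image (S.T ω), fun x hx => ?_⟩
  have hm : ∀ Z ∈ (hS.finite_branches_one ω).toFinset,
      Z ∈ monoIntervals (S.I \ H ω) (S.T ω) := fun Z hZ =>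
    mem_branches_one.1 ((hS.finite_branches_one ω).mem_toFinset.1 hZ)
  obtain ⟨F, hF, hsum⟩ := exists_finset_pieceTransfer_eq (fun Z hZ => (hm Z hZ).1.injOn)
    (fun Z hZ Z' hZ' => disjoint_of_mem_monoIntervals (hm Z hZ) (hm Z' hZ')) x
  refine ⟨F, fun y => (hF y).trans ⟨?_, ?_⟩, fun f => ?_⟩
  · rintro ⟨⟨Z, hZ, hy⟩, hyx⟩
    exact ⟨(hm Z hZ).1.2.2.2.1 hy, hyx⟩
  · rintro ⟨hy, hyx⟩
    refine ⟨?_, hyx⟩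
    by_contra hcon
    refine hx ⟨y, ⟨hy, ?_⟩, hyx⟩
    rintro ⟨Z, hZ, hyZ⟩
    exact hcon ⟨Z, (hS.finite_branches_one ω).mem_toFinset.2 hZ, hyZ⟩
  · rw [hS.transfer_eq_pieceTransfer, hsum]

/-- Off a countable set, the iterated transfer operator is a sum over the points of the survivor
set above a given point. -/
theorem IsRandomOpenMap.exists_fiber_transferIter (hS : S.IsRandomOpenMap H) (n : ℕ) (ω : Ω) :
    ∃ C : Set ℝ, C.Countable ∧ ∀ x ∈ S.I, x ∉ C → ∃ F : Finset ℝ,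
      (∀ y, y ∈ F ↔ y ∈ S.survivor H n ω ∧ S.iter n ω y = x) ∧
      ∀ f, S.transferIter H n ω f x = ∑ y ∈ F, f y * S.gprod n ω y := by
  classical
  induction n with
  | zero =>
    refine ⟨∅, countable_empty, fun x hx _ => ⟨{x}, fun y => ?_, fun f => ?_⟩⟩
    · rw [survivor_zero, Finset.mem_singleton]
      exact ⟨fun h => h.symm ▸ ⟨hx, rfl⟩, fun h => h.2⟩
    · simp [transferIter, gprod]
  | succ n ih =>
    obtain ⟨C, hC, h⟩ := ih
    obtain ⟨C', hC', h'⟩ := hS.exists_fiber_transfer (S.σ^[n] ω)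
    refine ⟨C' ∪ S.T (S.σ^[n] ω) '' C, hC'.union (hC.image _), fun x _ hxC => ?_⟩
    simp only [mem_union, not_or] at hxC
    obtain ⟨B, hB, hBsum⟩ := h' x hxC.1
    have hBC : ∀ y ∈ B, y ∉ C := fun y hy hyC => hxC.2 ⟨y, hyC, ((hB y).1 hy).2⟩
    choose! F hF hFsum using fun y (hy : y ∈ B) => h y ((hB y).1 hy).1.1 (hBC y hy)
    refine ⟨B.biUnion F, fun y => ?_, fun f => ?_⟩
    · rw [Finset.mem_biUnion, survivor_succ]
      constructor
      · rintro ⟨z, hz, hy⟩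
        obtain ⟨h1, rfl⟩ := (hF z hz y).1 hy
        obtain ⟨h2, h3⟩ := (hB _).1 hz
        exact ⟨⟨h1, h2⟩, h3⟩
      · rintro ⟨⟨h1, h2⟩, h3⟩
        have hz : S.iter n ω y ∈ B := (hB _).2 ⟨h2, h3⟩
        exact ⟨_, hz, (hF _ hz y).2 ⟨h1, rfl⟩⟩
    · rw [Finset.sum_biUnion]
      · show S.transfer H (S.σ^[n] ω) (S.transferIter H n ω f) x = _
        rw [hBsum]
        refine Finset.sum_congr rfl fun z hz => ?_
        rw [hFsum z hz, Finset.sum_mul]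
        refine Finset.sum_congr rfl fun y hy => ?_
        rw [gprod_succ, ((hF z hz y).1 hy).2, mul_assoc]
      · intro z hz z' hz' hne
        rw [Function.onFun, Finset.disjoint_left]
        intro y hy hy'
        exact hne (((hF z hz y).1 hy).2.symm.trans ((hF z' hz' y).1 hy').2)

theorem IsRandomOpenMap.eventually_transferIter_eq (hS : S.IsRandomOpenMap H) (n : ℕ) (ω : Ω) :
    ∀ᶠ x in S.cc, ∃ F : Finset ℝ,
      (∀ y, y ∈ F ↔ y ∈ S.survivor H n ω ∧ S.iter n ω y = x) ∧
      ∀ f, S.transferIter H n ω f x = ∑ y ∈ F, f y * S.gprod n ω y := by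
  obtain ⟨C, hC, h⟩ := hS.exists_fiber_transferIter n ω
  filter_upwards [eventually_cc_notMem hC, eventually_cc_mem] with x hx hxI
  exact h x (Ioo_subset_Icc_self hxI) hx

theorem transferIter_add (n k : ℕ) (ω : Ω) (f : ℝ → ℝ) : S.transferIter H (n + k) ω f =
    S.transferIter H k (S.σ^[n] ω) (S.transferIter H n ω f) := by
  induction k with
  | zero => rfl
  | succ k ih =>
    show S.transfer H (S.σ^[n + k] ω) (S.transferIter H (n + k) ω f) =
      S.transfer H (S.σ^[k] (S.σ^[n] ω)) _
    rw [ih, ← Function.iterate_add_apply, add_comm k n]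

theorem IsRandomOpenMap.transferIter_mono (hS : S.IsRandomOpenMap H) (n : ℕ) (ω : Ω)
    {f f' : ℝ → ℝ} (h : ∀ᶠ x in S.cc, f x ≤ f' x) :
    ∀ᶠ x in S.cc, S.transferIter H n ω f x ≤ S.transferIter H n ω f' x := by
  filter_upwards [hS.eventually_transferIter_eq n ω, eventually_cc_fiber h n ω] with x ⟨F, hF, hs⟩ hx
  rw [hs, hs]
  refine Finset.sum_le_sum fun y hy => ?_
  obtain ⟨hy1, hy2⟩ := (hF y).1 hy
  exact mul_le_mul_of_nonneg_right (hx y hy1.1 hy2) (hS.gprod_pos n ω hy1.1).le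

theorem IsRandomOpenMap.transferIter_congr (hS : S.IsRandomOpenMap H) (n : ℕ) (ω : Ω)
    {f f' : ℝ → ℝ} (h : ∀ᶠ x in S.cc, f x = f' x) :
    ∀ᶠ x in S.cc, S.transferIter H n ω f x = S.transferIter H n ω f' x := by
  filter_upwards [hS.transferIter_mono n ω (h.mono fun x hx => hx.le),
    hS.transferIter_mono n ω (h.mono fun x hx => hx.ge)] with x h1 h2
  exact le_antisymm h1 h2

theorem IsRandomOpenMap.transferIter_linear (hS : S.IsRandomOpenMap H) (n : ℕ) (ω : Ω)
    (a b : ℝ) (f f' : ℝ → ℝ) :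
    ∀ᶠ x in S.cc, S.transferIter H n ω (fun y => a * f y + b * f' y) x =
      a * S.transferIter H n ω f x + b * S.transferIter H n ω f' x := by
  filter_upwards [hS.eventually_transferIter_eq n ω] with x ⟨F, hF, hs⟩
  rw [hs, hs, hs, Finset.mul_sum, Finset.mul_sum, ← Finset.sum_add_distrib]
  exact Finset.sum_congr rfl fun y _ => by ring

theorem IsRandomOpenMap.transferIter_smul (hS : S.IsRandomOpenMap H) (n : ℕ) (ω : Ω)
    (a : ℝ) (f : ℝ → ℝ) :
    ∀ᶠ x in S.cc, S.transferIter H n ω (fun y => a * f y) x = a * S.transferIter H n ω f x := by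
  filter_upwards [hS.eventually_transferIter_eq n ω] with x ⟨F, hF, hs⟩
  rw [hs, hs, Finset.mul_sum]
  exact Finset.sum_congr rfl fun y _ => by ring

theorem survivor_anti {H' : Ω → Set ℝ} (h : ∀ ω, H' ω ⊆ H ω) (n : ℕ) (ω : Ω) :
    S.survivor H n ω ⊆ S.survivor H' n ω := fun _ hx =>
  ⟨hx.1, fun j hj => ⟨(hx.2 j hj).1, fun hH => (hx.2 j hj).2 (h _ hH)⟩⟩

/-- Transferring through the smaller holes a function restricted to the survivor set of the larger
holes amounts to transferring through the larger holes. -/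
theorem IsRandomOpenMap.transferIter_indicator_survivor {H' : Ω → Set ℝ}
    (hS : S.IsRandomOpenMap H) (hS' : S.IsRandomOpenMap H') (h : ∀ ω, H' ω ⊆ H ω) (n : ℕ) (ω : Ω)
    (f : ℝ → ℝ) :
    ∀ᶠ x in S.cc, S.transferIter H' n ω ((S.survivor H n ω).indicator f) x =
      S.transferIter H n ω f x := by
  classical
  filter_upwards [hS.eventually_transferIter_eq n ω, hS'.eventually_transferIter_eq n ω] with
    x ⟨F, hF, hs⟩ ⟨F', hF', hs'⟩
  rw [hs, hs']
  -- The fibre for the larger holes is the surviving part of the fibre for the smaller ones; the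
  -- weights are the same.
  have : F = F'.filter (· ∈ S.survivor H n ω) := by
    ext y
    rw [Finset.mem_filter, hF, hF']
    exact ⟨fun hy => ⟨⟨survivor_anti h n ω hy.1, hy.2⟩, hy.1⟩, fun hy => ⟨hy.2, hy.1.2⟩⟩
  rw [this, Finset.sum_filter]
  refine Finset.sum_congr rfl fun y _ => ?_
  rw [indicator_apply]
  split_ifs <;> simp

theorem IsRandomOpenMap.transferIter_anti {H' : Ω → Set ℝ}
    (hS : S.IsRandomOpenMap H) (hS' : S.IsRandomOpenMap H') (h : ∀ ω, H' ω ⊆ H ω) (n : ℕ) (ω : Ω)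
    {f : ℝ → ℝ} (hf : ∀ᶠ x in S.cc, 0 ≤ f x) :
    ∀ᶠ x in S.cc, S.transferIter H n ω f x ≤ S.transferIter H' n ω f x := by
  filter_upwards [hS.transferIter_indicator_survivor hS' h n ω f,
    hS'.transferIter_mono n ω (f := (S.survivor H n ω).indicator f) (f' := f) (by
      filter_upwards [hf] with x hx
      exact indicator_le_self' (fun _ _ => hx) x)] with x h1 h2
  rwa [← h1]

/-- The iterated transfer operator as a sum over pieces. -/
theorem IsRandomOpenMap.transferIter_eq_pieceTransfer (hS : S.IsRandomOpenMap H) (n : ℕ) (ω : Ω)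
    {f w : ℝ → ℝ} (hw : {y ∈ S.survivor H n ω | w y ≠ f y * S.gprod n ω y}.Countable) :
    ∀ᶠ x in S.cc, S.transferIter H n ω f x =
      pieceTransfer (hS.finite_pieces n ω).toFinset (S.iter n ω) w x := by
  filter_upwards [hS.eventually_transferIter_eq n ω,
    eventually_cc_notMem ((hS.countable_diff_pieces n ω).image (S.iter n ω)),
    eventually_cc_notMem (hw.image (S.iter n ω))] with x ⟨F, hF, hs⟩ hx1 hx2
  have hm : ∀ Z ∈ (hS.finite_pieces n ω).toFinset, Z ∈ S.pieces H n ω := fun Z hZ =>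
    (hS.finite_pieces n ω).mem_toFinset.1 hZ
  obtain ⟨F', hF', hs'⟩ := exists_finset_pieceTransfer_eq
    (fun Z hZ => (hS.isMonoInterval_of_mem_pieces (hm Z hZ)).1.injOn)
    (fun Z hZ Z' hZ' => disjoint_pieces (hm Z hZ) (hm Z' hZ')) x
  have hFF : F = F' := by
    ext y
    rw [hF, hF']
    refine and_congr_left fun hyx => ⟨fun hy => ?_, ?_⟩
    · by_contra hcon
      refine hx1 ⟨y, ⟨hy, ?_⟩, hyx⟩
      rintro ⟨Z, hZ, hyZ⟩
      exact hcon ⟨Z, (hS.finite_pieces n ω).mem_toFinset.2 hZ, hyZ⟩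
    · rintro ⟨Z, hZ, hyZ⟩
      exact (hS.isMonoInterval_of_mem_pieces (hm Z hZ)).1.2.2.2.1 hyZ
  rw [hs, hs', ← hFF]
  refine Finset.sum_congr rfl fun y hy => ?_
  by_contra hne
  exact hx2 ⟨y, ⟨((hF y).1 hy).1, Ne.symm hne⟩, ((hF y).1 hy).2⟩

end RandomMap

namespace RandomMap

variable {Ω : Type*} [MeasurableSpace Ω] {S : RandomMap Ω} {H : Ω → Set ℝ}

/-! ### Essential bounds -/

theorem ae_restrict_I_neBot (h : S.lo < S.hi) : (ae (volume.restrict S.I)).NeBot := by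
  rw [MeasureTheory.ae_neBot, Ne, Measure.restrict_eq_zero, RandomMap.I, Real.volume_Icc]
  simpa using h

theorem exists_abs_le_of_boundedVariationOn {f : ℝ → ℝ} {s : Set ℝ} (hf : BoundedVariationOn f s) :
    ∃ M, ∀ x ∈ s, |f x| ≤ M := by
  rcases s.eq_empty_or_nonempty with rfl | ⟨y, hy⟩
  · exact ⟨0, fun x hx => hx.elim⟩
  · refine ⟨|f y| + (eVariationOn f s).toReal, fun x hx => ?_⟩
    have h1 := hf.dist_le hx hy
    rw [Real.dist_eq] at h1
    have h2 : |f x| ≤ |f y| + |f x - f y| := by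
      calc |f x| = |f y + (f x - f y)| := by ring_nf
        _ ≤ _ := abs_add_le _ _
    linarith

theorem ae_einf_le {f : ℝ → ℝ} {M : ℝ} (h : ∀ᵐ x ∂volume.restrict S.I, M ≤ f x) :
    ∀ᵐ x ∂volume.restrict S.I, S.einf f ≤ f x :=
  ae_essInf_le ⟨M, by simpa using h⟩

theorem le_einf (hlt : S.lo < S.hi) {f : ℝ → ℝ} {c M : ℝ}
    (hc : ∀ᵐ x ∂volume.restrict S.I, c ≤ f x) (hM : ∀ᵐ x ∂volume.restrict S.I, f x ≤ M) :
    c ≤ S.einf f := by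
  have := ae_restrict_I_neBot hlt
  refine le_liminf_of_le ?_ hc
  have hb : IsBoundedUnder (· ≤ ·) (ae (volume.restrict S.I)) f := ⟨M, by simpa using hM⟩
  exact hb.isCoboundedUnder_ge

theorem einf_le_of_ae_le (hlt : S.lo < S.hi) {f : ℝ → ℝ} {c M : ℝ}
    (hc : ∀ᵐ x ∂volume.restrict S.I, c ≤ f x) (hM : ∀ᵐ x ∂volume.restrict S.I, f x ≤ M) :
    S.einf f ≤ M := by
  have := ae_restrict_I_neBot hlt
  obtain ⟨x, h1, h2⟩ := ((ae_einf_le hc).and hM).exists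
  exact h1.trans h2

theorem ae_abs_le_supNorm {f : ℝ → ℝ} {M : ℝ} (h : ∀ᵐ x ∂volume.restrict S.I, |f x| ≤ M) :
    ∀ᵐ x ∂volume.restrict S.I, |f x| ≤ S.supNorm f :=
  ae_le_essSup ⟨M, by simpa using h⟩

theorem var_nonneg (f : ℝ → ℝ) : 0 ≤ S.var f := ENNReal.toReal_nonneg

theorem IsRandomOpenMap.ae_g_bounds (hS : S.IsRandomOpenMap H) (ω : Ω) :
    ∀ᵐ x ∂volume.restrict S.I, S.einf (S.g ω) ≤ S.g ω x ∧ S.g ω x ≤ S.supNorm (S.g ω) := by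
  obtain ⟨M, hM⟩ := exists_abs_le_of_boundedVariationOn (hS.g_bv ω)
  have hmem : ∀ᵐ x ∂volume.restrict S.I, x ∈ S.I := ae_restrict_mem measurableSet_Icc
  filter_upwards [ae_einf_le (S := S) (f := S.g ω) (M := 0)
    (hmem.mono fun x hx => (hS.g_pos ω x hx).le),
    ae_abs_le_supNorm (S := S) (f := S.g ω) (hmem.mono fun x hx => hM x hx)] with x h1 h2
  exact ⟨h1, (le_abs_self _).trans h2⟩

theorem IsRandomOpenMap.einf_le_supNorm (hS : S.IsRandomOpenMap H) (ω : Ω) :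
    S.einf (S.g ω) ≤ S.supNorm (S.g ω) := by
  have := ae_restrict_I_neBot hS.lo_lt_hi
  obtain ⟨x, h1, h2⟩ := (hS.ae_g_bounds ω).exists
  exact h1.trans h2

/-! ### Regularised weights -/

/-- The normalised variation of the weight, increased by one. -/
noncomputable def relVar (S : RandomMap Ω) (ω : Ω) : ℝ :=
  S.var (S.g ω) / S.supNorm (S.g ω) + 1

theorem IsRandomOpenMap.relVar_pos (hS : S.IsRandomOpenMap H) {ω : Ω} (h : 0 < S.einf (S.g ω)) :
    0 < S.relVar ω :=
  add_pos_of_nonneg_of_pos (div_nonneg (var_nonneg _) (h.trans_le (hS.einf_le_supNorm ω)).le)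
    one_pos

/-- The slack in the choice of a representative is taken equal to the sup norm; this is the origin
of the `+ 1` in `relVar`. -/
theorem IsRandomOpenMap.exists_regular_weight (hS : S.IsRandomOpenMap H) {ω : Ω}
    (h : 0 < S.einf (S.g ω)) :
    ∃ u : ℝ → ℝ, {x ∈ S.I | S.g ω x ≠ u x}.Countable ∧
      (∀ x ∈ S.I, S.einf (S.g ω) ≤ u x ∧ u x ≤ S.supNorm (S.g ω)) ∧
      eVariationOn u S.I ≤ ENNReal.ofReal (S.supNorm (S.g ω) * S.relVar ω) := by
  have hle := hS.einf_le_supNorm ω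
  have hpos := h.trans_le hle
  obtain ⟨u, h1, h2, h3⟩ := S.exists_good_representative hS.lo_lt_hi (hS.g_bv ω) hle hpos
    ((hS.ae_g_bounds ω).mono fun x hx => hx.1) ((hS.ae_g_bounds ω).mono fun x hx => hx.2)
  refine ⟨u, h1, h2, h3.trans (le_of_eq ?_)⟩
  rw [relVar, mul_add, mul_div_cancel₀ _ hpos.ne', mul_one]

/-- Product rule, together with the fact that a monotone change of variable does not increase
variation. Only the iterates `j < k ≤ n + 1` enter, and these are monotone on the piece. -/
theorem IsRandomOpenMap.eVariationOn_prod_le (hS : S.IsRandomOpenMap H) {n : ℕ} {ω : Ω}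
    {lw up v : ℕ → ℝ} {u : ℕ → ℝ → ℝ} (hlw : ∀ j, 0 ≤ lw j) (hv : ∀ j, 0 ≤ v j)
    (hu : ∀ j, ∀ x ∈ S.I, lw j ≤ u j x ∧ u j x ≤ up j)
    (huv : ∀ j, eVariationOn (u j) S.I ≤ ENNReal.ofReal (up j * v j)) {Z : Set ℝ}
    (hZ : Z ∈ S.pieces H n ω) {k : ℕ} (hk : k ≤ n + 1) :
    (∀ x ∈ Z, ∏ j ∈ Finset.range k, lw j ≤ ∏ j ∈ Finset.range k, u j (S.iter j ω x) ∧
      ∏ j ∈ Finset.range k, u j (S.iter j ω x) ≤ ∏ j ∈ Finset.range k, up j) ∧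
    eVariationOn (fun x => ∏ j ∈ Finset.range k, u j (S.iter j ω x)) Z ≤
      ENNReal.ofReal ((∏ j ∈ Finset.range k, up j) * ∑ j ∈ Finset.range k, v j) := by
  obtain ⟨hmono, hsub, hj⟩ := hS.isMonoInterval_of_mem_pieces hZ
  have hZI : ∀ j, MapsTo (S.iter j ω) Z S.I := fun j x hx =>
    hS.mapsTo_iter j ω (Ioo_subset_Icc_self (hsub hx))
  have hup : ∀ j, 0 ≤ up j := fun j => by
    obtain ⟨x, hx⟩ := hmono.2.2.1
    have := hu j _ (hZI j hx)
    linarith [hlw j]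
  have hbd : ∀ k, ∀ x ∈ Z, ∏ j ∈ Finset.range k, lw j ≤ ∏ j ∈ Finset.range k, u j (S.iter j ω x) ∧
      ∏ j ∈ Finset.range k, u j (S.iter j ω x) ≤ ∏ j ∈ Finset.range k, up j := fun k x hx =>
    ⟨Finset.prod_le_prod (fun j _ => hlw j) fun j _ => (hu j _ (hZI j hx)).1,
      Finset.prod_le_prod (fun j _ => (hlw j).trans (hu j _ (hZI j hx)).1)
        fun j _ => (hu j _ (hZI j hx)).2⟩
  refine ⟨hbd k, ?_⟩
  induction k with
  | zero =>
    simp only [Finset.range_zero, Finset.prod_empty, Finset.sum_empty, mul_zero,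
      ENNReal.ofReal_zero, nonpos_iff_eq_zero]
    exact eVariationOn.constant_on (subsingleton_singleton.anti
      (by rintro _ ⟨x, -, rfl⟩; exact mem_singleton (1 : ℝ)))
  | succ k ih =>
    have ih := ih (by omega)
    have hPk : 0 ≤ ∏ j ∈ Finset.range k, up j := Finset.prod_nonneg fun j _ => hup j
    have hlk : 0 ≤ ∏ j ∈ Finset.range k, lw j := Finset.prod_nonneg fun j _ => hlw j
    have hsk : 0 ≤ ∑ j ∈ Finset.range k, v j := Finset.sum_nonneg fun j _ => hv j
    have hcomp : eVariationOn (fun x => u k (S.iter k ω x)) Z ≤ ENNReal.ofReal (up k * v k) := by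
      refine le_trans ?_ (huv k)
      rcases (hj k (by omega)).2 with h | h
      · exact eVariationOn.comp_le_of_monotoneOn (u k) _ h.monotoneOn (hZI k)
      · exact eVariationOn.comp_le_of_antitoneOn (u k) _ h.antitoneOn (hZI k)
    simp only [Finset.prod_range_succ, Finset.sum_range_succ]
    refine (eVariationOn_mul_le (A := ∏ j ∈ Finset.range k, up j) (B := up k) (fun x hx => ?_)
      (fun x hx => ?_)).trans ?_
    · rw [abs_of_nonneg (hlk.trans (hbd k x hx).1)]; exact (hbd k x hx).2
    · have := hu k _ (hZI k hx)
      rw [abs_of_nonneg ((hlw k).trans this.1)]; exact this.2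
    · refine (add_le_add (mul_le_mul_right ih _) (mul_le_mul_right hcomp _)).trans ?_
      rw [← ENNReal.ofReal_mul (hup k), ← ENNReal.ofReal_mul hPk, ← ENNReal.ofReal_add
        (mul_nonneg (hup k) (mul_nonneg hPk hsk)) (mul_nonneg hPk (mul_nonneg (hup k) (hv k)))]
      exact ENNReal.ofReal_le_ofReal (by ring_nf; exact le_rfl)

/-- The product weight has, off a countable set, a version with good bounds on each piece. -/
theorem IsRandomOpenMap.exists_regular_gprod (hS : S.IsRandomOpenMap H) (n : ℕ) {ω : Ω}
    (h : ∀ j, 0 < S.einf (S.g (S.σ^[j] ω))) :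
    ∃ G : ℝ → ℝ, {y ∈ S.survivor H n ω | G y ≠ S.gprod n ω y}.Countable ∧
      (∀ Z ∈ S.pieces H n ω, ∀ x ∈ Z, ∏ j ∈ Finset.range n, S.einf (S.g (S.σ^[j] ω)) ≤ G x ∧
        G x ≤ ∏ j ∈ Finset.range n, S.supNorm (S.g (S.σ^[j] ω))) ∧
      ∀ Z ∈ S.pieces H n ω, eVariationOn G Z ≤
        ENNReal.ofReal ((∏ j ∈ Finset.range n, S.supNorm (S.g (S.σ^[j] ω))) *
          ∑ j ∈ Finset.range n, S.relVar (S.σ^[j] ω)) := by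
  choose u hu1 hu2 hu3 using fun j => hS.exists_regular_weight (h j)
  have key := fun Z (hZ : Z ∈ S.pieces H n ω) =>
    hS.eVariationOn_prod_le (fun j => (h j).le) (fun j => (hS.relVar_pos (h j)).le) hu2 hu3 hZ
      (Nat.le_succ n)
  refine ⟨fun y => ∏ j ∈ Finset.range n, u j (S.iter j ω y), ?_,
    fun Z hZ => (key Z hZ).1, fun Z hZ => (key Z hZ).2⟩
  have hc : (⋃ Z ∈ S.pieces H n ω, ⋃ j ∈ {j | j ≤ n},
      Z ∩ S.iter j ω ⁻¹' {x ∈ S.I | S.g (S.σ^[j] ω) x ≠ u j x}).Countable := by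
    refine (hS.finite_pieces n ω).countable.biUnion fun Z hZ =>
      (Set.to_countable _).biUnion fun j hj => ?_
    refine MapsTo.countable_of_injOn (f := S.iter j ω) (fun x hx => hx.2) ?_ (hu1 j)
    have := ((hS.isMonoInterval_of_mem_pieces hZ).2.2 j hj).2
    exact (this.elim StrictMonoOn.injOn StrictAntiOn.injOn).mono inter_subset_left
  refine ((hS.countable_diff_pieces n ω).union hc).mono fun y hy => ?_
  by_contra hcon
  rw [mem_union, not_or] at hcon
  obtain ⟨Z, hZ, hyZ⟩ : y ∈ ⋃₀ S.pieces H n ω := by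
    by_contra hn
    exact hcon.1 ⟨hy.1, hn⟩
  refine hy.2 (Finset.prod_congr rfl fun j hj => ?_)
  by_contra hne
  exact hcon.2 (mem_iUnion₂.2 ⟨Z, hZ, mem_iUnion₂.2 ⟨j, (Finset.mem_range.1 hj).le, hyZ,
    hS.mapsTo_iter j ω hy.1.1, Ne.symm hne⟩⟩)

/-! ### The cone of functions of small relative variation -/

/-- Off a countable set, `f` is a positive function `u` with variation at most `a · inf u`. -/
def InCone (S : RandomMap Ω) (a : ℝ) (f : ℝ → ℝ) : Prop :=
  ∃ u : ℝ → ℝ, (∀ᶠ x in S.cc, f x = u x) ∧ (∀ x ∈ Ioo S.lo S.hi, 0 < u x) ∧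
    ∀ x ∈ Ioo S.lo S.hi, eVariationOn u (Ioo S.lo S.hi) ≤ ENNReal.ofReal (a * u x)

theorem InCone.mono {a b : ℝ} {f : ℝ → ℝ} (h : S.InCone a f) (hab : a ≤ b) : S.InCone b f := by
  obtain ⟨u, h1, h2, h3⟩ := h
  exact ⟨u, h1, h2, fun x hx => (h3 x hx).trans
    (ENNReal.ofReal_le_ofReal (mul_le_mul_of_nonneg_right hab (h2 x hx).le))⟩

/-- The Lasota–Yorke inequality leaves the term `V`, the variation of `u`. Since `V ≤ a * u` at the
preimage of `x` in every full piece, averaging over the full pieces bounds `V` by `a` divided by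
their number, times the value at `x` over the product of the essential infima. -/
theorem IsRandomOpenMap.inCone_transferIter (hS : S.IsRandomOpenMap H) (n : ℕ) {ω : Ω}
    (h : ∀ j, 0 < S.einf (S.g (S.σ^[j] ω))) {k a : ℝ} (hk : S.IsContigBound H n ω k) (hk0 : 0 ≤ k)
    (ha : 0 ≤ a) {f : ℝ → ℝ} (hf : S.InCone a f) :
    S.InCone ((∏ j ∈ Finset.range n, S.supNorm (S.g (S.σ^[j] ω))) /
      (∏ j ∈ Finset.range n, S.einf (S.g (S.σ^[j] ω))) *
      (∑ j ∈ Finset.range n, S.relVar (S.σ^[j] ω) + 3) * (1 + 2 * k) *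
      (1 + a / (S.fullPieces H n ω).ncard)) (S.transferIter H n ω f) := by
  classical
  obtain ⟨u, hfu, hu0, hu⟩ := hf
  obtain ⟨G, hG1, hG2, hG3⟩ := hS.exists_regular_gprod n h
  set gl := ∏ j ∈ Finset.range n, S.einf (S.g (S.σ^[j] ω)) with hgl
  set gs := ∏ j ∈ Finset.range n, S.supNorm (S.g (S.σ^[j] ω)) with hgs
  set s := ∑ j ∈ Finset.range n, S.relVar (S.σ^[j] ω) with hs
  have hgl0 : 0 < gl := Finset.prod_pos fun j _ => h j
  have hgs0 : 0 < gs := Finset.prod_pos fun j _ => (h j).trans_le (hS.einf_le_supNorm _)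
  have hs0 : 0 ≤ s := Finset.sum_nonneg fun j _ => (hS.relVar_pos (h j)).le
  set R := (hS.finite_pieces n ω).toFinset with hR
  have hffin : (S.fullPieces H n ω).Finite := (hS.finite_pieces n ω).subset (fullPieces_subset n ω)
  set M := hffin.toFinset with hM
  have hRm : ∀ Z ∈ R, Z ∈ S.pieces H n ω := fun Z hZ => (hS.finite_pieces n ω).mem_toFinset.1 hZ
  have hMm : ∀ Z, Z ∈ M ↔ Z ∈ S.fullPieces H n ω := fun Z => hffin.mem_toFinset
  have hMR : M ⊆ R := fun Z hZ =>
    (hS.finite_pieces n ω).mem_toFinset.2 (fullPieces_subset n ω ((hMm Z).1 hZ))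
  have hcardM : (S.fullPieces H n ω).ncard = M.card := ncard_eq_toFinset_card _ hffin
  have hMcard : 0 < M.card := hcardM ▸ hS.ncard_fullPieces_pos n ω
  have hMne : M.Nonempty := Finset.card_pos.1 hMcard
  have hp := fun Z (hZ : Z ∈ R) => hS.isMonoInterval_of_mem_pieces (hRm Z hZ)
  have hfull : ∀ Z ∈ M, Ioo S.lo S.hi ⊆ S.iter n ω '' Z := fun Z hZ => ((hMm Z).1 hZ).2
  have hGR : ∀ Z ∈ R, ∀ x ∈ Z, gl ≤ G x := fun Z hZ x hx => (hG2 Z (hRm Z hZ) x hx).1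
  set V := (eVariationOn u (Ioo S.lo S.hi)).toReal with hV
  obtain ⟨x₀, hx₀⟩ := nonempty_Ioo.2 hS.lo_lt_hi
  have hutop : eVariationOn u (Ioo S.lo S.hi) ≠ ⊤ :=
    ne_top_of_le_ne_top ENNReal.ofReal_ne_top (hu x₀ hx₀)
  have hVu : ∀ x ∈ Ioo S.lo S.hi, V ≤ a * u x := fun x hx =>
    ENNReal.toReal_le_of_le_ofReal (mul_nonneg ha (hu0 x hx).le) (hu x hx)
  have hV0 : 0 ≤ V := ENNReal.toReal_nonneg
  set Q := pieceTransfer R (S.iter n ω) (fun y => u y * G y) with hQ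
  have hlow : ∀ x ∈ Ioo S.lo S.hi,
      gl * ∑ Z ∈ M, u (Function.invFunOn (S.iter n ω) Z x) ≤ Q x := fun x hx =>
    le_pieceTransfer hMR (fun Z hZ => (hp Z hZ).2.1) hfull hgl0.le hGR
      (fun x hx => (hu0 x hx).le) hx
  have hinvJ : ∀ x ∈ Ioo S.lo S.hi, ∀ Z ∈ M,
      Function.invFunOn (S.iter n ω) Z x ∈ Ioo S.lo S.hi := fun x hx Z hZ =>
    (hp Z (hMR hZ)).2.1 (Function.invFunOn_mem (hfull Z hZ hx))
  have hM0 : (0 : ℝ) < M.card := by exact_mod_cast hMcard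
  refine ⟨Q, ?_, fun x hx => ?_, fun x hx => ?_⟩
  · refine hS.transferIter_eq_pieceTransfer n ω ?_
    refine (hG1.union (countable_of_eventually_cc hfu)).mono fun y hy => ?_
    by_contra hcon
    simp only [mem_union, mem_ofPred_eq, not_or, not_and, not_not] at hcon
    exact hy.2 (by rw [hcon.1 hy.1, hcon.2 hy.1.1])
  · refine lt_of_lt_of_le (mul_pos hgl0 (Finset.sum_pos (fun Z hZ => ?_) hMne)) (hlow x hx)
    exact hu0 _ (hinvJ x hx Z hZ)
  · have hLY := eVariationOn_pieceTransfer_le (u := u) (G := G) (V := V) hMR hMne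
      (fun Z hZ => (hp Z hZ).1.2.1) (fun Z hZ => (hp Z hZ).1.2.2.1) (fun Z hZ => (hp Z hZ).2.1)
      (fun Z hZ Z' hZ' => disjoint_pieces (hRm Z hZ) (hRm Z' hZ'))
      (fun Z hZ => (hp Z hZ).1.2.2.2.2.1) (fun Z hZ => (hp Z hZ).1.2.2.2.2.2) hfull hgl0 hs0 hk0 hV0
      (fun Z hZ => hG2 Z (hRm Z hZ)) (fun Z hZ => hG3 Z (hRm Z hZ)) (fun A hA hsep => ?_)
      (fun x hx => (hu0 x hx).le) (ENNReal.ofReal_toReal hutop).ge x hx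
    · refine hLY.trans (ENNReal.ofReal_le_ofReal ?_)
      rw [hcardM]
      have hQ0 : gl * M.card * V ≤ a * Q x := by
        have h1 : M.card * V ≤ a * ∑ Z ∈ M, u (Function.invFunOn (S.iter n ω) Z x) := by
          rw [Finset.mul_sum, ← nsmul_eq_mul]
          exact Finset.card_nsmul_le_sum _ _ _ fun Z hZ => hVu _ (hinvJ x hx Z hZ)
        nlinarith [mul_le_mul_of_nonneg_left (hlow x hx) ha, mul_le_mul_of_nonneg_left h1 hgl0.le]
      have hVle : V ≤ a / M.card * (Q x / gl) := by
        rw [div_mul_div_comm, le_div_iff₀ (by positivity)]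
        linarith
      calc gs * (s + 3) * (1 + 2 * k) * (Q x / gl + V)
          ≤ gs * (s + 3) * (1 + 2 * k) * (Q x / gl + a / M.card * (Q x / gl)) := by gcongr
        _ = _ := by field_simp
    · refine hk A (fun Y hY => ?_) fun Z hZ W hW W' hW' => hsep Z ((hMm Z).2 hZ) W hW W' hW'
      obtain ⟨h1, h2⟩ := Finset.mem_sdiff.1 (hA hY)
      exact ⟨hRm Y h1, fun hf => h2 ((hMm Y).2 hf)⟩

end RandomMap

/-! ### Positivity, and subtraction inside the cone. -/

theorem eVariationOn_const_mul_le (c : ℝ) (v : ℝ → ℝ) (s : Set ℝ) :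
    eVariationOn (fun x => c * v x) s ≤ ENNReal.ofReal |c| * eVariationOn v s := by
  refine iSup_le fun p => ?_
  refine le_trans ?_ (mul_le_mul_right
    (eVariationOn.sum_le (f := v) (n := p.1) p.2.2.1 p.2.2.2) _)
  rw [Finset.mul_sum]
  refine Finset.sum_le_sum fun i _ => ?_
  rw [edist_dist, edist_dist, ← ENNReal.ofReal_mul (abs_nonneg c), Real.dist_eq, Real.dist_eq,
    ← abs_mul, mul_sub]

theorem eVariationOn_const (c : ℝ) (s : Set ℝ) : eVariationOn (fun _ : ℝ => c) s = 0 :=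
  eVariationOn.constant_on (subsingleton_singleton.anti
    (by rintro _ ⟨x, -, rfl⟩; exact mem_singleton c))

namespace RandomMap

variable {Ω : Type*} [MeasurableSpace Ω] {S : RandomMap Ω} {H : Ω → Set ℝ}

theorem IsRandomOpenMap.transferIter_pos (hS : S.IsRandomOpenMap H) (n : ℕ) (ω : Ω)
    {f : ℝ → ℝ} (h : ∀ᶠ x in S.cc, 0 < f x) :
    ∀ᶠ x in S.cc, 0 < S.transferIter H n ω f x := by
  filter_upwards [hS.eventually_transferIter_eq n ω, eventually_cc_fiber h n ω,
    eventually_cc_mem] with x ⟨F, hF, hs⟩ hx hxJ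
  rw [hs]
  refine Finset.sum_pos (fun y hy => ?_) ?_
  · obtain ⟨hy1, hy2⟩ := (hF y).1 hy
    exact mul_pos (hx y hy1.1 hy2) (hS.gprod_pos n ω hy1.1)
  · obtain ⟨Z, hZ⟩ := nonempty_of_ncard_ne_zero (hS.ncard_fullPieces_pos n ω).ne'
    obtain ⟨z, hz, hzx⟩ := hZ.2 hxJ
    exact ⟨z, (hF z).2 ⟨(hS.isMonoInterval_of_mem_pieces hZ.1).1.2.2.2.1 hz, hzx⟩⟩

theorem inCone_one {a : ℝ} : S.InCone a (fun _ => 1) :=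
  ⟨fun _ => 1, Eventually.of_forall fun _ => rfl, fun _ _ => one_pos, fun x _ => by
    rw [eVariationOn_const]; exact zero_le⟩

theorem InCone.le_mul {a : ℝ} {u : ℝ → ℝ} (ha : 0 ≤ a) (hu0 : ∀ x ∈ Ioo S.lo S.hi, 0 < u x)
    (hu : ∀ x ∈ Ioo S.lo S.hi, eVariationOn u (Ioo S.lo S.hi) ≤ ENNReal.ofReal (a * u x)) :
    ∀ x ∈ Ioo S.lo S.hi, ∀ y ∈ Ioo S.lo S.hi, u x ≤ (1 + a) * u y := by
  intro x hx y hy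
  have hfin : BoundedVariationOn u (Ioo S.lo S.hi) :=
    ne_top_of_le_ne_top ENNReal.ofReal_ne_top (hu y hy)
  have h1 := hfin.sub_le hx hy
  have h2 : (eVariationOn u (Ioo S.lo S.hi)).toReal ≤ a * u y :=
    ENNReal.toReal_le_of_le_ofReal (mul_nonneg ha (hu0 y hy).le) (hu y hy)
  linarith

/-- A small multiple of one member of the cone can be subtracted from another one. -/
theorem InCone.exists_sub (hlt : S.lo < S.hi) {a : ℝ} (ha : 0 < a) {f f' : ℝ → ℝ}
    (hf : S.InCone (a / 2) f) (hf' : S.InCone (a / 2) f') :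
    ∃ s : ℝ, 0 ≤ s ∧ S.InCone a (fun x => f x - s * f' x) ∧
      ∀ᶠ x in S.cc, 1 / (3 * (1 + a / 2) ^ 4) * f x ≤ s * f' x := by
  obtain ⟨u, hu1, hu0, hu⟩ := hf
  obtain ⟨v, hv1, hv0, hv⟩ := hf'
  obtain ⟨x₀, hx₀⟩ := nonempty_Ioo.2 hlt
  have hul := InCone.le_mul (by positivity) hu0 hu
  have hvl := InCone.le_mul (by positivity) hv0 hv
  set B := 1 + a / 2 with hB
  have hB0 : 0 < B := by positivity
  have hu00 := hu0 x₀ hx₀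
  have hv00 := hv0 x₀ hx₀
  -- As `u` and `v` each vary by a factor at most `B`, this `s` gives `u / (3 * B ^ 4) ≤ s * v ≤ u /
  -- 3`. The upper bound leaves a difference of at least `2 * u / 3`, with variation at most `(a /
  -- 2) * (4 / 3) * u`.
  set s := u x₀ / (3 * B ^ 2 * v x₀) with hs
  have hs0 : 0 < s := by positivity
  have hsv : s * v x₀ = u x₀ / (3 * B ^ 2) := by rw [hs]; field_simp
  have h1 : ∀ x ∈ Ioo S.lo S.hi, s * v x ≤ u x / 3 := fun x hx => by
    calc s * v x ≤ s * (B * v x₀) := by gcongr; exact hvl x hx x₀ hx₀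
      _ = B * (s * v x₀) := by ring
      _ = u x₀ / (3 * B) := by rw [hsv]; field_simp
      _ ≤ B * u x / (3 * B) := by gcongr; exact hul x₀ hx₀ x hx
      _ = u x / 3 := by field_simp
  have h2 : ∀ x ∈ Ioo S.lo S.hi, 1 / (3 * B ^ 4) * u x ≤ s * v x := fun x hx => by
    have e1 := hul x hx x₀ hx₀
    have e2 := hvl x₀ hx₀ x hx
    calc 1 / (3 * B ^ 4) * u x ≤ 1 / (3 * B ^ 4) * (B * u x₀) := by gcongr
      _ = (s * v x₀) / B := by rw [hsv]; field_simp
      _ ≤ (s * (B * v x)) / B := by gcongr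
      _ = s * v x := by field_simp
  refine ⟨s, hs0.le, ⟨fun x => u x - s * v x, ?_, fun x hx => ?_, fun x hx => ?_⟩, ?_⟩
  · filter_upwards [hu1, hv1] with x h3 h4
    rw [h3, h4]
  · have := h1 x hx
    have := hu0 x hx
    linarith
  · have e := eVariationOn_add_le u (fun x => (-s) * v x) (Ioo S.lo S.hi)
    have e2 := eVariationOn_const_mul_le (-s) v (Ioo S.lo S.hi)
    rw [abs_neg, abs_of_pos hs0] at e2
    have e3 : eVariationOn (fun x => u x - s * v x) (Ioo S.lo S.hi) ≤
        ENNReal.ofReal (a / 2 * u x) + ENNReal.ofReal s * ENNReal.ofReal (a / 2 * v x) := by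
      have : (fun x => u x - s * v x) = fun x => u x + (-s) * v x := by ext; ring
      rw [this]
      exact e.trans (add_le_add (hu x hx) (e2.trans (mul_le_mul_right (hv x hx) _)))
    have hux := hu0 x hx
    have hvx := hv0 x hx
    rw [← ENNReal.ofReal_mul hs0.le, ← ENNReal.ofReal_add (by positivity) (by positivity)] at e3
    refine e3.trans (ENNReal.ofReal_le_ofReal ?_)
    nlinarith [h1 x hx]
  · filter_upwards [hu1, hv1, eventually_cc_mem] with x h3 h4 hx
    rw [h3, h4]
    exact h2 x hx

/-! ### Limits of normalised iterates -/

/-- `L_ω^{(n)} f / L_ω^{(n)} 1` converges uniformly (off countable sets) to the constant `c`. -/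
def HasLim (S : RandomMap Ω) (H : Ω → Set ℝ) (ω : Ω) (f : ℝ → ℝ) (c : ℝ) : Prop :=
  ∀ δ > 0, ∃ N, ∀ n ≥ N, ∀ᶠ x in S.cc, |S.transferIter H n ω f x -
    c * S.transferIter H n ω (fun _ => 1) x| ≤ δ * S.transferIter H n ω (fun _ => 1) x

variable {ω : Ω}

theorem IsRandomOpenMap.one_pos (hS : S.IsRandomOpenMap H) (n : ℕ) (ω : Ω) :
    ∀ᶠ x in S.cc, 0 < S.transferIter H n ω (fun _ => 1) x :=
  hS.transferIter_pos n ω (Eventually.of_forall fun _ => zero_lt_one)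

theorem IsRandomOpenMap.hasLim_mono (hS : S.IsRandomOpenMap H) {f f' : ℝ → ℝ} {c c' : ℝ}
    (hf : S.HasLim H ω f c) (hf' : S.HasLim H ω f' c') (h : ∀ᶠ x in S.cc, f x ≤ f' x) :
    c ≤ c' := by
  refine le_of_forall_pos_le_add fun δ hδ => ?_
  obtain ⟨N, hN⟩ := hf (δ / 2) (by positivity)
  obtain ⟨N', hN'⟩ := hf' (δ / 2) (by positivity)
  have := cc_neBot hS.lo_lt_hi
  obtain ⟨x, h1, h2, h3, h4⟩ := ((hN (max N N') (le_max_left _ _)).and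
    ((hN' (max N N') (le_max_right _ _)).and ((hS.transferIter_mono (max N N') ω h).and
      (hS.one_pos (max N N') ω)))).exists
  rw [abs_le] at h1 h2
  refine le_of_mul_le_mul_right ?_ h4
  linarith

theorem IsRandomOpenMap.hasLim_unique (hS : S.IsRandomOpenMap H) {f : ℝ → ℝ} {c c' : ℝ}
    (hf : S.HasLim H ω f c) (hf' : S.HasLim H ω f c') : c = c' :=
  le_antisymm (hS.hasLim_mono hf hf' (Eventually.of_forall fun _ => le_rfl))
    (hS.hasLim_mono hf' hf (Eventually.of_forall fun _ => le_rfl))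

theorem IsRandomOpenMap.hasLim_one (hS : S.IsRandomOpenMap H) :
    S.HasLim H ω (fun _ => 1) 1 := fun δ hδ => ⟨0, fun n _ => by
  filter_upwards [hS.one_pos n ω] with x hx
  rw [one_mul, sub_self, abs_zero]
  positivity⟩

theorem IsRandomOpenMap.hasLim_congr (hS : S.IsRandomOpenMap H) {f f' : ℝ → ℝ} {c : ℝ}
    (hf : S.HasLim H ω f c) (h : ∀ᶠ x in S.cc, f x = f' x) : S.HasLim H ω f' c := by
  intro δ hδ
  obtain ⟨N, hN⟩ := hf δ hδ
  refine ⟨N, fun n hn => ?_⟩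
  filter_upwards [hN n hn, hS.transferIter_congr n ω h] with x h1 h2
  rwa [← h2]

theorem IsRandomOpenMap.hasLim_linear (hS : S.IsRandomOpenMap H) {f f' : ℝ → ℝ} {c c' : ℝ}
    (hf : S.HasLim H ω f c) (hf' : S.HasLim H ω f' c') (a b : ℝ) :
    S.HasLim H ω (fun x => a * f x + b * f' x) (a * c + b * c') := by
  intro δ hδ
  set η := δ / (|a| + |b| + 1) with hη
  have hη0 : 0 < η := by positivity
  obtain ⟨N, hN⟩ := hf η hη0
  obtain ⟨N', hN'⟩ := hf' η hη0
  refine ⟨max N N', fun n hn => ?_⟩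
  filter_upwards [hN n ((le_max_left _ _).trans hn), hN' n ((le_max_right _ _).trans hn),
    hS.transferIter_linear n ω a b f f', hS.one_pos n ω] with x h1 h2 h3 h4
  rw [h3]
  set L := S.transferIter H n ω (fun _ => 1) x
  set p := S.transferIter H n ω f x
  set q := S.transferIter H n ω f' x
  calc |a * p + b * q - (a * c + b * c') * L| = |a * (p - c * L) + b * (q - c' * L)| := by ring_nf
    _ ≤ |a| * |p - c * L| + |b| * |q - c' * L| := by
        rw [← abs_mul, ← abs_mul]; exact abs_add_le _ _
    _ ≤ |a| * (η * L) + |b| * (η * L) := by gcongr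
    _ = (|a| + |b|) * η * L := by ring
    _ ≤ δ * L := by
        gcongr
        rw [hη, mul_div_assoc', div_le_iff₀ (by positivity)]
        nlinarith [abs_nonneg a, abs_nonneg b]

theorem IsRandomOpenMap.hasLim_add_const (hS : S.IsRandomOpenMap H) {f : ℝ → ℝ} {c : ℝ}
    (hf : S.HasLim H ω f c) (K : ℝ) : S.HasLim H ω (fun x => f x + K) (c + K) := by
  have := hS.hasLim_linear hf hS.hasLim_one 1 K
  simpa using this

theorem IsRandomOpenMap.hasLim_smul (hS : S.IsRandomOpenMap H) {f : ℝ → ℝ} {c : ℝ}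
    (hf : S.HasLim H ω f c) (a : ℝ) : S.HasLim H ω (fun x => a * f x) (a * c) := by
  have := hS.hasLim_linear hf hS.hasLim_one a 0
  simpa using this

theorem IsRandomOpenMap.hasLim_add (hS : S.IsRandomOpenMap H) {f f' : ℝ → ℝ} {c c' : ℝ}
    (hf : S.HasLim H ω f c) (hf' : S.HasLim H ω f' c') :
    S.HasLim H ω (fun x => f x + f' x) (c + c') := by
  have := hS.hasLim_linear hf hf' 1 1
  simpa using this

/-- The limit is the supremum of the constants that are eventually lower bounds of the ratio; an
approximation within `δ` pins it down to within `δ`. -/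
theorem IsRandomOpenMap.exists_hasLim_of_approx (hS : S.IsRandomOpenMap H) {f : ℝ → ℝ}
    (h : ∀ δ > 0, ∃ c, ∃ N, ∀ n ≥ N, ∀ᶠ x in S.cc, |S.transferIter H n ω f x -
      c * S.transferIter H n ω (fun _ => 1) x| ≤ δ * S.transferIter H n ω (fun _ => 1) x) :
    ∃ c, S.HasLim H ω f c := by
  set A : Set ℝ := {c | ∃ N, ∀ n ≥ N, ∀ᶠ x in S.cc,
    c * S.transferIter H n ω (fun _ => 1) x ≤ S.transferIter H n ω f x} with hA
  have key : ∀ δ > 0, ∀ c N, (∀ n ≥ N, ∀ᶠ x in S.cc, |S.transferIter H n ω f x -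
      c * S.transferIter H n ω (fun _ => 1) x| ≤ δ * S.transferIter H n ω (fun _ => 1) x) →
      c - δ ∈ A ∧ ∀ a ∈ A, a ≤ c + δ := by
    intro δ hδ c N hN
    refine ⟨⟨N, fun n hn => ?_⟩, ?_⟩
    · filter_upwards [hN n hn] with x hx
      rw [abs_le] at hx
      linarith
    · rintro a ⟨N', hN'⟩
      have := cc_neBot hS.lo_lt_hi
      obtain ⟨x, h1, h2, h3⟩ := ((hN (max N N') (le_max_left _ _)).and
        ((hN' (max N N') (le_max_right _ _)).and (hS.one_pos (max N N') ω))).exists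
      rw [abs_le] at h1
      refine le_of_mul_le_mul_right ?_ h3
      linarith
  obtain ⟨c₁, N₁, h₁⟩ := h 1 zero_lt_one
  have hbdd : BddAbove A := ⟨_, (key 1 zero_lt_one c₁ N₁ h₁).2⟩
  have hne : A.Nonempty := ⟨_, (key 1 zero_lt_one c₁ N₁ h₁).1⟩
  refine ⟨sSup A, fun δ hδ => ?_⟩
  obtain ⟨c, N, hN⟩ := h (δ / 2) (by positivity)
  obtain ⟨k1, k2⟩ := key (δ / 2) (by positivity) c N hN
  have e1 := le_csSup hbdd k1
  have e2 := csSup_le hne k2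
  refine ⟨N, fun n hn => ?_⟩
  filter_upwards [hN n hn, hS.one_pos n ω] with x h1 h2
  rw [abs_le] at h1 ⊢
  constructor <;> nlinarith

/-- Along some sequence of times, the fibre operators map a cone into a smaller one. -/
def IsContractingFibre (S : RandomMap Ω) (H : Ω → Set ℝ) (ω : Ω) : Prop :=
  ∃ a > 0, ∃ D : Set ℕ, 0 ∈ D ∧ ∀ s ∈ D, ∃ t ∈ D, s < t ∧ ∀ f, S.InCone a f →
    S.InCone (a / 2) (S.transferIter H (t - s) (S.σ^[s] ω) f)

/-- By induction along `D`, the iterate of `f` is a multiple of the iterate of `1` plus a remainder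
`r` in the cone with `r ≤ ρ ^ k` times the iterate of `f`. At the next time both `r` and the iterate
of `1` have entered the half cone, so a multiple of the latter carrying a proportion `1 - ρ` of `r`
can be subtracted without leaving the cone. -/
theorem IsRandomOpenMap.exists_hasLim_of_inCone (hS : S.IsRandomOpenMap H) {a : ℝ} (ha : 0 < a)
    {D : Set ℕ} (hD0 : 0 ∈ D) (hD : ∀ s ∈ D, ∃ t ∈ D, s < t ∧ ∀ f, S.InCone a f →
      S.InCone (a / 2) (S.transferIter H (t - s) (S.σ^[s] ω) f)) {f : ℝ → ℝ} (hf : S.InCone a f) :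
    ∃ c, S.HasLim H ω f c := by
  set ρ := 1 - 1 / (3 * (1 + a / 2) ^ 4) with hρ
  have hB : 1 ≤ 3 * (1 + a / 2) ^ 4 := by
    have : 1 ≤ (1 + a / 2) ^ 4 := one_le_pow₀ (by linarith)
    linarith
  have hρ0 : 0 ≤ ρ := by
    rw [hρ, sub_nonneg, div_le_one (by linarith)]; exact hB
  have hρ1 : ρ < 1 := by rw [hρ]; linarith [show 0 < 1 / (3 * (1 + a / 2) ^ 4) by positivity]
  have claim : ∀ k : ℕ, ∃ s ∈ D, S.InCone a (S.transferIter H s ω fun _ => 1) ∧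
      ∃ c : ℝ, ∃ r, S.InCone a r ∧
      ∀ᶠ x in S.cc, S.transferIter H s ω f x = c * S.transferIter H s ω (fun _ => 1) x + r x ∧
        r x ≤ ρ ^ k * S.transferIter H s ω f x := by
    intro k
    induction k with
    | zero =>
      refine ⟨0, hD0, inCone_one, 0, f, hf, Eventually.of_forall fun x => ?_⟩
      simp [transferIter]
    | succ k ih =>
      obtain ⟨s, hs, h1, c, r, hr, hfr⟩ := ih
      obtain ⟨t, ht, hst, hcon⟩ := hD s hs
      have hadd : ∀ h, S.transferIter H t ω h =
          S.transferIter H (t - s) (S.σ^[s] ω) (S.transferIter H s ω h) := fun h => by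
        rw [← transferIter_add, Nat.add_sub_cancel' hst.le]
      have h1' := hcon _ h1
      rw [← hadd] at h1'
      obtain ⟨s', -, hcone, hle⟩ := InCone.exists_sub hS.lo_lt_hi ha (hcon _ hr) h1'
      refine ⟨t, ht, h1'.mono (by linarith), c + s', _, hcone, ?_⟩
      filter_upwards [hle, hS.transferIter_congr (t - s) (S.σ^[s] ω) (hfr.mono fun x hx => hx.1),
        hS.transferIter_linear (t - s) (S.σ^[s] ω) c 1 (S.transferIter H s ω fun _ => 1) r,
        hS.transferIter_mono (t - s) (S.σ^[s] ω) (hfr.mono fun x hx => hx.2),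
        hS.transferIter_smul (t - s) (S.σ^[s] ω) (ρ ^ k) (S.transferIter H s ω f)]
        with x e1 e2 e3 e4 e5
      simp only [one_mul] at e3
      rw [e5] at e4
      rw [e3, ← hadd, ← hadd] at e2
      rw [← hadd] at e4
      refine ⟨by rw [e2]; ring, ?_⟩
      set y := S.transferIter H (t - s) (S.σ^[s] ω) r x
      have : y - s' * S.transferIter H t ω (fun _ => 1) x ≤ ρ * y := by rw [hρ]; linarith
      calc _ ≤ ρ * y := this
        _ ≤ ρ * (ρ ^ k * S.transferIter H t ω f x) := by gcongr
        _ = _ := by ring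
  -- A constant upper bound for `f` turns the remainder into an error relative to the iterate of
  -- `1`.
  obtain ⟨K, hK0, hK⟩ : ∃ K : ℝ, 0 < K ∧ ∀ᶠ x in S.cc, f x ≤ K := by
    obtain ⟨u, h1, h2, h3⟩ := hf
    obtain ⟨x₀, hx₀⟩ := nonempty_Ioo.2 hS.lo_lt_hi
    refine ⟨(1 + a) * u x₀, mul_pos (by linarith) (h2 x₀ hx₀), ?_⟩
    filter_upwards [h1, eventually_cc_mem] with x h4 hx
    rw [h4]
    exact InCone.le_mul ha.le h2 h3 x hx x₀ hx₀
  refine hS.exists_hasLim_of_approx fun δ hδ => ?_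
  obtain ⟨k, hk⟩ := exists_pow_lt_of_lt_one (show 0 < δ / K by positivity) hρ1
  obtain ⟨s, hs, -, c, r, ⟨u, hru, hu0, -⟩, hfr⟩ := claim k
  refine ⟨c, s, fun n hn => ?_⟩
  have hadd : ∀ h, S.transferIter H n ω h =
      S.transferIter H (n - s) (S.σ^[s] ω) (S.transferIter H s ω h) := fun h => by
    rw [← transferIter_add, Nat.add_sub_cancel' hn]
  have hr0 : ∀ᶠ x in S.cc, 0 < r x := by
    filter_upwards [hru, eventually_cc_mem] with x h1 h2
    rw [h1]; exact hu0 x h2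
  filter_upwards [hS.transferIter_congr (n - s) (S.σ^[s] ω) (hfr.mono fun x hx => hx.1),
    hS.transferIter_linear (n - s) (S.σ^[s] ω) c 1 (S.transferIter H s ω fun _ => 1) r,
    hS.transferIter_mono (n - s) (S.σ^[s] ω) (hfr.mono fun x hx => hx.2),
    hS.transferIter_smul (n - s) (S.σ^[s] ω) (ρ ^ k) (S.transferIter H s ω f),
    hS.transferIter_pos (n - s) (S.σ^[s] ω) hr0, hS.transferIter_mono n ω hK,
    hS.transferIter_smul n ω K (fun _ => 1), hS.one_pos n ω] with x e2 e3 e4 e5 e6 e7 e8 e9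
  simp only [one_mul, mul_one] at e3 e8
  rw [e8] at e7
  rw [e5] at e4
  rw [e3, ← hadd, ← hadd] at e2
  rw [← hadd] at e4
  rw [e2, add_sub_cancel_left, abs_of_pos e6]
  have hpk : 0 ≤ ρ ^ k := pow_nonneg hρ0 k
  have hkK : ρ ^ k * K ≤ δ := by rw [lt_div_iff₀ hK0] at hk; exact hk.le
  calc _ ≤ ρ ^ k * S.transferIter H n ω f x := e4
    _ ≤ ρ ^ k * (K * S.transferIter H n ω (fun _ => 1) x) := by gcongr
    _ = ρ ^ k * K * S.transferIter H n ω (fun _ => 1) x := by ring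
    _ ≤ _ := by gcongr

/-! ### Functions of bounded variation off a countable set -/

/-- Off a countable set, `f` agrees with a function of bounded variation. -/
def IsBV (S : RandomMap Ω) (f : ℝ → ℝ) : Prop :=
  ∃ u : ℝ → ℝ, (∀ᶠ x in S.cc, f x = u x) ∧ BoundedVariationOn u (Ioo S.lo S.hi)

theorem IsBV.of_boundedVariationOn {f : ℝ → ℝ} (hf : BoundedVariationOn f S.I) : S.IsBV f :=
  ⟨f, Eventually.of_forall fun _ => rfl, hf.mono Ioo_subset_Icc_self⟩

theorem IsBV.linear {f f' : ℝ → ℝ} (hf : S.IsBV f) (hf' : S.IsBV f') (a b : ℝ) :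
    S.IsBV fun x => a * f x + b * f' x := by
  obtain ⟨u, h1, h2⟩ := hf
  obtain ⟨v, h3, h4⟩ := hf'
  refine ⟨fun x => a * u x + b * v x, ?_, ?_⟩
  · filter_upwards [h1, h3] with x e1 e2
    rw [e1, e2]
  · refine ne_top_of_le_ne_top (ENNReal.add_ne_top.2 ⟨?_, ?_⟩)
      (eVariationOn_add_le (fun x => a * u x) (fun x => b * v x) _)
    · exact ne_top_of_le_ne_top (ENNReal.mul_ne_top ENNReal.ofReal_ne_top h2)
        (eVariationOn_const_mul_le a u _)
    · exact ne_top_of_le_ne_top (ENNReal.mul_ne_top ENNReal.ofReal_ne_top h4)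
        (eVariationOn_const_mul_le b v _)

theorem InCone.isBV (hlt : S.lo < S.hi) {a : ℝ} {f : ℝ → ℝ} (hf : S.InCone a f) : S.IsBV f := by
  obtain ⟨u, h1, -, h3⟩ := hf
  obtain ⟨x₀, hx₀⟩ := nonempty_Ioo.2 hlt
  exact ⟨u, h1, ne_top_of_le_ne_top ENNReal.ofReal_ne_top (h3 x₀ hx₀)⟩

/-- A large constant raises the infimum and leaves the variation unchanged; by linearity, results on
the cone then extend to all functions of bounded variation. -/
theorem IsBV.exists_inCone_add_const {f : ℝ → ℝ} (hf : S.IsBV f) {a : ℝ} (ha : 0 < a) :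
    ∃ K : ℝ, S.InCone a fun x => f x + K := by
  obtain ⟨u, h1, h2⟩ := hf
  obtain ⟨M, hM⟩ := exists_abs_le_of_boundedVariationOn h2
  set V := (eVariationOn u (Ioo S.lo S.hi)).toReal with hV
  have hV0 : 0 ≤ V := ENNReal.toReal_nonneg
  refine ⟨M + V / a + 1, fun x => u x + (M + V / a + 1), ?_, fun x hx => ?_, fun x hx => ?_⟩
  · filter_upwards [h1] with x hx
    rw [hx]
  · have := (abs_le.1 (hM x hx)).1
    have : 0 ≤ V / a := by positivity
    linarith
  · refine (eVariationOn_add_le u (fun _ => M + V / a + 1) _).trans ?_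
    rw [eVariationOn_const, add_zero, ← ENNReal.ofReal_toReal h2]
    apply ENNReal.ofReal_le_ofReal
    have h3 := (abs_le.1 (hM x hx)).1
    have h4 : a * (V / a) = V := by field_simp
    nlinarith

theorem IsRandomOpenMap.exists_hasLim (hS : S.IsRandomOpenMap H) (hω : S.IsContractingFibre H ω)
    {f : ℝ → ℝ} (hf : S.IsBV f) : ∃ c, S.HasLim H ω f c := by
  obtain ⟨a, ha, D, hD0, hD⟩ := hω
  obtain ⟨K, hK⟩ := hf.exists_inCone_add_const ha
  obtain ⟨c, hc⟩ := hS.exists_hasLim_of_inCone ha hD0 hD hK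
  refine ⟨c + -K, hS.hasLim_congr (hS.hasLim_add_const hc (-K)) (Eventually.of_forall fun x => ?_)⟩
  ring

end RandomMap

namespace RandomMap

variable {Ω : Type*} [MeasurableSpace Ω] {S : RandomMap Ω} {H : Ω → Set ℝ} {ω : Ω}

/-! ### Bounds for the iterated operators -/

theorem IsRandomOpenMap.transferIter_mono_survivor (hS : S.IsRandomOpenMap H) (n : ℕ) (ω : Ω)
    {f f' : ℝ → ℝ} (h : ∀ᶠ x in S.cc, x ∈ S.survivor H n ω → f x ≤ f' x) :
    ∀ᶠ x in S.cc, S.transferIter H n ω f x ≤ S.transferIter H n ω f' x := by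
  filter_upwards [hS.eventually_transferIter_eq n ω, eventually_cc_fiber h n ω] with x ⟨F, hF, hs⟩ hx
  rw [hs, hs]
  refine Finset.sum_le_sum fun y hy => ?_
  obtain ⟨hy1, hy2⟩ := (hF y).1 hy
  exact mul_le_mul_of_nonneg_right (hx y hy1.1 hy2 hy1) (hS.gprod_pos n ω hy1.1).le

/-- The pieces being disjoint, only the members of `P` contribute, each at most the product of the
sup norms. -/
theorem IsRandomOpenMap.transferIter_indicator_le (hS : S.IsRandomOpenMap H) (n : ℕ)
    (h : ∀ j, 0 < S.einf (S.g (S.σ^[j] ω))) (P : Finset (Set ℝ))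
    (hP : ∀ Z ∈ P, Z ∈ S.pieces H n ω) :
    ∀ᶠ x in S.cc, S.transferIter H n ω ((⋃₀ (P : Set (Set ℝ))).indicator fun _ => 1) x ≤
      P.card * ∏ j ∈ Finset.range n, S.supNorm (S.g (S.σ^[j] ω)) := by
  classical
  obtain ⟨G, hG1, hG2, -⟩ := hS.exists_regular_gprod n h
  set gs := ∏ j ∈ Finset.range n, S.supNorm (S.g (S.σ^[j] ω)) with hgs
  have hgs0 : 0 ≤ gs := Finset.prod_nonneg fun j _ => ((h j).trans_le (hS.einf_le_supNorm _)).le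
  set e : ℝ → ℝ := (⋃₀ (P : Set (Set ℝ))).indicator fun _ => 1 with he
  have hw : {y ∈ S.survivor H n ω | e y * G y ≠ e y * S.gprod n ω y}.Countable := by
    refine hG1.mono fun y hy => ?_
    exact ⟨hy.1, fun hcon => hy.2 (by rw [hcon])⟩
  filter_upwards [hS.transferIter_eq_pieceTransfer n ω hw] with x hx
  rw [hx, pieceTransfer]
  calc _ ≤ ∑ Z ∈ (hS.finite_pieces n ω).toFinset, if Z ∈ P then gs else 0 := by
        refine Finset.sum_le_sum fun Z hZ => ?_
        have hZ := (hS.finite_pieces n ω).mem_toFinset.1 hZ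
        by_cases hxZ : x ∈ S.iter n ω '' Z
        · rw [indicator_of_mem hxZ]
          have hy := Function.invFunOn_mem hxZ
          set y := Function.invFunOn (S.iter n ω) Z x
          split_ifs with hZP
          · rw [he, indicator_of_mem (mem_sUnion.2 ⟨Z, hZP, hy⟩), one_mul]
            exact (hG2 Z hZ y hy).2
          · rw [he, indicator_of_notMem, zero_mul]
            rintro ⟨Z', hZ', hy'⟩
            exact disjoint_left.1 (disjoint_pieces hZ (hP Z' hZ') (by rintro rfl; exact hZP hZ'))
              hy hy'
        · rw [indicator_of_notMem hxZ]
          split_ifs <;> first | exact hgs0 | exact le_rfl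
    _ ≤ P.card * gs := by
        rw [Finset.sum_ite_mem, Finset.sum_const, nsmul_eq_mul]
        gcongr
        exact Finset.inter_subset_right

theorem IsRandomOpenMap.transferIter_one_le (hS : S.IsRandomOpenMap H) (n : ℕ)
    (h : ∀ j, 0 < S.einf (S.g (S.σ^[j] ω))) :
    ∀ᶠ x in S.cc, S.transferIter H n ω (fun _ => 1) x ≤
      (S.pieces H n ω).ncard * ∏ j ∈ Finset.range n, S.supNorm (S.g (S.σ^[j] ω)) := by
  have h1 := hS.transferIter_indicator_le n h (hS.finite_pieces n ω).toFinset
    fun Z hZ => (hS.finite_pieces n ω).mem_toFinset.1 hZ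
  rw [← ncard_eq_toFinset_card _ (hS.finite_pieces n ω), (hS.finite_pieces n ω).coe_toFinset] at h1
  refine ((hS.transferIter_mono_survivor n ω (f := fun _ => 1) ?_).and h1).mono
    fun x hx => hx.1.trans hx.2
  filter_upwards [eventually_cc_notMem (hS.countable_diff_pieces n ω)] with x hx hxs
  rw [indicator_of_mem (by by_contra hn; exact hx ⟨hxs, hn⟩)]

theorem IsRandomOpenMap.le_transferIter_one (hS : S.IsRandomOpenMap H) (n : ℕ)
    (h : ∀ j, 0 < S.einf (S.g (S.σ^[j] ω))) :
    ∀ᶠ x in S.cc, (S.fullPieces H n ω).ncard * ∏ j ∈ Finset.range n, S.einf (S.g (S.σ^[j] ω)) ≤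
      S.transferIter H n ω (fun _ => 1) x := by
  obtain ⟨G, hG1, hG2, -⟩ := hS.exists_regular_gprod n h
  have hffin : (S.fullPieces H n ω).Finite := (hS.finite_pieces n ω).subset (fullPieces_subset n ω)
  have hw : {y ∈ S.survivor H n ω | 1 * G y ≠ 1 * S.gprod n ω y}.Countable := by
    refine hG1.mono fun y hy => ?_
    exact ⟨hy.1, fun hcon => hy.2 (by rw [hcon])⟩
  filter_upwards [hS.transferIter_eq_pieceTransfer n ω hw, eventually_cc_mem] with x hx hxJ
  rw [hx]
  have := le_pieceTransfer (J := Ioo S.lo S.hi) (M := hffin.toFinset) (u := fun _ => 1)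
    (a := ∏ j ∈ Finset.range n, S.einf (S.g (S.σ^[j] ω))) (G := G) (τ := S.iter n ω)
    (R := (hS.finite_pieces n ω).toFinset)
    (by simpa using fullPieces_subset n ω)
    (fun Z hZ => (hS.isMonoInterval_of_mem_pieces ((hS.finite_pieces n ω).mem_toFinset.1 hZ)).2.1)
    (fun Z hZ => (hffin.mem_toFinset.1 hZ).2) (Finset.prod_nonneg fun j _ => (h j).le)
    (fun Z hZ y hy => (hG2 Z ((hS.finite_pieces n ω).mem_toFinset.1 hZ) y hy).1)
    (fun _ _ => zero_le_one) hxJ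
  simpa [ncard_eq_toFinset_card _ hffin, mul_comm] using this

/-! ### The limit functional has no atoms -/

/-- Fibres along which the operators contract and the masses of small intervals tend to `0`. -/
structure IsGoodFibre (S : RandomMap Ω) (H : Ω → Set ℝ) (ω : Ω) : Prop where
  einf_pos : ∀ j, 0 < S.einf (S.g (S.σ^[j] ω))
  contracting : S.IsContractingFibre H ω
  small : ∀ δ > 0, ∃ n, ∏ j ∈ Finset.range n, S.supNorm (S.g (S.σ^[j] ω)) ≤
    δ * ((S.fullPieces H n ω).ncard * ∏ j ∈ Finset.range n, S.einf (S.g (S.σ^[j] ω)))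

theorem exists_finset_card_le_one {l : Filter ℝ} {P : Set (Set ℝ)} (hP : P.Finite)
    (h : ∀ Z ∈ P, (∀ᶠ y in l, y ∈ Z) ∨ ∀ᶠ y in l, y ∉ Z) :
    ∃ Q : Finset (Set ℝ), (∀ Z ∈ Q, Z ∈ P) ∧ Q.card ≤ 1 ∧
      ∀ᶠ y in l, y ∈ ⋃₀ P → y ∈ ⋃₀ (Q : Set (Set ℝ)) := by
  by_cases hex : ∃ Z ∈ P, ∀ᶠ y in l, y ∈ Z
  · obtain ⟨Z, hZ, hl⟩ := hex
    refine ⟨{Z}, by simpa using hZ, by simp, ?_⟩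
    filter_upwards [hl] with y hy _
    simpa using hy
  · push Not at hex
    refine ⟨∅, by simp, by simp, ?_⟩
    have : ∀ᶠ y in l, ∀ Z ∈ P, y ∉ Z := by
      rw [eventually_all_finite hP]
      intro Z hZ
      exact (h Z hZ).resolve_left (not_eventually.2 (hex Z hZ))
    filter_upwards [this] with y hy ⟨Z, hZ, hyZ⟩
    exact (hy Z hZ hyZ).elim

theorem eventually_mem_or_notMem_nhdsGT {Z : Set ℝ} (hZ : Z.OrdConnected) (x : ℝ) :
    (∀ᶠ y in 𝓝[>] x, y ∈ Z) ∨ ∀ᶠ y in 𝓝[>] x, y ∉ Z := by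
  by_cases h : ∃ᶠ y in 𝓝[>] x, y ∈ Z
  · left
    obtain ⟨z, hz, hxz⟩ := (h.and_eventually self_mem_nhdsWithin).exists
    filter_upwards [Ioo_mem_nhdsGT hxz] with y hy
    obtain ⟨w, hw, hwy⟩ := (h.and_eventually (Ioo_mem_nhdsGT hy.1)).exists
    exact hZ.out hw hz ⟨hwy.2.le, hy.2.le⟩
  · exact Or.inr (not_frequently.1 h)

theorem eventually_mem_or_notMem_nhdsLT {Z : Set ℝ} (hZ : Z.OrdConnected) (x : ℝ) :
    (∀ᶠ y in 𝓝[<] x, y ∈ Z) ∨ ∀ᶠ y in 𝓝[<] x, y ∉ Z := by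
  by_cases h : ∃ᶠ y in 𝓝[<] x, y ∈ Z
  · left
    obtain ⟨z, hz, hxz⟩ := (h.and_eventually self_mem_nhdsWithin).exists
    filter_upwards [Ioo_mem_nhdsLT hxz] with y hy
    obtain ⟨w, hw, hwy⟩ := (h.and_eventually (Ioo_mem_nhdsLT hy.2)).exists
    exact hZ.out hz hw ⟨hy.1.le, hwy.1.le⟩
  · exact Or.inr (not_frequently.1 h)

/-- By positivity, a comparison with the iterate of `1` at one time persists at all later times. -/
theorem IsRandomOpenMap.hasLim_le_of_transferIter_le (hS : S.IsRandomOpenMap H) {f : ℝ → ℝ}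
    {c θ : ℝ} (hf : S.HasLim H ω f c) (n : ℕ) (h : ∀ᶠ x in S.cc, S.transferIter H n ω f x ≤
      θ * S.transferIter H n ω (fun _ => 1) x) : c ≤ θ := by
  refine le_of_forall_pos_le_add fun δ hδ => ?_
  obtain ⟨N, hN⟩ := hf δ hδ
  have := cc_neBot hS.lo_lt_hi
  have hadd : ∀ h, S.transferIter H (n + N) ω h =
      S.transferIter H N (S.σ^[n] ω) (S.transferIter H n ω h) := fun h => transferIter_add _ _ _ _
  obtain ⟨x, h1, h2, h3, h4⟩ := ((hN (n + N) (Nat.le_add_left _ _)).and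
    ((hS.transferIter_mono N (S.σ^[n] ω) h).and ((hS.transferIter_smul N (S.σ^[n] ω) θ
      (S.transferIter H n ω fun _ => 1)).and (hS.one_pos (n + N) ω)))).exists
  rw [h3, ← hadd, ← hadd] at h2
  rw [abs_le] at h1
  refine le_of_mul_le_mul_right ?_ h4
  linarith

/-- The limit functional is small on intervals which are close to `x` on one side. -/
theorem IsRandomOpenMap.hasLim_indicator_small (hS : S.IsRandomOpenMap H)
    (hω : S.IsGoodFibre H ω) {l : Filter ℝ}
    (hl : ∀ Z : Set ℝ, Z.OrdConnected → (∀ᶠ y in l, y ∈ Z) ∨ ∀ᶠ y in l, y ∉ Z) {δ : ℝ}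
    (hδ : 0 < δ) : ∃ K ∈ l, ∀ f : ℝ → ℝ, ∀ c, S.HasLim H ω f c →
      (∀ᶠ x in S.cc, f x ≤ K.indicator (fun _ => 1) x) → c ≤ δ := by
  -- Close to the point on the given side at most one piece of order `n` occurs, and by the choice
  -- of `n` its mass is at most `δ`. The set `K` consists of the points lying in no other piece.
  obtain ⟨n, hn⟩ := hω.small δ hδ
  obtain ⟨Q, hQ, hcard, hev⟩ := exists_finset_card_le_one (hS.finite_pieces n ω)
    (fun Z hZ => hl Z (hS.isMonoInterval_of_mem_pieces hZ).1.2.1)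
  refine ⟨_, hev, fun f c hf hle => hS.hasLim_le_of_transferIter_le hf n ?_⟩
  have hgs0 : 0 ≤ ∏ j ∈ Finset.range n, S.supNorm (S.g (S.σ^[j] ω)) :=
    Finset.prod_nonneg fun j _ => ((hω.einf_pos j).trans_le (hS.einf_le_supNorm _)).le
  filter_upwards [hS.transferIter_mono_survivor n ω (f := f)
    (f' := (⋃₀ (Q : Set (Set ℝ))).indicator fun _ => 1) (by
      filter_upwards [hle, eventually_cc_notMem (hS.countable_diff_pieces n ω)] with x h1 h2 h3
      have h4 : x ∈ ⋃₀ S.pieces H n ω := by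
        by_contra hcon
        exact h2 ⟨h3, hcon⟩
      refine h1.trans ?_
      by_cases h5 : x ∈ ⋃₀ (Q : Set (Set ℝ))
      · rw [indicator_of_mem h5]
        exact indicator_le_self' (fun _ _ => zero_le_one) x
      · rw [indicator_of_notMem h5, indicator_of_notMem]
        exact fun hK : x ∈ {y | y ∈ ⋃₀ S.pieces H n ω → y ∈ ⋃₀ (Q : Set (Set ℝ))} =>
          h5 (hK h4)), hS.transferIter_indicator_le n hω.einf_pos Q hQ,
    hS.le_transferIter_one n hω.einf_pos] with x h1 h2 h3
  calc _ ≤ _ := h1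
    _ ≤ Q.card * ∏ j ∈ Finset.range n, S.supNorm (S.g (S.σ^[j] ω)) := h2
    _ ≤ 1 * ∏ j ∈ Finset.range n, S.supNorm (S.g (S.σ^[j] ω)) := by
        gcongr
        exact_mod_cast hcard
    _ ≤ _ := by rw [one_mul]; exact hn.trans (by gcongr)

end RandomMap

/-- The sum is the integer part of `t`. -/
theorem sum_indicator_le_and_le {t : ℝ} (n : ℕ) (h0 : 0 ≤ t) (hn : t ≤ n) :
    (∑ i ∈ Finset.range n, {y : ℝ | ((i + 1 : ℕ) : ℝ) ≤ y}.indicator (fun _ => (1 : ℝ)) t) ≤ t ∧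
      t ≤ (∑ i ∈ Finset.range n,
        {y : ℝ | ((i + 1 : ℕ) : ℝ) ≤ y}.indicator (fun _ => (1 : ℝ)) t) + 1 := by
  classical
  have hfl : ⌊t⌋₊ ≤ n := Nat.floor_le_of_le hn
  have : ∑ i ∈ Finset.range n, {y : ℝ | ((i + 1 : ℕ) : ℝ) ≤ y}.indicator (fun _ => (1 : ℝ)) t =
      (⌊t⌋₊ : ℝ) := by
    rw [← Finset.card_range ⌊t⌋₊, ← nsmul_one, ← Finset.sum_const,
      ← Finset.sum_subset (Finset.range_mono hfl)]
    · refine Finset.sum_congr rfl fun i hi => ?_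
      rw [Finset.mem_range, ← Nat.succ_le_iff, Nat.le_floor_iff h0] at hi
      rw [indicator_of_mem (by exact hi)]
    · intro i _ hi
      rw [Finset.mem_range, ← Nat.succ_le_iff, Nat.le_floor_iff h0] at hi
      rw [indicator_of_notMem (by exact hi)]
  rw [this]
  exact ⟨Nat.floor_le h0, (Nat.lt_floor_add_one t).le⟩

namespace RandomMap

variable {Ω : Type*} [MeasurableSpace Ω] {S : RandomMap Ω} {H : Ω → Set ℝ} {ω : Ω}

/-! ### The measure representing the limit functional -/

theorem isBV_indicator {K : Set ℝ} (hK : K.OrdConnected) : S.IsBV (K.indicator fun _ => 1) := by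
  refine .of_boundedVariationOn (ne_top_of_le_ne_top ?_
    (eVariationOn_indicator_le (M := 1) hK (fun x _ => by simp) S.I))
  rw [eVariationOn_const]
  simp

/-- `ν` represents the limit functional on the indicator functions of half-lines. -/
structure IsLimMeasure (S : RandomMap Ω) (H : Ω → Set ℝ) (ω : Ω) (ν : Measure ℝ) : Prop where
  prob : IsProbabilityMeasure ν
  noAtoms : NullSingletonClass ν
  carried : ν S.Iᶜ = 0
  hasLim_Iic : ∀ x, S.HasLim H ω ((Iic x).indicator fun _ => 1) (ν.real (Iic x))

theorem IsRandomOpenMap.hasLim_zero (hS : S.IsRandomOpenMap H) :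
    S.HasLim H ω (fun _ => 0) 0 := by
  simpa using hS.hasLim_smul hS.hasLim_one 0

/-- The limits on indicators of half-lines form a distribution function `F`: it is monotone by
positivity, `0` up to `lo` and `1` from `hi` on. Smallness on one-sided neighbourhoods makes `F`
continuous, so its Stieltjes measure has no atoms. -/
theorem IsRandomOpenMap.exists_isLimMeasure (hS : S.IsRandomOpenMap H)
    (hω : S.IsGoodFibre H ω) : ∃ ν, S.IsLimMeasure H ω ν := by
  choose F hF using fun x : ℝ =>
    hS.exists_hasLim hω.contracting (isBV_indicator (S := S) (ordConnected_Iic (a := x)))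
  have hmono : Monotone F := fun x y hxy => hS.hasLim_mono (hF x) (hF y)
    (Eventually.of_forall fun z => indicator_le_indicator_of_subset (Iic_subset_Iic.2 hxy)
      (fun _ => zero_le_one) z)
  have h0 : ∀ x ≤ S.lo, F x = 0 := fun x hx => hS.hasLim_unique (hF x)
    (hS.hasLim_congr hS.hasLim_zero (eventually_cc_of_forall fun y hy => by
      rw [indicator_of_notMem]
      simpa using hx.trans_lt hy.1))
  have h1 : ∀ x, S.hi ≤ x → F x = 1 := fun x hx => hS.hasLim_unique (hF x)
    (hS.hasLim_congr hS.hasLim_one (eventually_cc_of_forall fun y hy => by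
      rw [indicator_of_mem]
      simpa using hy.2.le.trans hx))
  -- An open interval in `K` suffices to bound the increment of `F`, since the single point `b` is
  -- negligible for `cc`.
  have key : ∀ (l : Filter ℝ), (∀ Z : Set ℝ, Z.OrdConnected →
      (∀ᶠ y in l, y ∈ Z) ∨ ∀ᶠ y in l, y ∉ Z) → ∀ δ > 0, ∃ K ∈ l, ∀ a b, Ioo a b ⊆ K →
      F b ≤ F a + δ := by
    intro l hl δ hδ
    obtain ⟨K, hK, hsm⟩ := hS.hasLim_indicator_small hω hl hδ
    refine ⟨K, hK, fun a b hab => ?_⟩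
    have := hsm _ _ (hS.hasLim_linear (hF b) (hF a) 1 (-1)) (by
      filter_upwards [eventually_cc_ne b] with x hx
      by_cases h3 : x ∈ Iic a
      · rw [indicator_of_mem h3]
        have h4 : (Iic b).indicator (fun _ => (1 : ℝ)) x ≤ 1 :=
          indicator_apply_le' (fun _ => le_rfl) (fun _ => zero_le_one)
        have h5 : 0 ≤ K.indicator (fun _ => (1 : ℝ)) x := indicator_nonneg (fun _ _ => zero_le_one) x
        linarith
      · rw [indicator_of_notMem h3]
        by_cases h4 : x ∈ Iic b
        · rw [indicator_of_mem h4, indicator_of_mem (hab ⟨not_le.1 h3, lt_of_le_of_ne h4 hx⟩)]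
          norm_num
        · rw [indicator_of_notMem h4]
          simpa using indicator_nonneg (s := K) (f := fun _ : ℝ => (1 : ℝ))
            (fun _ _ => zero_le_one) x)
    linarith
  have hcont : ∀ x, ContinuousAt F x := by
    intro x
    refine Metric.tendsto_nhds.2 fun δ hδ => ?_
    obtain ⟨K, hK, hK'⟩ := key _ (fun Z hZ => eventually_mem_or_notMem_nhdsGT hZ x) (δ / 2)
      (by positivity)
    obtain ⟨K₂, hK₂, hK₂'⟩ := key _ (fun Z hZ => eventually_mem_or_notMem_nhdsLT hZ x) (δ / 2)
      (by positivity)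
    obtain ⟨z, hz, hzK⟩ := (mem_nhdsGT_iff_exists_Ioo_subset).1 hK
    obtain ⟨w, hw, hwK⟩ := (mem_nhdsLT_iff_exists_Ioo_subset).1 hK₂
    filter_upwards [Ioo_mem_nhds hw hz] with y hy
    have e1 := hK' x z hzK
    have e2 := hK₂' w x hwK
    have e3 := hmono hy.1.le
    have e4 := hmono hy.2.le
    rw [Real.dist_eq, abs_lt]
    constructor <;> linarith
  set f : StieltjesFunction ℝ := ⟨F, hmono, fun x => (hcont x).continuousWithinAt⟩ with hf
  have hbot : Tendsto f atBot (𝓝 0) :=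
    tendsto_const_nhds.congr' ((eventually_le_atBot S.lo).mono fun x hx => (h0 x hx).symm)
  have htop : Tendsto f atTop (𝓝 1) :=
    tendsto_const_nhds.congr' ((eventually_ge_atTop S.hi).mono fun x hx => (h1 x hx).symm)
  have hprob := f.isProbabilityMeasure hbot htop
  have hF0 : ∀ x, 0 ≤ F x := fun x => by
    rcases le_total x S.lo with h | h
    · exact (h0 x h).ge
    · exact (h0 _ le_rfl).ge.trans (hmono h)
  have hIic : ∀ x, f.measure (Iic x) = ENNReal.ofReal (F x) := fun x => by
    rw [f.measure_Iic hbot, sub_zero]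
  refine ⟨f.measure, hprob, ⟨fun x => ?_⟩, ?_, fun x => ?_⟩
  · rw [f.measure_singleton, ENNReal.ofReal_eq_zero, sub_nonpos]
    exact (hcont x).continuousWithinAt.leftLim_eq.ge
  · refine measure_mono_null (t := Iic S.lo ∪ Ioi S.hi) (fun x hx => ?_) (measure_union_null ?_ ?_)
    · by_contra hcon
      simp only [mem_union, mem_Iic, mem_Ioi, not_or, not_le, not_lt] at hcon
      exact hx ⟨hcon.1.le, hcon.2⟩
    · rw [hIic, h0 _ le_rfl, ENNReal.ofReal_zero]
    · rw [f.measure_Ioi htop]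
      show ENNReal.ofReal (1 - F S.hi) = 0
      rw [h1 _ le_rfl, sub_self, ENNReal.ofReal_zero]
  · rw [Measure.real, hIic, ENNReal.toReal_ofReal (hF0 x)]
    exact hF x

theorem IsLimMeasure.ae_of_eventually_cc {ν : Measure ℝ} (hν : S.IsLimMeasure H ω ν)
    {p : ℝ → Prop} (h : ∀ᶠ x in S.cc, p x) : ∀ᵐ x ∂ν, p x := by
  have := hν.noAtoms
  refine measure_mono_null (t := S.Iᶜ ∪ {x ∈ S.I | ¬ p x}) (fun x hx => ?_)
    (measure_union_null hν.carried ((countable_of_eventually_cc h).measure_zero ν))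
  by_cases hxI : x ∈ S.I
  · exact Or.inr ⟨hxI, hx⟩
  · exact Or.inl hxI

theorem IsRandomOpenMap.hasLim_sum (hS : S.IsRandomOpenMap H) {f : ℕ → ℝ → ℝ} {c : ℕ → ℝ}
    (hf : ∀ i, S.HasLim H ω (f i) (c i)) (n : ℕ) :
    S.HasLim H ω (fun x => ∑ i ∈ Finset.range n, f i x) (∑ i ∈ Finset.range n, c i) := by
  induction n with
  | zero => simpa using hS.hasLim_zero
  | succ n ih => simpa only [Finset.sum_range_succ] using hS.hasLim_add ih (hf n)

/-- Up to its end point, negligible for both sides, a proper upper set is the complement of a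
half-line `Iic`. -/
theorem IsRandomOpenMap.hasLim_indicator_upper (hS : S.IsRandomOpenMap H) {ν : Measure ℝ}
    (hν : S.IsLimMeasure H ω ν) {U : Set ℝ} (hU : IsUpperSet U) :
    S.HasLim H ω (U.indicator fun _ => 1) (ν.real U) := by
  have := hν.prob
  have := hν.noAtoms
  rcases U.eq_empty_or_nonempty with rfl | hne
  · simpa using hS.hasLim_zero
  by_cases hb : BddBelow U
  · have h1 : Ioi (sInf U) ⊆ U := fun x hx => by
      obtain ⟨y, hy, hyx⟩ := exists_lt_of_csInf_lt hne hx
      exact hU hyx.le hy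
    have h2 : U ⊆ Ici (sInf U) := fun x hx => csInf_le hb hx
    have hreal : ν.real U = 1 + -1 * ν.real (Iic (sInf U)) := by
      have : ν.real (Ioi (sInf U)) = 1 + -1 * ν.real (Iic (sInf U)) := by
        rw [← compl_Iic, probReal_compl_eq_one_sub measurableSet_Iic]; ring
      rw [← this]
      refine measureReal_congr (Filter.EventuallyEq.symm ?_)
      refine (LE.le.eventuallyLE h1).antisymm
        ((LE.le.eventuallyLE h2).trans Ioi_ae_eq_Ici.symm.le)
    rw [hreal]
    have := hS.hasLim_linear hS.hasLim_one (hν.hasLim_Iic (sInf U)) 1 (-1)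
    rw [one_mul] at this
    refine hS.hasLim_congr this ?_
    filter_upwards [eventually_cc_ne (sInf U)] with x hx
    by_cases h3 : x ∈ U
    · rw [indicator_of_mem h3, indicator_of_notMem]
      · norm_num
      · exact not_le.2 (lt_of_le_of_ne (h2 h3) hx.symm)
    · rw [indicator_of_notMem h3, indicator_of_mem]
      · norm_num
      · exact not_lt.1 fun h => h3 (h1 (mem_Ioi.2 h))
  · have : U = univ := by
      refine eq_univ_of_forall fun x => ?_
      rw [not_bddBelow_iff] at hb
      obtain ⟨y, hy, hyx⟩ := hb x
      exact hU hyx.le hy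
    subst this
    simpa using hS.hasLim_one

/-- The sum of the indicators of `N` superlevel sets approximates `N * p` within `1`, and on upper
sets limit and measure agree. Hence the limit and the integral of `p` differ by at most `1 / N`. -/
theorem IsRandomOpenMap.hasLim_monotone (hS : S.IsRandomOpenMap H) {ν : Measure ℝ}
    (hν : S.IsLimMeasure H ω ν) (hω : S.IsContractingFibre H ω) {p : ℝ → ℝ} (hp : Monotone p)
    (h0 : ∀ x, 0 ≤ p x) (h1 : ∀ x, p x ≤ 1) :
    Integrable p ν ∧ S.HasLim H ω p (∫ x, p x ∂ν) := by
  have := hν.prob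
  have hint : Integrable p ν := .of_bound hp.measurable.aestronglyMeasurable 1
    (Eventually.of_forall fun x => by rw [Real.norm_of_nonneg (h0 x)]; exact h1 x)
  refine ⟨hint, ?_⟩
  obtain ⟨c, hc⟩ := hS.exists_hasLim hω (.of_boundedVariationOn
    ((hp.monotoneOn S.I).boundedVariationOn (C := 1) fun x _ => by
      rw [abs_of_nonneg (h0 x)]; exact h1 x))
  suffices h : c = ∫ x, p x ∂ν by rwa [← h]
  set U : ℕ → ℕ → Set ℝ := fun N i => {x | ((i + 1 : ℕ) : ℝ) ≤ N * p x} with hU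
  have hUm : ∀ N i, IsUpperSet (U N i) := fun N i x y hxy hx =>
    le_trans (show ((i + 1 : ℕ) : ℝ) ≤ N * p x from hx)
      (mul_le_mul_of_nonneg_left (hp hxy) (Nat.cast_nonneg N))
  have hind : ∀ N i x, (U N i).indicator (fun _ => (1 : ℝ)) x =
      {y : ℝ | ((i + 1 : ℕ) : ℝ) ≤ y}.indicator (fun _ => (1 : ℝ)) (N * p x) := fun N i x => rfl
  have hsum : ∀ N : ℕ, ∀ x, (∑ i ∈ Finset.range N, (U N i).indicator (fun _ => (1 : ℝ)) x) ≤
      N * p x ∧ N * p x ≤ (∑ i ∈ Finset.range N, (U N i).indicator (fun _ => (1 : ℝ)) x) + 1 := by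
    intro N x
    simp only [hind]
    exact sum_indicator_le_and_le N (mul_nonneg (Nat.cast_nonneg N) (h0 x))
      (mul_le_of_le_one_right (Nat.cast_nonneg N) (h1 x))
  have hmeas : ∀ N i, MeasurableSet (U N i) := fun N i => (hUm N i).ordConnected.measurableSet
  have hi : ∀ N i, Integrable ((U N i).indicator fun _ => (1 : ℝ)) ν := fun N i =>
    (integrable_const 1).indicator (hmeas N i)
  have hclose : ∀ N : ℕ, N * (c - ∫ x, p x ∂ν) ≤ 1 ∧ N * ((∫ x, p x ∂ν) - c) ≤ 1 := by
    intro N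
    have e1 := hS.hasLim_sum (fun i => hS.hasLim_indicator_upper hν (hUm N i)) N
    have e2 := hS.hasLim_mono e1 (hS.hasLim_smul hc N) (Eventually.of_forall fun x => (hsum N x).1)
    have e3 := hS.hasLim_mono (hS.hasLim_smul hc N) (hS.hasLim_add_const e1 1)
      (Eventually.of_forall fun x => (hsum N x).2)
    have e4 : ∫ x, ∑ i ∈ Finset.range N, (U N i).indicator (fun _ => (1 : ℝ)) x ∂ν =
        ∑ i ∈ Finset.range N, ν.real (U N i) := by
      rw [integral_finsetSum _ fun i _ => hi N i]
      exact Finset.sum_congr rfl fun i _ => by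
        rw [integral_indicator (hmeas N i)]; simp
    have hsi : Integrable (fun x => ∑ i ∈ Finset.range N, (U N i).indicator (fun _ => (1 : ℝ)) x) ν :=
      integrable_finsetSum _ fun i _ => hi N i
    have e5 := integral_mono hsi (hint.const_mul (N : ℝ)) fun x => (hsum N x).1
    have e6 := integral_mono (hint.const_mul (N : ℝ)) (hsi.add (integrable_const 1))
      fun x => (hsum N x).2
    have e7 : ∫ x, ((∑ i ∈ Finset.range N, (U N i).indicator (fun _ => (1 : ℝ)) x) + 1) ∂ν =
        (∑ i ∈ Finset.range N, ν.real (U N i)) + 1 := by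
      rw [integral_add hsi (integrable_const 1), e4]; simp
    simp only [Pi.add_apply] at e6
    rw [e4, integral_const_mul] at e5
    rw [e7, integral_const_mul] at e6
    constructor <;> linarith
  by_contra hne
  rcases lt_or_gt_of_ne hne with h | h
  · obtain ⟨N, hN⟩ := exists_nat_gt (1 / ((∫ x, p x ∂ν) - c))
    rw [div_lt_iff₀ (by linarith)] at hN
    linarith [(hclose N).2]
  · obtain ⟨N, hN⟩ := exists_nat_gt (1 / (c - ∫ x, p x ∂ν))
    rw [div_lt_iff₀ (by linarith)] at hN
    linarith [(hclose N).1]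

/-- The limit functional on functions of bounded variation is integration. -/
theorem IsRandomOpenMap.hasLim_integral (hS : S.IsRandomOpenMap H) {ν : Measure ℝ}
    (hν : S.IsLimMeasure H ω ν) (hω : S.IsContractingFibre H ω) {f : ℝ → ℝ} (hf : S.IsBV f) :
    Integrable f ν ∧ S.HasLim H ω f (∫ x, f x ∂ν) := by
  have := hν.prob
  have hmon : ∀ p : ℝ → ℝ, Monotone p → (∀ x, p S.lo ≤ p x) → (∀ x, p x ≤ p S.hi) →
      Integrable p ν ∧ S.HasLim H ω p (∫ x, p x ∂ν) := by
    intro p hp hlo hhi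
    set D := p S.hi - p S.lo + 1 with hD
    have hD0 : 0 < D := by linarith [hlo S.hi]
    obtain ⟨h1, h2⟩ := hS.hasLim_monotone hν hω (p := fun x => (p x - p S.lo) / D)
      (fun x y hxy => by have := hp hxy; show (p x - p S.lo) / D ≤ (p y - p S.lo) / D; gcongr)
      (fun x => div_nonneg (by linarith [hlo x]) hD0.le)
      (fun x => by rw [div_le_one hD0]; linarith [hhi x])
    have e : p = fun x => D * ((p x - p S.lo) / D) + p S.lo := by
      ext x; field_simp; ring
    have hi : Integrable p ν := by
      rw [e]; exact (h1.const_mul D).add (integrable_const _)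
    refine ⟨hi, ?_⟩
    have h3 := hS.hasLim_add_const (hS.hasLim_smul h2 D) (p S.lo)
    have e2 : D * (∫ x, (p x - p S.lo) / D ∂ν) + p S.lo = ∫ x, p x ∂ν := by
      conv_rhs => rw [e]
      rw [integral_add (h1.const_mul D) (integrable_const _), integral_const_mul]
      simp
    rw [e2, ← e] at h3
    exact h3
  obtain ⟨u, h1, h2⟩ := hf
  obtain ⟨M, hM⟩ := exists_abs_le_of_boundedVariationOn h2
  have hbv : BoundedVariationOn ((Ioo S.lo S.hi).indicator u) univ :=
    ne_top_of_le_ne_top (ENNReal.add_ne_top.2 ⟨h2, by simp [ENNReal.mul_eq_top]⟩)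
      (eVariationOn_indicator_le (M := ENNReal.ofReal M) ordConnected_Ioo
        (fun x hx => ENNReal.ofReal_le_ofReal (hM x hx)) univ)
  obtain ⟨p, q, hp, hq, hpq⟩ := hbv.locallyBoundedVariationOn.exists_monotoneOn_sub_monotoneOn
  rw [monotoneOn_univ] at hp hq
  -- Composing the Jordan components with the clamp onto `[lo, hi]` makes them bounded and monotone
  -- on the whole line.
  set k : ℝ → ℝ := fun x => max S.lo (min x S.hi) with hk
  have hkm : Monotone k := fun x y hxy => max_le_max le_rfl (min_le_min hxy le_rfl)
  have hlt := hS.lo_lt_hi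
  have hklo : k S.lo = S.lo := by simp [hk]
  have hkhi : k S.hi = S.hi := by simp [hk, hlt.le]
  have hk1 : ∀ x, S.lo ≤ k x := fun x => le_max_left _ _
  have hk2 : ∀ x, k x ≤ S.hi := fun x => max_le hlt.le (min_le_right _ _)
  obtain ⟨p1, p2⟩ := hmon (p ∘ k) (hp.comp hkm) (fun x => hp (by rw [hklo]; exact hk1 x))
    (fun x => hp (by rw [hkhi]; exact hk2 x))
  obtain ⟨q1, q2⟩ := hmon (q ∘ k) (hq.comp hkm) (fun x => hq (by rw [hklo]; exact hk1 x))
    (fun x => hq (by rw [hkhi]; exact hk2 x))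
  have hfe : ∀ᶠ x in S.cc, 1 * (p ∘ k) x + -1 * (q ∘ k) x = f x := by
    filter_upwards [h1, eventually_cc_mem] with x hx hxJ
    have hkx : k x = x := by
      simp only [hk]
      rw [min_eq_left hxJ.2.le, max_eq_right hxJ.1.le]
    have := congrFun hpq x
    rw [indicator_of_mem hxJ, Pi.sub_apply] at this
    rw [hx, this, Function.comp, Function.comp, hkx]
    ring
  have hlim := hS.hasLim_congr (hS.hasLim_linear p2 q2 1 (-1)) hfe
  have hae := hν.ae_of_eventually_cc hfe
  have hint := (p1.const_mul 1).add (q1.const_mul (-1))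
  refine ⟨hint.congr hae, ?_⟩
  rw [← integral_congr_ae hae, integral_add (p1.const_mul 1) (q1.const_mul (-1)),
    integral_const_mul, integral_const_mul]
  exact hlim

end RandomMap

namespace RandomMap

variable {Ω : Type*} [MeasurableSpace Ω] {S : RandomMap Ω} {H : Ω → Set ℝ} {ω : Ω}

/-! ### The conformal measure -/

theorem IsRandomOpenMap.transferIter_nonneg (hS : S.IsRandomOpenMap H) (n : ℕ) (ω : Ω)
    {f : ℝ → ℝ} (h : ∀ᶠ x in S.cc, 0 ≤ f x) : ∀ᶠ x in S.cc, 0 ≤ S.transferIter H n ω f x := by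
  filter_upwards [hS.transferIter_mono n ω h, hS.transferIter_smul n ω 0 (fun _ => 1)] with x h1 h2
  simp only [zero_mul] at h2
  rwa [h2] at h1

theorem IsRandomOpenMap.einf_transferIter_one_bounds (hS : S.IsRandomOpenMap H) (n : ℕ)
    (h : ∀ j, 0 < S.einf (S.g (S.σ^[j] ω))) :
    (S.fullPieces H n ω).ncard * ∏ j ∈ Finset.range n, S.einf (S.g (S.σ^[j] ω)) ≤
      S.einf (S.transferIter H n ω fun _ => 1) ∧
    S.einf (S.transferIter H n ω fun _ => 1) ≤
      (S.pieces H n ω).ncard * ∏ j ∈ Finset.range n, S.supNorm (S.g (S.σ^[j] ω)) := by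
  have h1 := ae_of_eventually_cc (hS.le_transferIter_one n h)
  have h2 := ae_of_eventually_cc (hS.transferIter_one_le n h)
  exact ⟨le_einf hS.lo_lt_hi h1 h2, einf_le_of_ae_le hS.lo_lt_hi h1 h2⟩

theorem IsRandomOpenMap.fullMass_pos (hS : S.IsRandomOpenMap H) (n : ℕ)
    (h : ∀ j, 0 < S.einf (S.g (S.σ^[j] ω))) :
    0 < (S.fullPieces H n ω).ncard * ∏ j ∈ Finset.range n, S.einf (S.g (S.σ^[j] ω)) :=
  mul_pos (Nat.cast_pos.2 (hS.ncard_fullPieces_pos n ω)) (Finset.prod_pos fun j _ => h j)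

/-- Uniform closeness of the iterate of `f` to `c` times the iterate of `1` passes to essential
infima; positivity of `f` covers the case where the lower factor `c - δ / 2` is negative. -/
theorem IsRandomOpenMap.tendsto_einf_ratio (hS : S.IsRandomOpenMap H)
    (h : ∀ j, 0 < S.einf (S.g (S.σ^[j] ω))) {f : ℝ → ℝ} {c : ℝ} (hf : S.HasLim H ω f c)
    (hf0 : ∀ᶠ x in S.cc, 0 ≤ f x) :
    Tendsto (fun n : ℕ => S.einf (S.transferIter H n ω f) /
      S.einf (S.transferIter H n ω (fun _ => 1))) atTop (𝓝 c) := by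
  have hc0 : 0 ≤ c := hS.hasLim_mono hS.hasLim_zero hf hf0
  refine Metric.tendsto_atTop.2 fun δ hδ => ?_
  obtain ⟨N, hN⟩ := hf (δ / 2) (by positivity)
  refine ⟨N, fun n hn => ?_⟩
  have hlt := hS.lo_lt_hi
  have h1 := ae_of_eventually_cc (hS.le_transferIter_one n h)
  have h2 := ae_of_eventually_cc (hS.transferIter_one_le n h)
  have h3 := ae_of_eventually_cc (hS.transferIter_nonneg n ω hf0)
  have h4 := ae_of_eventually_cc (hN n hn)
  have hm0 : 0 < S.einf (S.transferIter H n ω fun _ => 1) :=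
    (hS.fullMass_pos n h).trans_le (hS.einf_transferIter_one_bounds n h).1
  have h5 := ae_einf_le h1
  have h6 := ae_einf_le h3
  set m := S.einf (S.transferIter H n ω fun _ => 1)
  set e := S.einf (S.transferIter H n ω f)
  set U := (S.pieces H n ω).ncard * ∏ j ∈ Finset.range n, S.supNorm (S.g (S.σ^[j] ω))
  have hcd : 0 < c + δ / 2 := by positivity
  have up : e / (c + δ / 2) ≤ m := by
    refine le_einf hlt ?_ h2
    filter_upwards [h4, h6] with x e1 e2
    rw [div_le_iff₀ hcd]
    linarith [(abs_le.1 e1).2]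
  have lw : (c - δ / 2) * m ≤ e := by
    have hU : ∀ᵐ x ∂volume.restrict S.I, S.transferIter H n ω f x ≤ (c + δ / 2) * U := by
      filter_upwards [h4, h2] with x e1 e2
      have := mul_le_mul_of_nonneg_left e2 hcd.le
      linarith [(abs_le.1 e1).2]
    refine le_einf hlt ?_ hU
    filter_upwards [h3, h4, h5] with x e1 e2 e3
    rcases le_total 0 (c - δ / 2) with hs | hs
    · have := mul_le_mul_of_nonneg_left e3 hs
      linarith [(abs_le.1 e2).1]
    · exact (mul_nonpos_of_nonpos_of_nonneg hs hm0.le).trans e1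
  rw [div_le_iff₀ hcd] at up
  have e1 : e / m ≤ c + δ / 2 := by rw [div_le_iff₀ hm0]; linarith
  have e2 : c - δ / 2 ≤ e / m := by rw [le_div_iff₀ hm0]; exact lw
  rw [Real.dist_eq, abs_lt]
  constructor <;> linarith

/-- What remains is that the hole is null: the indicator of a component of the hole is annihilated
by one step of the operator, so its limit is at most `0`. -/
theorem IsRandomOpenMap.isConformalMeasure (hS : S.IsRandomOpenMap H) (hω : S.IsGoodFibre H ω)
    {ν : Measure ℝ} (hν : S.IsLimMeasure H ω ν) : S.IsConformalMeasure H ω ν := by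
  have := hν.prob
  refine ⟨hν.prob, hν.noAtoms.measure_singleton, ?_, fun f hf => ?_⟩
  · obtain ⟨-, J, hJ, hconn, hHJ⟩ := hS.hole ω
    rw [compl_sdiff]
    refine measure_union_null ?_ hν.carried
    rw [hHJ, measure_sUnion_null_iff hJ.countable]
    intro K hK
    have hmeas := (hconn K hK).measurableSet
    have h1 := (hS.hasLim_integral hν hω.contracting (isBV_indicator (hconn K hK))).2
    have h2 := hS.hasLim_le_of_transferIter_le (θ := 0) h1 1 (by
      filter_upwards [hS.transferIter_mono_survivor 1 ω (f := K.indicator fun _ => 1)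
        (f' := fun _ => 0) (Eventually.of_forall fun x hx => by
          rw [indicator_of_notMem]
          intro hxK
          refine (hx.2 0 zero_lt_one).2 ?_
          show x ∈ H ω
          rw [hHJ]
          exact ⟨K, hK, hxK⟩), hS.transferIter_smul 1 ω 0 (fun _ => 1)] with x e1 e2
      simp only [zero_mul] at e2 ⊢
      rwa [e2] at e1)
    rw [integral_indicator hmeas] at h2
    simp only [integral_const, MeasurableSet.univ, measureReal_restrict_apply, univ_inter,
      smul_eq_mul, mul_one] at h2
    exact (measureReal_eq_zero_iff).1 (le_antisymm h2 measureReal_nonneg)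
  · obtain ⟨h1, h2, -⟩ := hf
    exact hS.tendsto_einf_ratio hω.einf_pos
      (hS.hasLim_integral hν hω.contracting (.of_boundedVariationOn h1)).2
      (eventually_cc_of_forall fun x hx => (h2 x (Ioo_subset_Icc_self hx)).le)

/-- The variation is at most `2` and the constant raises the infimum to `2`. These test functions
determine the distribution function, hence the conformal measure. -/
theorem indicator_Iic_add_two_mem_cone (hlt : S.lo < S.hi) (x : ℝ) :
    (fun y => (Iic x).indicator (fun _ => (1 : ℝ)) y + 2) ∈ S.cone 1 := by
  have hv : eVariationOn (fun y => (Iic x).indicator (fun _ => (1 : ℝ)) y + 2) S.I ≤ 2 := by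
    refine (eVariationOn_add_le _ (fun _ => (2 : ℝ)) _).trans ?_
    rw [eVariationOn_const, add_zero]
    refine (eVariationOn_indicator_le (M := 1) ordConnected_Iic (fun x _ => by simp) S.I).trans ?_
    rw [eVariationOn_const]
    simp
  have h0 : ∀ y, 0 ≤ (Iic x).indicator (fun _ => (1 : ℝ)) y :=
    indicator_nonneg fun _ _ => zero_le_one
  have h1 : ∀ y, (Iic x).indicator (fun _ => (1 : ℝ)) y ≤ 1 := fun y =>
    indicator_apply_le' (fun _ => le_rfl) (fun _ => zero_le_one)
  refine ⟨ne_top_of_le_ne_top (by simp) hv, fun y _ => by linarith [h0 y], ?_⟩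
  have e1 : S.var (fun y => (Iic x).indicator (fun _ => (1 : ℝ)) y + 2) ≤ 2 := by
    refine ENNReal.toReal_le_of_le_ofReal zero_le_two (le_trans (iInf_le _ ⟨_, EventuallyEq.rfl⟩) ?_)
    simpa using hv
  have e2 : 2 ≤ S.einf (fun y => (Iic x).indicator (fun _ => (1 : ℝ)) y + 2) :=
    le_einf hlt (M := 3) (Eventually.of_forall fun y => by linarith [h0 y])
      (Eventually.of_forall fun y => by linarith [h1 y])
  linarith

theorem IsConformalMeasure.eq {ν ν' : Measure ℝ} (hlt : S.lo < S.hi)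
    (hν : S.IsConformalMeasure H ω ν) (hν' : S.IsConformalMeasure H ω ν') : ν = ν' := by
  have := hν.prob
  have := hν'.prob
  have key : ∀ μ : Measure ℝ, IsProbabilityMeasure μ → ∀ x,
      ∫ y, ((Iic x).indicator (fun _ => (1 : ℝ)) y + 2) ∂μ = μ.real (Iic x) + 2 := by
    intro μ _ x
    rw [integral_add ((integrable_const 1).indicator measurableSet_Iic) (integrable_const 2),
      integral_indicator measurableSet_Iic]
    simp
  refine Measure.ext_of_Iic ν ν' fun x => ?_
  have h := tendsto_nhds_unique (hν.limit _ (indicator_Iic_add_two_mem_cone hlt x))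
    (hν'.limit _ (indicator_Iic_add_two_mem_cone hlt x))
  rw [key ν hν.prob, key ν' hν'.prob] at h
  exact (measureReal_eq_measureReal_iff).1 (by linarith)

theorem IsRandomOpenMap.isLimMeasure_conformalMeasure (hS : S.IsRandomOpenMap H)
    (hω : S.IsGoodFibre H ω) : S.IsLimMeasure H ω (S.conformalMeasure H ω) := by
  obtain ⟨ν, hν⟩ := hS.exists_isLimMeasure hω
  have h1 := hS.isConformalMeasure hω hν
  have hex : ∃ ν, S.IsConformalMeasure H ω ν := ⟨ν, h1⟩
  rw [conformalMeasure, dif_pos hex, ← h1.eq hS.lo_lt_hi hex.choose_spec]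
  exact hν

/-! ### Equivariance -/

/-- Both `f + K` and `1` lie in a cone, and so do their images; subtract by linearity. -/
theorem IsRandomOpenMap.isBV_transferIter (hS : S.IsRandomOpenMap H) (n : ℕ)
    (h : ∀ j, 0 < S.einf (S.g (S.σ^[j] ω))) {f : ℝ → ℝ} (hf : S.IsBV f) :
    S.IsBV (S.transferIter H n ω f) := by
  have hc := hS.isContigBound (ξ := fun ω => S.maxContiguous H 1 ω) (fun ω => le_rfl) n ω
  have hc0 : (0 : ℝ) ≤ 2 * n * ∏ j ∈ Finset.range n, (2 + (S.maxContiguous H 1 (S.σ^[j] ω) : ℝ)) := by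
    positivity
  obtain ⟨K, hK⟩ := hf.exists_inCone_add_const zero_lt_one
  have h1 := (hS.inCone_transferIter n h hc hc0 zero_le_one hK).isBV hS.lo_lt_hi
  have h2 := (hS.inCone_transferIter n h hc hc0 zero_le_one inCone_one).isBV hS.lo_lt_hi
  obtain ⟨u, hu1, hu2⟩ := h1.linear h2 1 (-K)
  refine ⟨u, ?_, hu2⟩
  filter_upwards [hu1, hS.transferIter_linear n ω 1 K f (fun _ => 1)] with x e1 e2
  simp only [one_mul, mul_one] at e2
  rw [← e1, e2]
  ring

/-- `L^{(1+n)} f` is close to `c` times `L^{(1+n)} 1`, which is the `n`-th iterate over `σ ω` of the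
transferred `1`, hence close to `l` times the iterate of `1`. -/
theorem IsRandomOpenMap.hasLim_transfer (hS : S.IsRandomOpenMap H) {f : ℝ → ℝ} {c l : ℝ}
    (hf : S.HasLim H ω f c) (hl : S.HasLim H (S.σ ω) (S.transfer H ω fun _ => 1) l) :
    S.HasLim H (S.σ ω) (S.transfer H ω f) (c * l) := by
  intro δ hδ
  set η := δ / (2 * (|l| + 1)) with hη
  set η' := δ / (2 * (|c| + 1)) with hη'
  have hη0 : 0 < η := by positivity
  have hη0' : 0 < η' := by positivity
  obtain ⟨N, hN⟩ := hf η hη0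
  obtain ⟨N₁, hN₁⟩ := hl 1 zero_lt_one
  obtain ⟨N', hN'⟩ := hl η' hη0'
  refine ⟨max N (max N₁ N'), fun n hn => ?_⟩
  have hadd : ∀ h, S.transferIter H (1 + n) ω h =
      S.transferIter H n (S.σ ω) (S.transfer H ω h) := fun h => transferIter_add 1 n ω h
  filter_upwards [hN (1 + n) (((le_max_left _ _).trans hn).trans (Nat.le_add_left _ _)),
    hN₁ n (((le_max_left _ _).trans (le_max_right _ _)).trans hn),
    hN' n (((le_max_right _ _).trans (le_max_right _ _)).trans hn),
    hS.one_pos n (S.σ ω), hS.one_pos (1 + n) ω] with x h1 h2 h3 h4 h5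
  rw [hadd, hadd] at h1
  rw [hadd] at h5
  set A := S.transferIter H n (S.σ ω) (S.transfer H ω f) x
  set B := S.transferIter H n (S.σ ω) (S.transfer H ω fun _ => 1) x
  set C := S.transferIter H n (S.σ ω) (fun _ => 1) x
  have hB : B ≤ (|l| + 1) * C := by
    have := (abs_le.1 h2).2
    have := mul_le_mul_of_nonneg_right (le_abs_self l) h4.le
    linarith
  calc |A - c * l * C| = |(A - c * B) + c * (B - l * C)| := by ring_nf
    _ ≤ |A - c * B| + |c| * |B - l * C| := by rw [← abs_mul]; exact abs_add_le _ _
    _ ≤ η * ((|l| + 1) * C) + |c| * (η' * C) := by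
        gcongr
        exact h1.trans (by gcongr)
    _ ≤ η * ((|l| + 1) * C) + (|c| + 1) * (η' * C) := by gcongr; linarith
    _ = δ * C := by rw [hη, hη']; field_simp; ring

theorem IsRandomOpenMap.integral_transfer (hS : S.IsRandomOpenMap H) (hω : S.IsGoodFibre H ω)
    (hσω : S.IsGoodFibre H (S.σ ω)) {f : ℝ → ℝ} (hf : S.IsBV f) :
    ∫ x, S.transfer H ω f x ∂(S.conformalMeasure H (S.σ ω)) =
      S.multiplier H ω * ∫ x, f x ∂(S.conformalMeasure H ω) := by
  have hν := hS.isLimMeasure_conformalMeasure hω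
  have hν' := hS.isLimMeasure_conformalMeasure hσω
  have hbv : ∀ {h}, S.IsBV h → S.IsBV (S.transfer H ω h) := fun hh =>
    hS.isBV_transferIter 1 hω.einf_pos hh
  have hone : S.IsBV fun _ => 1 := inCone_one.isBV (a := 1) hS.lo_lt_hi
  have h1 := (hS.hasLim_integral hν hω.contracting hf).2
  have h2 := (hS.hasLim_integral hν' hσω.contracting (hbv hf)).2
  have h3 := (hS.hasLim_integral hν' hσω.contracting (hbv hone)).2
  rw [hS.hasLim_unique h2 (hS.hasLim_transfer h1 h3), mul_comm]
  rfl

theorem IsRandomOpenMap.integral_transferIter (hS : S.IsRandomOpenMap H)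
    (hω : ∀ j, S.IsGoodFibre H (S.σ^[j] ω)) (n : ℕ) {f : ℝ → ℝ} (hf : S.IsBV f) :
    ∫ x, S.transferIter H n ω f x ∂(S.conformalMeasure H (S.σ^[n] ω)) =
      (∏ j ∈ Finset.range n, S.multiplier H (S.σ^[j] ω)) * ∫ x, f x ∂(S.conformalMeasure H ω) := by
  induction n with
  | zero => simp [transferIter]
  | succ n ih =>
    have h := hω (n + 1)
    rw [Function.iterate_succ_apply'] at h ⊢
    show ∫ x, S.transfer H (S.σ^[n] ω) (S.transferIter H n ω f) x ∂_ = _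
    rw [hS.integral_transfer (hω n) h (hS.isBV_transferIter (ω := ω) n (hω 0).einf_pos hf), ih,
      Finset.prod_range_succ]
    ring

/-- Integrating bounds valid off a countable set against the conformal measure. -/
theorem IsRandomOpenMap.integral_mem_Icc (hS : S.IsRandomOpenMap H) (hω : S.IsGoodFibre H ω)
    {f : ℝ → ℝ} (hf : S.IsBV f) {A B : ℝ} (hA : ∀ᶠ x in S.cc, A ≤ f x)
    (hB : ∀ᶠ x in S.cc, f x ≤ B) : ∫ x, f x ∂(S.conformalMeasure H ω) ∈ Icc A B := by
  have h := (hS.hasLim_integral (hS.isLimMeasure_conformalMeasure hω) hω.contracting hf).2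
  have hc : ∀ C : ℝ, S.HasLim H ω (fun _ => C) C := fun C => by
    simpa using hS.hasLim_smul hS.hasLim_one C
  exact ⟨hS.hasLim_mono (hc A) h hA, hS.hasLim_mono h (hc B) hB⟩

theorem IsRandomOpenMap.multiplier_mem_Icc (hS : S.IsRandomOpenMap H)
    (h : ∀ j, 0 < S.einf (S.g (S.σ^[j] ω))) (hσω : S.IsGoodFibre H (S.σ ω)) :
    S.multiplier H ω ∈ Icc (S.einf (S.g ω))
      ((S.branches H 1 ω).ncard * S.supNorm (S.g ω)) := by
  have hone : S.IsBV fun _ => 1 := inCone_one.isBV (a := 1) hS.lo_lt_hi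
  have hb := hS.isBV_transferIter 1 h hone
  have h1 := hS.le_transferIter_one 1 h
  have h2 := hS.transferIter_one_le 1 h
  have h3 := hS.ncard_pieces_le 1 ω
  have h4 := hS.ncard_fullPieces_pos 1 ω
  simp only [Finset.prod_range_one, Function.iterate_zero, id_eq] at h1 h2 h3
  refine hS.integral_mem_Icc hσω hb (h1.mono fun x hx => le_trans ?_ hx)
    (h2.mono fun x hx => hx.trans ?_)
  · exact le_mul_of_one_le_left (h 0).le (by exact_mod_cast h4)
  · have : 0 ≤ S.supNorm (S.g ω) := (h 0).le.trans (hS.einf_le_supNorm ω)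
    gcongr

end RandomMap

namespace RandomMap

variable {Ω : Type*} [MeasurableSpace Ω] {S : RandomMap Ω} {H : Ω → Set ℝ} {ω : Ω}

/-! ### Contraction over blocks -/

/-- The quantity whose integral is assumed to be negative. -/
noncomputable def excess (S : RandomMap Ω) (b ξ : Ω → ℝ) (ω : Ω) : ℝ :=
  Real.log (S.supNorm (S.g ω)) - Real.log (S.einf (S.g ω)) + Real.log (2 + ξ ω) - Real.log (b ω)

/-- The logarithm of the number of branches. -/
noncomputable def logCard (S : RandomMap Ω) (H : Ω → Set ℝ) (ω : Ω) : ℝ :=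
  Real.log ((S.branches H 1 ω).ncard : ℝ)

/-- An upper bound for the logarithmic contraction rate over blocks of length `N`. -/
noncomputable def blockRate (S : RandomMap Ω) (b ξ : Ω → ℝ) (N : ℕ) (ω : Ω) : ℝ :=
  S.excess b ξ ω + S.relVar ω / N + (Real.log N + Real.log (1 + 4 * N) + 3 / N) / N

theorem exp_birkhoffSum (f : Ω → ℝ) (n : ℕ) (ω : Ω) : Real.exp (birkhoffSum S.σ f n ω) =
    ∏ j ∈ Finset.range n, Real.exp (f (S.σ^[j] ω)) := by
  rw [birkhoffSum, Real.exp_sum]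

theorem IsRandomOpenMap.ncard_branches_pos (hS : S.IsRandomOpenMap H) (ω : Ω) :
    0 < (S.branches H 1 ω).ncard :=
  (hS.numFull_one_pos ω).trans_le (ncard_le_ncard (sep_subset _ _) (hS.finite_branches_one ω))

theorem IsRandomOpenMap.logCard_nonneg (hS : S.IsRandomOpenMap H) (ω : Ω) : 0 ≤ S.logCard H ω :=
  Real.log_nonneg (by exact_mod_cast hS.ncard_branches_pos ω)

theorem IsRandomOpenMap.exp_birkhoffSum_logCard (hS : S.IsRandomOpenMap H) (n : ℕ) (ω : Ω) :
    Real.exp (birkhoffSum S.σ (S.logCard H) n ω) =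
      ∏ j ∈ Finset.range n, ((S.branches H 1 (S.σ^[j] ω)).ncard : ℝ) := by
  rw [exp_birkhoffSum]
  exact Finset.prod_congr rfl fun j _ =>
    Real.exp_log (by exact_mod_cast hS.ncard_branches_pos _)

theorem IsRandomOpenMap.exp_birkhoffSum_excess (hS : S.IsRandomOpenMap H) {b ξ : Ω → ℝ}
    (hb : ∀ ω, 0 < b ω) (hξ : ∀ ω, 0 < ξ ω) (n : ℕ) (h : ∀ j, 0 < S.einf (S.g (S.σ^[j] ω))) :
    Real.exp (birkhoffSum S.σ (S.excess b ξ) n ω) *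
      ((∏ j ∈ Finset.range n, S.einf (S.g (S.σ^[j] ω))) * ∏ j ∈ Finset.range n, b (S.σ^[j] ω)) =
      (∏ j ∈ Finset.range n, S.supNorm (S.g (S.σ^[j] ω))) *
        ∏ j ∈ Finset.range n, (2 + ξ (S.σ^[j] ω)) := by
  rw [exp_birkhoffSum, ← Finset.prod_mul_distrib, ← Finset.prod_mul_distrib,
    ← Finset.prod_mul_distrib]
  refine Finset.prod_congr rfl fun j _ => ?_
  have h1 := h j
  have h2 := h1.trans_le (hS.einf_le_supNorm _)
  have h3 := hb (S.σ^[j] ω)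
  have h4 : 0 < 2 + ξ (S.σ^[j] ω) := by linarith [hξ (S.σ^[j] ω)]
  rw [excess, Real.exp_sub, Real.exp_add, Real.exp_sub, Real.exp_log h1, Real.exp_log h2,
    Real.exp_log h3, Real.exp_log h4]
  field_simp

theorem IsRandomOpenMap.prod_le_ncard_fullPieces (hS : S.IsRandomOpenMap H) {b : Ω → ℝ}
    (hb : ∀ ω, 0 < b ω) (hb_le : ∀ ω, b ω ≤ S.numFull H 1 ω) (n : ℕ) (ω : Ω) :
    ∏ j ∈ Finset.range n, b (S.σ^[j] ω) ≤ (S.fullPieces H n ω).ncard := by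
  calc _ ≤ ∏ j ∈ Finset.range n, (S.numFull H 1 (S.σ^[j] ω) : ℝ) :=
        Finset.prod_le_prod (fun j _ => (hb _).le) fun j _ => hb_le _
    _ ≤ _ := by exact_mod_cast hS.prod_numFull_le n ω

theorem one_add_mul_prod_le {ξ : Ω → ℝ} (hξ : ∀ ω, 0 < ξ ω) (n : ℕ) (ω : Ω) :
    1 + 2 * (2 * n * ∏ j ∈ Finset.range n, (2 + ξ (S.σ^[j] ω))) ≤
      (1 + 4 * n) * ∏ j ∈ Finset.range n, (2 + ξ (S.σ^[j] ω)) := by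
  have : 1 ≤ ∏ j ∈ Finset.range n, (2 + ξ (S.σ^[j] ω)) := by
    rw [← Finset.prod_const_one (s := Finset.range n)]
    exact Finset.prod_le_prod (fun _ _ => zero_le_one) fun j _ => by linarith [hξ (S.σ^[j] ω)]
  linarith

/-- The bound of `inCone_transferIter` is rewritten with exponentials of Birkhoff sums, so that the
ergodic theorem for `σ` applies to it. -/
theorem IsRandomOpenMap.inCone_block (hS : S.IsRandomOpenMap H) {b ξ : Ω → ℝ}
    (hb : ∀ ω, 0 < b ω) (hξ : ∀ ω, 0 < ξ ω) (hb_le : ∀ ω, b ω ≤ S.numFull H 1 ω)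
    (hle_ξ : ∀ ω, S.maxContiguous H 1 ω ≤ ξ ω) {N : ℕ} (hN : 0 < N)
    (h : ∀ j, 0 < S.einf (S.g (S.σ^[j] ω))) {a : ℝ} (ha : 0 ≤ a) {f : ℝ → ℝ} (hf : S.InCone a f) :
    S.InCone (Real.exp (birkhoffSum S.σ (S.blockRate b ξ N) N ω) *
      (Real.exp (birkhoffSum S.σ (S.logCard H) N ω) + a)) (S.transferIter H N ω f) := by
  have hk := hS.isContigBound hle_ξ N ω
  have hprod : 0 < ∏ j ∈ Finset.range N, (2 + ξ (S.σ^[j] ω)) :=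
    Finset.prod_pos fun j _ => by linarith [hξ (S.σ^[j] ω)]
  refine (hS.inCone_transferIter N h hk (by positivity) ha hf).mono ?_
  have hone := one_add_mul_prod_le (S := S) hξ N ω
  have hex := hS.exp_birkhoffSum_excess hb hξ N h
  have hB := hS.prod_le_ncard_fullPieces hb hb_le N ω
  have hB' : ((S.fullPieces H N ω).ncard : ℝ) ≤
      Real.exp (birkhoffSum S.σ (S.logCard H) N ω) := by
    rw [hS.exp_birkhoffSum_logCard]
    exact_mod_cast (ncard_le_ncard (fullPieces_subset N ω) (hS.finite_pieces N ω)).trans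
      (hS.ncard_pieces_le N ω)
  have hB0 : (0 : ℝ) < (S.fullPieces H N ω).ncard := by exact_mod_cast hS.ncard_fullPieces_pos N ω
  have hN0 : (0 : ℝ) < N := by exact_mod_cast hN
  have hl0 : 0 < ∏ j ∈ Finset.range N, S.einf (S.g (S.σ^[j] ω)) := Finset.prod_pos fun j _ => h j
  have hs0 : 0 < ∏ j ∈ Finset.range N, S.supNorm (S.g (S.σ^[j] ω)) :=
    Finset.prod_pos fun j _ => (h j).trans_le (hS.einf_le_supNorm _)
  have hsum0 : 0 ≤ ∑ j ∈ Finset.range N, S.relVar (S.σ^[j] ω) :=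
    Finset.sum_nonneg fun j _ => (hS.relVar_pos (h j)).le
  have hrate : birkhoffSum S.σ (S.blockRate b ξ N) N ω = birkhoffSum S.σ (S.excess b ξ) N ω +
      ((∑ j ∈ Finset.range N, S.relVar (S.σ^[j] ω) + 3) / N + Real.log N +
        Real.log (1 + 4 * N)) := by
    simp only [birkhoffSum, blockRate, Finset.sum_add_distrib, Finset.sum_const, Finset.card_range,
      nsmul_eq_mul, ← Finset.sum_div]
    field_simp
    ring
  have hE : Real.exp (birkhoffSum S.σ (S.blockRate b ξ N) N ω) =
      Real.exp (birkhoffSum S.σ (S.excess b ξ) N ω) *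
      (Real.exp ((∑ j ∈ Finset.range N, S.relVar (S.σ^[j] ω) + 3) / N) * N * (1 + 4 * N)) := by
    rw [hrate, Real.exp_add, Real.exp_add, Real.exp_add, Real.exp_log hN0,
      Real.exp_log (by positivity)]
  -- From `y ≤ exp y`: the factor containing the summed variations becomes the exponential of a
  -- Birkhoff sum divided by `N`, at the cost of a factor `N`.
  have hs3 : ∑ j ∈ Finset.range N, S.relVar (S.σ^[j] ω) + 3 ≤
      Real.exp ((∑ j ∈ Finset.range N, S.relVar (S.σ^[j] ω) + 3) / N) * N := by
    rw [← div_le_iff₀ hN0]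
    linarith [Real.add_one_le_exp ((∑ j ∈ Finset.range N, S.relVar (S.σ^[j] ω) + 3) / N)]
  set gl := ∏ j ∈ Finset.range N, S.einf (S.g (S.σ^[j] ω))
  set gs := ∏ j ∈ Finset.range N, S.supNorm (S.g (S.σ^[j] ω))
  set s := ∑ j ∈ Finset.range N, S.relVar (S.σ^[j] ω)
  set X := ∏ j ∈ Finset.range N, (2 + ξ (S.σ^[j] ω))
  set Bp := ∏ j ∈ Finset.range N, b (S.σ^[j] ω)
  set B := ((S.fullPieces H N ω).ncard : ℝ)
  set E := Real.exp (birkhoffSum S.σ (S.blockRate b ξ N) N ω)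
  set Q := Real.exp (birkhoffSum S.σ (S.excess b ξ) N ω)
  set Y := Real.exp ((s + 3) / N)
  have hE0 : 0 < E := Real.exp_pos _
  have hD : gs / gl * (s + 3) * (1 + 2 * (2 * N * X)) ≤ E * B := by
    calc _ ≤ gs / gl * (Y * N) * ((1 + 4 * N) * X) := by gcongr
      _ = (gs * X) / gl * (Y * N * (1 + 4 * N)) := by ring
      _ = E * Bp := by rw [← hex, hE]; field_simp
      _ ≤ E * B := by gcongr
  calc _ ≤ E * B * (1 + a / B) := by gcongr
    _ = E * (B + a) := by field_simp
    _ ≤ _ := by gcongr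

/-- The solution of the affine recursion `a ↦ exp A * (B + a)` of `inCone_block` over `d` blocks. -/
theorem IsRandomOpenMap.inCone_blocks (hS : S.IsRandomOpenMap H) {b ξ : Ω → ℝ}
    (hb : ∀ ω, 0 < b ω) (hξ : ∀ ω, 0 < ξ ω) (hb_le : ∀ ω, b ω ≤ S.numFull H 1 ω)
    (hle_ξ : ∀ ω, S.maxContiguous H 1 ω ≤ ξ ω) {N : ℕ} (hN : 0 < N)
    (h : ∀ j, 0 < S.einf (S.g (S.σ^[j] ω))) {a : ℝ} (ha : 0 ≤ a) {f : ℝ → ℝ} (hf : S.InCone a f)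
    (d : ℕ) :
    S.InCone (Real.exp (birkhoffSum S.σ (S.blockRate b ξ N) (d * N) ω) * a +
      ∑ k ∈ Finset.range d, Real.exp (birkhoffSum S.σ (S.logCard H) N (S.σ^[k * N] ω) +
        birkhoffSum S.σ (S.blockRate b ξ N) (d * N) ω -
        birkhoffSum S.σ (S.blockRate b ξ N) (k * N) ω)) (S.transferIter H (d * N) ω f) := by
  induction d with
  | zero => simpa [transferIter] using hf
  | succ d ih =>
    have h' : ∀ j, 0 < S.einf (S.g (S.σ^[j] (S.σ^[d * N] ω))) := fun j => by
      rw [← Function.iterate_add_apply]; exact h _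
    have := hS.inCone_block hb hξ hb_le hle_ξ hN h' (by positivity) ih
    rw [Nat.succ_mul, transferIter_add]
    refine this.mono (le_of_eq ?_)
    rw [birkhoffSum_add, Finset.sum_range_succ, mul_add, mul_add, Finset.mul_sum, Real.exp_add]
    set A := birkhoffSum S.σ (S.blockRate b ξ N) N (S.σ^[d * N] ω)
    set P := birkhoffSum S.σ (S.blockRate b ξ N) (d * N) ω
    have e : ∀ k, Real.exp (birkhoffSum S.σ (S.logCard H) N (S.σ^[k * N] ω) + (P + A) -
        birkhoffSum S.σ (S.blockRate b ξ N) (k * N) ω) = Real.exp A *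
        Real.exp (birkhoffSum S.σ (S.logCard H) N (S.σ^[k * N] ω) + P -
        birkhoffSum S.σ (S.blockRate b ξ N) (k * N) ω) := fun k => by
      rw [← Real.exp_add]; congr 1; ring
    simp only [e]
    have e2 : Real.exp (birkhoffSum S.σ (S.logCard H) N (S.σ^[d * N] ω) + (P + A) - P) =
      Real.exp A * Real.exp (birkhoffSum S.σ (S.logCard H) N (S.σ^[d * N] ω)) := by
      rw [← Real.exp_add]; congr 1; ring
    rw [e2]
    ring

/-- The block rate with corrections for steps with many branches and for exponential decay. -/
noncomputable def recordRate (S : RandomMap Ω) (H : Ω → Set ℝ) (b ξ : Ω → ℝ) (N : ℕ) (M γ : ℝ)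
    (ω : Ω) : ℝ :=
  S.blockRate b ξ N ω + max (S.logCard H ω - M) 0 + γ

/-- At a record the sum of `recordRate` from block `k` to block `d` is nonpositive. Its correction
terms absorb the branch count of the first block beyond `N * M` and leave a decay of `γ` per step.
-/
theorem birkhoffSum_sub_le_recordRate {b ξ : Ω → ℝ} {N : ℕ} {M γ : ℝ} {k d : ℕ} (hkd : k < d)
    (hrec : birkhoffSum S.σ (S.recordRate H b ξ N M γ) (d * N) ω ≤
      birkhoffSum S.σ (S.recordRate H b ξ N M γ) (k * N) ω) :
    birkhoffSum S.σ (S.logCard H) N (S.σ^[k * N] ω) +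
      birkhoffSum S.σ (S.blockRate b ξ N) (d * N) ω -
      birkhoffSum S.σ (S.blockRate b ξ N) (k * N) ω ≤ N * M - γ * N * (d - k : ℕ) := by
  obtain ⟨e, rfl⟩ := Nat.exists_eq_add_of_lt hkd
  rw [show (k + e + 1) * N = k * N + (N + e * N) by ring, birkhoffSum_add] at hrec ⊢
  set ω' := S.σ^[k * N] ω
  have h1 : birkhoffSum S.σ (S.recordRate H b ξ N M γ) (N + e * N) ω' =
      birkhoffSum S.σ (S.blockRate b ξ N) (N + e * N) ω' +
      birkhoffSum S.σ (fun ω => max (S.logCard H ω - M) 0) (N + e * N) ω' +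
      (N + e * N : ℕ) * γ := by
    simp [birkhoffSum, recordRate, Finset.sum_add_distrib]
  have h2 : birkhoffSum S.σ (S.logCard H) N ω' ≤
      birkhoffSum S.σ (fun ω => max (S.logCard H ω - M) 0) N ω' + N * M := by
    rw [birkhoffSum, birkhoffSum, ← nsmul_eq_mul, ← Finset.card_range N, ← Finset.sum_const,
      Finset.card_range, ← Finset.sum_add_distrib]
    exact Finset.sum_le_sum fun j _ => by linarith [le_max_left (S.logCard H (S.σ^[j] ω') - M) 0]
  have h3 : birkhoffSum S.σ (fun ω => max (S.logCard H ω - M) 0) N ω' ≤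
      birkhoffSum S.σ (fun ω => max (S.logCard H ω - M) 0) (N + e * N) ω' :=
    Finset.sum_le_sum_of_subset_of_nonneg (Finset.range_mono (Nat.le_add_right _ _))
      fun j _ _ => le_max_right _ _
  have h4 : γ * N * ((k + e + 1 - k : ℕ) : ℝ) = (N + e * N : ℕ) * γ := by
    rw [show k + e + 1 - k = e + 1 by omega]; push_cast; ring
  rw [h4]
  linarith

theorem sum_exp_sub_le {c γ : ℝ} (hγ : 0 < γ) (d : ℕ) :
    ∑ k ∈ Finset.range d, Real.exp (c - γ * (d - k : ℕ)) ≤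
      Real.exp c / (1 - Real.exp (-γ)) := by
  have hρ : Real.exp (-γ) < 1 := by rw [Real.exp_lt_one_iff]; linarith
  have hρ0 := Real.exp_pos (-γ)
  have e : ∀ j : ℕ, Real.exp (c - γ * (j : ℝ)) = Real.exp c * Real.exp (-γ) ^ j := fun j => by
    rw [← Real.exp_nat_mul, ← Real.exp_add]; congr 1; ring
  have h1 : ∑ k ∈ Finset.range d, Real.exp (c - γ * ((d - k : ℕ) : ℝ)) ≤
      ∑ k ∈ Finset.range d, Real.exp c * Real.exp (-γ) ^ (d - 1 - k) := by
    refine Finset.sum_le_sum fun k hk => ?_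
    rw [e]
    exact mul_le_mul_of_nonneg_left (pow_le_pow_of_le_one hρ0.le hρ.le (by omega))
      (Real.exp_pos c).le
  refine h1.trans ?_
  rw [Finset.sum_range_reflect (fun j => Real.exp c * Real.exp (-γ) ^ j), ← Finset.mul_sum,
    div_eq_mul_inv]
  exact mul_le_mul_of_nonneg_left
    (sum_le_hasSum _ (fun _ _ => pow_nonneg hρ0.le _) (hasSum_geometric_of_lt_one hρ0.le hρ))
    (Real.exp_pos c).le

/-- Contraction from time `s * N` to a record time `t * N`. -/
theorem IsRandomOpenMap.inCone_record (hS : S.IsRandomOpenMap H) {b ξ : Ω → ℝ}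
    (hb : ∀ ω, 0 < b ω) (hξ : ∀ ω, 0 < ξ ω) (hb_le : ∀ ω, b ω ≤ S.numFull H 1 ω)
    (hle_ξ : ∀ ω, S.maxContiguous H 1 ω ≤ ξ ω) {N : ℕ} (hN : 0 < N)
    (h : ∀ j, 0 < S.einf (S.g (S.σ^[j] ω))) {a : ℝ} (ha : 0 ≤ a) {f : ℝ → ℝ} (hf : S.InCone a f)
    {M γ : ℝ} (hM : 0 ≤ M) (hγ : 0 < γ) {d : ℕ}
    (hrec : ∀ k ≤ d, birkhoffSum S.σ (S.recordRate H b ξ N M γ) (d * N) ω ≤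
      birkhoffSum S.σ (S.recordRate H b ξ N M γ) (k * N) ω) :
    S.InCone (Real.exp (N * M - γ * N * d) * a + Real.exp (N * M) / (1 - Real.exp (-(γ * N))))
      (S.transferIter H (d * N) ω f) := by
  refine (hS.inCone_blocks hb hξ hb_le hle_ξ hN h ha hf d).mono (add_le_add ?_ ?_)
  · refine mul_le_mul_of_nonneg_right (Real.exp_le_exp.2 ?_) ha
    rcases d.eq_zero_or_pos with rfl | hd
    · simp only [zero_mul, birkhoffSum_zero, Nat.cast_zero, mul_zero, sub_zero]
      positivity
    · have h1 := birkhoffSum_sub_le_recordRate hd (hrec 0 hd.le)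
      have h2 : 0 ≤ birkhoffSum S.σ (S.logCard H) N ω :=
        Finset.sum_nonneg fun j _ => hS.logCard_nonneg _
      simp only [zero_mul, Function.iterate_zero, id_eq, birkhoffSum_zero, Nat.sub_zero] at h1
      linarith
  · have hN0 : (0 : ℝ) < N := by exact_mod_cast hN
    refine le_trans (Finset.sum_le_sum fun k hk => Real.exp_le_exp.2 ?_)
      (sum_exp_sub_le (mul_pos hγ hN0) d)
    have hk := Finset.mem_range.1 hk
    exact birkhoffSum_sub_le_recordRate hk (hrec k hk.le)

end RandomMap

/-! ### Running minima and elementary limits. -/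

/-- The positions of the running minima of a sequence with negative drift. -/
theorem exists_running_minima {G : ℕ → ℝ} {β : ℝ} (hβ : 0 < β)
    (hG : Tendsto (fun k : ℕ => G k / k) atTop (𝓝 (-β))) :
    ∃ t : ℕ → ℕ, (∀ K, t K ≤ K) ∧ (∀ K, ∀ i ≤ K, G (t K) ≤ G i) ∧
      Tendsto t atTop atTop ∧ Tendsto (fun K => (t K : ℝ) / K) atTop (𝓝 1) := by
  have hmin : ∀ K : ℕ, ∃ t ≤ K, ∀ i ≤ K, G t ≤ G i := fun K => by
    obtain ⟨t, ht, h⟩ := Finset.exists_min_image (Finset.range (K + 1)) G ⟨0, by simp⟩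
    exact ⟨t, by simpa [Nat.lt_succ_iff] using ht, fun i hi => h i (by simp; omega)⟩
  choose t ht hmin using hmin
  have hbot : Tendsto G atTop atBot := by
    have h1 : Tendsto (fun k : ℕ => G k / k * k) atTop atBot :=
      hG.neg_mul_atTop (by linarith) tendsto_natCast_atTop_atTop
    refine h1.congr' ?_
    filter_upwards [eventually_gt_atTop 0] with k hk
    have : (k : ℝ) ≠ 0 := by positivity
    field_simp
  have htop : Tendsto t atTop atTop := by
    refine tendsto_atTop.2 fun C => ?_
    obtain ⟨i, hi, hmini⟩ := Finset.exists_min_image (Finset.range (C + 1)) G ⟨0, by simp⟩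
    filter_upwards [hbot.eventually_lt_atBot (G i)] with K hK
    by_contra hcon
    push Not at hcon
    have h1 := hmini (t K) (by simp; omega)
    linarith [hmin K K le_rfl]
  refine ⟨t, ht, hmin, htop, ?_⟩
  -- Both quotients tend to `-β`. Since `G (t K) ≤ G K` and `G (t K)` is negative, this ratio is a
  -- lower bound for `t K / K`.
  have h1 : Tendsto (fun K => G K / K / (G (t K) / t K)) atTop (𝓝 1) := by
    have := hG.div (hG.comp htop) (by linarith)
    rwa [div_self (by linarith)] at this
  refine tendsto_of_tendsto_of_tendsto_of_le_of_le' h1 tendsto_const_nhds ?_ ?_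
  · filter_upwards [eventually_gt_atTop 0, htop.eventually_gt_atTop 0,
      (hG.comp htop).eventually_lt_const (show -β < 0 by linarith)] with K h2 h3 h4
    have h2' : (0 : ℝ) < K := by exact_mod_cast h2
    have h3' : (0 : ℝ) < t K := by exact_mod_cast h3
    replace h4 : G (t K) / t K < 0 := h4
    rw [div_le_iff_of_neg h4]
    rw [div_mul_div_comm, mul_comm (t K : ℝ) (G (t K)), mul_div_mul_right _ _ h3'.ne']
    have := hmin K K le_rfl
    gcongr
  · filter_upwards [eventually_gt_atTop 0] with K h2
    have h2' : (0 : ℝ) < K := by exact_mod_cast h2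
    rw [div_le_one h2']
    exact_mod_cast ht K

theorem tendsto_log_natCast_div : Tendsto (fun N : ℕ => Real.log N / N) atTop (𝓝 0) := by
  have := (Real.tendsto_pow_log_div_mul_add_atTop 1 0 1 one_ne_zero).comp
    (tendsto_natCast_atTop_atTop (R := ℝ))
  exact this.congr fun N => by simp

theorem tendsto_log_one_add_mul_div :
    Tendsto (fun N : ℕ => Real.log (1 + 4 * N) / N) atTop (𝓝 0) := by
  have := (Real.tendsto_pow_log_div_mul_add_atTop (1 / 4) (-1 / 4) 1 (by norm_num)).comp
    (tendsto_atTop_add_const_left atTop (1 : ℝ) ((tendsto_natCast_atTop_atTop (R := ℝ)).const_mul_atTop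
      (show (0 : ℝ) < 4 by norm_num)))
  refine this.congr fun N => ?_
  simp only [Function.comp, pow_one]
  congr 1
  ring

theorem tendsto_integral_max_sub_zero {Ω : Type*} [MeasurableSpace Ω] {m : Measure Ω} {f : Ω → ℝ}
    (hf : Integrable f m) (h0 : ∀ ω, 0 ≤ f ω) :
    Tendsto (fun M : ℕ => ∫ ω, max (f ω - M) 0 ∂m) atTop (𝓝 0) := by
  have h := tendsto_integral_of_dominated_convergence (μ := m)
    (F := fun (M : ℕ) ω => max (f ω - M) 0) (f := fun _ => 0) f (fun M => ?_) hf (fun M => ?_) ?_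
  · simpa using h
  · exact ((hf.aestronglyMeasurable.sub aestronglyMeasurable_const).sup aestronglyMeasurable_const)
  · refine Eventually.of_forall fun ω => ?_
    rw [Real.norm_of_nonneg (le_max_right _ _)]
    exact max_le (by linarith [show (0 : ℝ) ≤ M from Nat.cast_nonneg M]) (h0 ω)
  · refine Eventually.of_forall fun ω => ?_
    obtain ⟨M₀, hM₀⟩ := exists_nat_ge (f ω)
    refine tendsto_const_nhds.congr' ?_
    filter_upwards [eventually_ge_atTop M₀] with M hM
    rw [max_eq_right]
    have : (M₀ : ℝ) ≤ M := by exact_mod_cast hM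
    linarith

/-! ### Admissible systems: contraction and growth along almost every orbit. -/

namespace RandomMap

variable {Ω : Type*} [MeasurableSpace Ω] {S : RandomMap Ω} {H : Ω → Set ℝ} {m : Measure Ω}
  {b ξ : Ω → ℝ}

/-- A random open map over an ergodic base with integrable data and negative mean excess. -/
structure IsAdmissible (S : RandomMap Ω) (m : Measure Ω) (H : Ω → Set ℝ) (b ξ : Ω → ℝ) :
    Prop where
  map : S.IsRandomOpenMap H
  erg : Ergodic S.σ m
  b_pos : ∀ ω, 0 < b ω
  ξ_pos : ∀ ω, 0 < ξ ω
  b_le : ∀ ω, b ω ≤ S.numFull H 1 ω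
  le_ξ : ∀ ω, S.maxContiguous H 1 ω ≤ ξ ω
  einf_pos : ∀ᵐ ω ∂m, 0 < S.einf (S.g ω)
  int_card : Integrable (S.logCard H) m
  int_sup : Integrable (fun ω => Real.log (S.supNorm (S.g ω))) m
  int_inf : Integrable (fun ω => Real.log (S.einf (S.g ω))) m
  int_var : Integrable S.relVar m
  neg : ∫ ω, S.excess b ξ ω ∂m < 0

theorem ae_all_iterate {σ : Ω → Ω} (hσ : Ergodic σ m) {p : Ω → Prop} (hp : ∀ᵐ ω ∂m, p ω) :
    ∀ᵐ ω ∂m, ∀ j, p (σ^[j] ω) :=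
  ae_all_iff.2 fun j => (hσ.toMeasurePreserving.iterate j).quasiMeasurePreserving.ae hp

theorem integrable_of_integral_neg {f : Ω → ℝ} (h : ∫ ω, f ω ∂m < 0) : Integrable f m := by
  by_contra hcon
  rw [integral_undef hcon] at h
  exact lt_irrefl _ h

variable [IsProbabilityMeasure m]

theorem IsAdmissible.ae_tendsto (hA : S.IsAdmissible m H b ξ) {f : Ω → ℝ} (hf : Integrable f m) :
    ∀ᵐ ω ∂m, Tendsto (fun n : ℕ => birkhoffSum S.σ f n ω / n) atTop (𝓝 (∫ ω, f ω ∂m)) :=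
  ae_tendsto_birkhoffSum_div hA.erg hf

theorem IsAdmissible.integrable_blockRate (hA : S.IsAdmissible m H b ξ) (N : ℕ) :
    Integrable (S.blockRate b ξ N) m :=
  ((integrable_of_integral_neg hA.neg).add (hA.int_var.div_const _)).add (integrable_const _)

/-- The corrections to the mean excess have means tending to `0` as `N` grows. -/
theorem IsAdmissible.exists_blockRate_neg (hA : S.IsAdmissible m H b ξ) :
    ∃ N : ℕ, 0 < N ∧ ∫ ω, S.blockRate b ξ N ω ∂m < 0 := by
  have h1 : ∀ N : ℕ, ∫ ω, S.blockRate b ξ N ω ∂m = (∫ ω, S.excess b ξ ω ∂m) +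
      (∫ ω, S.relVar ω ∂m) / N + (Real.log N / N + Real.log (1 + 4 * N) / N + 3 / N / N) := by
    intro N
    have e1 := integrable_of_integral_neg hA.neg
    have e2 := hA.int_var.div_const (N : ℝ)
    simp only [blockRate]
    rw [integral_add (f := fun ω => S.excess b ξ ω + S.relVar ω / N) (e1.add e2)
      (integrable_const _), integral_add e1 e2, integral_div]
    simp [add_div]
  have hN := tendsto_natCast_atTop_atTop (R := ℝ)
  have t3 : Tendsto (fun N : ℕ => (3 : ℝ) / N / N) atTop (𝓝 0) := by
    simpa [div_eq_mul_inv] using (tendsto_const_div_atTop_nhds_zero_nat (3 : ℝ)).mul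
      (tendsto_inv_atTop_zero.comp hN)
  have t : Tendsto (fun N : ℕ => ∫ ω, S.blockRate b ξ N ω ∂m) atTop
      (𝓝 ((∫ ω, S.excess b ξ ω ∂m) + 0 + (0 + 0 + 0))) := by
    simp only [h1]
    exact (tendsto_const_nhds.add (tendsto_const_div_atTop_nhds_zero_nat _)).add
      ((tendsto_log_natCast_div.add tendsto_log_one_add_mul_div).add t3)
  rw [add_zero, add_zero, add_zero, add_zero] at t
  obtain ⟨N, hN1, hN2⟩ := ((t.eventually_lt_const hA.neg).and (eventually_gt_atTop 0)).exists
  exact ⟨N, hN2, hN1⟩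

/-- If the mean of `blockRate` is `-e`, the truncation level `M` makes the branch correction cost
less than `e / 3` on average, and `γ = e / 3`. -/
theorem IsAdmissible.exists_recordRate_neg (hA : S.IsAdmissible m H b ξ) :
    ∃ N : ℕ, 0 < N ∧ ∃ M γ : ℝ, 0 ≤ M ∧ 0 < γ ∧ Integrable (S.recordRate H b ξ N M γ) m ∧
      ∫ ω, S.recordRate H b ξ N M γ ω ∂m < 0 := by
  obtain ⟨N, hN, hneg⟩ := hA.exists_blockRate_neg
  set e := -∫ ω, S.blockRate b ξ N ω ∂m with he
  have he0 : 0 < e := by linarith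
  obtain ⟨M, hM⟩ := ((tendsto_integral_max_sub_zero hA.int_card
    hA.map.logCard_nonneg).eventually_lt_const (show 0 < e / 3 by positivity)).exists
  have hmax : Integrable (fun ω => max (S.logCard H ω - M) 0) m :=
    (hA.int_card.sub (integrable_const _)).sup (integrable_const 0)
  refine ⟨N, hN, M, e / 3, Nat.cast_nonneg M, by positivity,
    ((hA.integrable_blockRate N).add hmax).add (integrable_const _), ?_⟩
  simp only [recordRate]
  rw [integral_add (f := fun ω => S.blockRate b ξ N ω + max (S.logCard H ω - M) 0)
    ((hA.integrable_blockRate N).add hmax) (integrable_const _),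
    integral_add (hA.integrable_blockRate N) hmax]
  simp only [integral_const, probReal_univ, smul_eq_mul, one_mul]
  linarith

/-- Along almost every orbit there are records of the blockwise rate with density one. -/
theorem IsAdmissible.ae_exists_records (hA : S.IsAdmissible m H b ξ) :
    ∃ N : ℕ, 0 < N ∧ ∃ M γ : ℝ, 0 ≤ M ∧ 0 < γ ∧ ∀ᵐ ω ∂m, ∃ t : ℕ → ℕ, (∀ K, t K ≤ K) ∧
      (∀ K, ∀ i ≤ K, birkhoffSum S.σ (S.recordRate H b ξ N M γ) (t K * N) ω ≤
        birkhoffSum S.σ (S.recordRate H b ξ N M γ) (i * N) ω) ∧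
      Tendsto t atTop atTop ∧ Tendsto (fun K => (t K : ℝ) / K) atTop (𝓝 1) := by
  obtain ⟨N, hN, M, γ, hM, hγ, hint, hneg⟩ := hA.exists_recordRate_neg
  have hN0 : (0 : ℝ) < N := by exact_mod_cast hN
  refine ⟨N, hN, M, γ, hM, hγ, ?_⟩
  filter_upwards [hA.ae_tendsto hint] with ω hω
  -- Birkhoff sums of `σ` are sampled at multiples of `N`, so ergodicity of the power `σ^N` is not
  -- required.
  have h1 : Tendsto (fun k : ℕ => k * N) atTop atTop := tendsto_id.atTop_mul_const' hN
  have h2 := (hω.comp h1).mul_const (N : ℝ)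
  refine exists_running_minima (G := fun k => birkhoffSum S.σ (S.recordRate H b ξ N M γ) (k * N) ω)
    (β := -((∫ ω, S.recordRate H b ξ N M γ ω ∂m) * N)) (by nlinarith) ?_
  rw [neg_neg]
  refine h2.congr fun k => ?_
  simp only [Function.comp, Nat.cast_mul]
  rcases k.eq_zero_or_pos with rfl | hk
  · simp
  · have : (0 : ℝ) < k := by exact_mod_cast hk
    field_simp

theorem IsAdmissible.ae_isGoodFibre (hA : S.IsAdmissible m H b ξ) :
    ∀ᵐ ω ∂m, ∀ j, S.IsGoodFibre H (S.σ^[j] ω) := by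
  obtain ⟨N, hN, M, γ, hM, hγ, hrec⟩ := hA.ae_exists_records
  have hN0 : (0 : ℝ) < N := by exact_mod_cast hN
  refine ae_all_iterate hA.erg ?_
  filter_upwards [hrec, ae_all_iterate hA.erg hA.einf_pos,
    hA.ae_tendsto (integrable_of_integral_neg hA.neg)] with ω ⟨t, htle, ht, htop, _⟩ hpos hex
  refine ⟨hpos, ?_, fun δ hδ => ?_⟩
  · set M' := Real.exp (N * M) / (1 - Real.exp (-(γ * N))) with hM'
    have hM'0 : 0 < M' := by
      refine div_pos (Real.exp_pos _) (sub_pos.2 ?_)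
      rw [Real.exp_lt_one_iff]
      nlinarith
    -- With `a = 4 * M'` and a damping factor of at most `1 / 4`, the new parameter is at most `M' +
    -- M' = a / 2`. A record exceeds the minimum over all earlier blocks, so it is also a record
    -- when counting starts at `k`.
    refine ⟨4 * M', by positivity, {s | ∃ k, s = k * N ∧ ∀ i ≤ k,
      birkhoffSum S.σ (S.recordRate H b ξ N M γ) (k * N) ω ≤
        birkhoffSum S.σ (S.recordRate H b ξ N M γ) (i * N) ω}, ⟨0, by simp, by simp⟩, ?_⟩
    rintro _ ⟨k, rfl, hk⟩
    obtain ⟨d₀, hd₀⟩ := exists_nat_ge ((N * M + Real.log 4) / (γ * N))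
    obtain ⟨K, hK⟩ := (htop.eventually_ge_atTop (k + d₀ + 1)).exists
    obtain ⟨d, hd⟩ : ∃ d, t K = k + d := ⟨t K - k, by omega⟩
    have hKrec := ht K
    rw [hd] at hKrec
    have hdK : k + d ≤ K := hd ▸ htle K
    refine ⟨(k + d) * N, ⟨k + d, rfl, fun i hi => hKrec i (hi.trans hdK)⟩, ?_, fun f hf => ?_⟩
    · exact Nat.mul_lt_mul_of_pos_right (by omega) hN
    · rw [show (k + d) * N - k * N = d * N by rw [Nat.add_mul, Nat.add_sub_cancel_left]]
      refine (hA.map.inCone_record hA.b_pos hA.ξ_pos hA.b_le hA.le_ξ hN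
        (fun j => by rw [← Function.iterate_add_apply]; exact hpos _) (by positivity) hf hM hγ
        (d := d) fun i hi => ?_).mono ?_
      · have h1 := hKrec (k + i) (by omega)
        rw [Nat.add_mul, Nat.add_mul, birkhoffSum_add, birkhoffSum_add] at h1
        linarith
      · have h2 : Real.exp (N * M - γ * N * d) ≤ 1 / 4 := by
          rw [← Real.exp_log (show (0 : ℝ) < 1 / 4 by norm_num), Real.exp_le_exp, one_div,
            Real.log_inv]
          rw [div_le_iff₀ (by positivity)] at hd₀
          have : (d₀ : ℝ) ≤ d := by exact_mod_cast (by omega : d₀ ≤ d)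
          nlinarith [mul_pos hγ hN0]
        rw [← hM']
        nlinarith
  -- The Birkhoff sums of the excess tend to `-∞`, and their exponentials dominate the mass ratio of
  -- a piece, as `2 + ξ ≥ 1` and there are at least `∏ b` full pieces.
  · have hbot : Tendsto (fun n : ℕ => birkhoffSum S.σ (S.excess b ξ) n ω) atTop atBot := by
      have h1 := hex.neg_mul_atTop hA.neg (tendsto_natCast_atTop_atTop (R := ℝ))
      refine h1.congr' ?_
      filter_upwards [eventually_gt_atTop 0] with k hk
      have : (k : ℝ) ≠ 0 := by positivity
      field_simp
    obtain ⟨n, hn⟩ := (hbot.eventually_le_atBot (Real.log δ)).exists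
    have hn' : Real.exp (birkhoffSum S.σ (S.excess b ξ) n ω) ≤ δ := by
      rwa [← Real.exp_log hδ, Real.exp_le_exp]
    refine ⟨n, ?_⟩
    have e1 := hA.map.exp_birkhoffSum_excess hA.b_pos hA.ξ_pos n hpos
    have e2 := hA.map.prod_le_ncard_fullPieces hA.b_pos hA.b_le n ω
    have hl0 : 0 < ∏ j ∈ Finset.range n, S.einf (S.g (S.σ^[j] ω)) :=
      Finset.prod_pos fun j _ => hpos j
    have hs0 : 0 ≤ ∏ j ∈ Finset.range n, S.supNorm (S.g (S.σ^[j] ω)) :=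
      Finset.prod_nonneg fun j _ => ((hpos j).trans_le (hA.map.einf_le_supNorm _)).le
    have e3 : 1 ≤ ∏ j ∈ Finset.range n, (2 + ξ (S.σ^[j] ω)) := by
      rw [← Finset.prod_const_one (s := Finset.range n)]
      exact Finset.prod_le_prod (fun _ _ => zero_le_one) fun j _ => by
        linarith [hA.ξ_pos (S.σ^[j] ω)]
    have hb0 : 0 < ∏ j ∈ Finset.range n, b (S.σ^[j] ω) := Finset.prod_pos fun j _ => hA.b_pos _
    calc _ ≤ (∏ j ∈ Finset.range n, S.supNorm (S.g (S.σ^[j] ω))) *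
          ∏ j ∈ Finset.range n, (2 + ξ (S.σ^[j] ω)) := le_mul_of_one_le_right hs0 e3
      _ = _ := e1.symm
      _ ≤ δ * ((∏ j ∈ Finset.range n, S.einf (S.g (S.σ^[j] ω))) *
          ∏ j ∈ Finset.range n, b (S.σ^[j] ω)) := by gcongr
      _ ≤ δ * ((∏ j ∈ Finset.range n, S.einf (S.g (S.σ^[j] ω))) * (S.fullPieces H n ω).ncard) := by
          gcongr
      _ = _ := by ring

/-- The iterates of the constant function have subexponential oscillation. -/
theorem IsAdmissible.ae_growth (hA : S.IsAdmissible m H b ξ) :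
    ∀ᵐ ω ∂m, ∃ lw up : ℕ → ℝ, (∀ n, 0 < lw n) ∧ (∀ n, ∀ᶠ x in S.cc,
      lw n ≤ S.transferIter H n ω (fun _ => 1) x ∧ S.transferIter H n ω (fun _ => 1) x ≤ up n) ∧
      Tendsto (fun n : ℕ => (Real.log (up n) - Real.log (lw n)) / n) atTop (𝓝 0) := by
  obtain ⟨N, hN, M, γ, hM, hγ, hrec⟩ := hA.ae_exists_records
  have hN0 : (0 : ℝ) < N := by exact_mod_cast hN
  have hint := (hA.int_card.add hA.int_sup).sub hA.int_inf
  set W : Ω → ℝ := fun ω => S.logCard H ω + Real.log (S.supNorm (S.g ω)) -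
    Real.log (S.einf (S.g ω)) with hW
  filter_upwards [hrec, ae_all_iterate hA.erg hA.einf_pos, hA.ae_tendsto (f := W) hint] with
    ω ⟨t, htle, ht, htop, ht1⟩ hpos hWlim
  have hS := hA.map
  have hdiv : Tendsto (fun n : ℕ => n / N) atTop atTop := Nat.tendsto_div_const_atTop hN.ne'
  -- The position, in steps, of the running minimum over the complete blocks up to time `n`.
  set τ : ℕ → ℕ := fun n => t (n / N) * N with hτ
  have hτle : ∀ n, τ n ≤ n := fun n =>
    (Nat.mul_le_mul_right N (htle _)).trans (Nat.div_mul_le_self n N)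
  have hτtop : Tendsto τ atTop atTop := (htop.comp hdiv).atTop_mul_const' hN
  have hτ1 : Tendsto (fun n => (τ n : ℝ) / n) atTop (𝓝 1) := by
    have h1 : Tendsto (fun K : ℕ => (t K : ℝ) / (K + 1)) atTop (𝓝 1) := by
      have := ht1.mul (tendsto_natCast_div_add_atTop (1 : ℝ))
      rw [one_mul] at this
      refine this.congr' ?_
      filter_upwards [eventually_gt_atTop 0] with K hK
      have : (0 : ℝ) < K := by exact_mod_cast hK
      field_simp
    refine tendsto_of_tendsto_of_tendsto_of_le_of_le' (h1.comp hdiv) tendsto_const_nhds ?_ ?_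
    · filter_upwards [eventually_gt_atTop 0] with n hn
      have hn' : (0 : ℝ) < n := by exact_mod_cast hn
      simp only [Function.comp, hτ, Nat.cast_mul]
      rw [div_le_div_iff₀ (by positivity) hn', mul_assoc]
      have : (n : ℝ) ≤ N * ((n / N : ℕ) + 1) := by exact_mod_cast (Nat.lt_mul_div_succ n hN).le
      gcongr
    · filter_upwards [eventually_gt_atTop 0] with n hn
      have hn' : (0 : ℝ) < n := by exact_mod_cast hn
      rw [div_le_one hn']
      exact_mod_cast hτle n
  set a := Real.exp (N * M) * 1 + Real.exp (N * M) / (1 - Real.exp (-(γ * N))) with ha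
  have ha0 : 0 ≤ a := by
    have : 0 < 1 - Real.exp (-(γ * N)) := by
      rw [sub_pos, Real.exp_lt_one_iff]
      nlinarith
    positivity
  have hcone : ∀ n, S.InCone a (S.transferIter H (τ n) ω fun _ => 1) := fun n =>
    (hS.inCone_record hA.b_pos hA.ξ_pos hA.b_le hA.le_ξ hN hpos zero_le_one inCone_one hM hγ
      fun k hk => ht _ _ (hk.trans (htle _))).mono (by
        rw [ha]
        gcongr
        have : 0 ≤ γ * N * (t (n / N) : ℝ) := by positivity
        linarith)
  choose v hv1 hv2 hv3 using hcone
  obtain ⟨x₀, hx₀⟩ := nonempty_Ioo.2 hS.lo_lt_hi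
  have hpos' : ∀ n j, 0 < S.einf (S.g (S.σ^[j] (S.σ^[τ n] ω))) := fun n j => by
    rw [← Function.iterate_add_apply]; exact hpos _
  -- At time `τ n` the iterate of `1` lies in a fixed cone, so it varies by at most the factor `1 +
  -- a`; the remaining `n - τ n` steps are bounded crudely.
  set lw : ℕ → ℝ := fun n => v n x₀ / (1 + a) *
    Real.exp (birkhoffSum S.σ (fun ω => Real.log (S.einf (S.g ω))) (n - τ n) (S.σ^[τ n] ω)) with hlw
  set up : ℕ → ℝ := fun n => (1 + a) * v n x₀ *
    Real.exp (birkhoffSum S.σ (fun ω => S.logCard H ω + Real.log (S.supNorm (S.g ω)))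
      (n - τ n) (S.σ^[τ n] ω)) with hup
  have hvx : ∀ n, 0 < v n x₀ := fun n => hv2 n x₀ hx₀
  refine ⟨lw, up, fun n => by have := hvx n; positivity, fun n => ?_, ?_⟩
  · have hadd : S.transferIter H n ω (fun _ => 1) = S.transferIter H (n - τ n) (S.σ^[τ n] ω)
        (S.transferIter H (τ n) ω fun _ => 1) := by
      rw [← transferIter_add, Nat.add_sub_cancel' (hτle n)]
    have e1 := hS.le_transferIter_one (n - τ n) (hpos' n)
    have e2 := hS.transferIter_one_le (n - τ n) (hpos' n)
    have el : Real.exp (birkhoffSum S.σ (fun ω => Real.log (S.einf (S.g ω))) (n - τ n)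
        (S.σ^[τ n] ω)) = ∏ j ∈ Finset.range (n - τ n), S.einf (S.g (S.σ^[j] (S.σ^[τ n] ω))) := by
      rw [exp_birkhoffSum]
      exact Finset.prod_congr rfl fun j _ => Real.exp_log (hpos' n j)
    have eu : Real.exp (birkhoffSum S.σ (fun ω => S.logCard H ω + Real.log (S.supNorm (S.g ω)))
        (n - τ n) (S.σ^[τ n] ω)) =
        (∏ j ∈ Finset.range (n - τ n), ((S.branches H 1 (S.σ^[j] (S.σ^[τ n] ω))).ncard : ℝ)) *
          ∏ j ∈ Finset.range (n - τ n), S.supNorm (S.g (S.σ^[j] (S.σ^[τ n] ω))) := by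
      rw [exp_birkhoffSum, ← Finset.prod_mul_distrib]
      refine Finset.prod_congr rfl fun j _ => ?_
      rw [Real.exp_add, Real.exp_log ((hpos' n j).trans_le (hS.einf_le_supNorm _)), logCard,
        Real.exp_log (by exact_mod_cast hS.ncard_branches_pos _)]
    have hgs0 : 0 ≤ ∏ j ∈ Finset.range (n - τ n), S.supNorm (S.g (S.σ^[j] (S.σ^[τ n] ω))) :=
      Finset.prod_nonneg fun j _ => ((hpos' n j).trans_le (hS.einf_le_supNorm _)).le
    have hgl0 : 0 ≤ ∏ j ∈ Finset.range (n - τ n), S.einf (S.g (S.σ^[j] (S.σ^[τ n] ω))) :=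
      Finset.prod_nonneg fun j _ => (hpos' n j).le
    have hle := InCone.le_mul ha0 (hv2 n) (hv3 n)
    have b1 : ∀ᶠ x in S.cc, v n x₀ / (1 + a) * 1 ≤ S.transferIter H (τ n) ω (fun _ => 1) x := by
      filter_upwards [hv1 n, eventually_cc_mem] with x h1 h2
      rw [h1, mul_one, div_le_iff₀ (by positivity), mul_comm]
      exact hle x₀ hx₀ x h2
    have b2 : ∀ᶠ x in S.cc, S.transferIter H (τ n) ω (fun _ => 1) x ≤ (1 + a) * v n x₀ * 1 := by
      filter_upwards [hv1 n, eventually_cc_mem] with x h1 h2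
      rw [h1, mul_one]
      exact hle x h2 x₀ hx₀
    have hvn := hvx n
    filter_upwards [e1, e2, hS.transferIter_mono (n - τ n) (S.σ^[τ n] ω) b1,
      hS.transferIter_mono (n - τ n) (S.σ^[τ n] ω) b2,
      hS.transferIter_smul (n - τ n) (S.σ^[τ n] ω) (v n x₀ / (1 + a)) (fun _ => 1),
      hS.transferIter_smul (n - τ n) (S.σ^[τ n] ω) ((1 + a) * v n x₀) (fun _ => 1)] with
      x h1 h2 h3 h4 h5 h6
    rw [h5, ← hadd] at h3
    rw [h6, ← hadd] at h4
    constructor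
    · refine le_trans ?_ h3
      simp only [hlw]
      rw [el]
      gcongr
      refine le_trans (le_mul_of_one_le_left hgl0 ?_) h1
      exact_mod_cast hS.ncard_fullPieces_pos _ _
    · refine h4.trans ?_
      simp only [hup]
      rw [eu]
      gcongr
      refine h2.trans ?_
      gcongr
      exact_mod_cast hS.ncard_pieces_le _ _
  · have e : ∀ n, Real.log (up n) - Real.log (lw n) = 2 * Real.log (1 + a) +
        (birkhoffSum S.σ W n ω - birkhoffSum S.σ W (τ n) ω) := fun n => by
      have hvn := hvx n
      have h1a : 0 < 1 + a := by positivity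
      have hadd : birkhoffSum S.σ W n ω - birkhoffSum S.σ W (τ n) ω =
          birkhoffSum S.σ W (n - τ n) (S.σ^[τ n] ω) := by
        have := birkhoffSum_add S.σ W (τ n) (n - τ n) ω
        rw [Nat.add_sub_cancel' (hτle n)] at this
        linarith
      have hadd2 : birkhoffSum S.σ W (n - τ n) (S.σ^[τ n] ω) =
          birkhoffSum S.σ (fun ω => S.logCard H ω + Real.log (S.supNorm (S.g ω)))
            (n - τ n) (S.σ^[τ n] ω) -
          birkhoffSum S.σ (fun ω => Real.log (S.einf (S.g ω))) (n - τ n) (S.σ^[τ n] ω) := by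
        simp only [birkhoffSum, hW, Finset.sum_sub_distrib]
      rw [hadd, hadd2]
      simp only [hlw, hup]
      rw [Real.log_mul (by positivity) (Real.exp_pos _).ne', Real.log_mul (by positivity)
        (Real.exp_pos _).ne', Real.log_exp, Real.log_exp, Real.log_mul h1a.ne' hvn.ne',
        Real.log_div hvn.ne' h1a.ne']
      ring
    -- Since `τ n / n` tends to `1`, the Birkhoff sums of `W` up to `n` and up to `τ n` differ by
    -- `o(n)`.
    have h1 : Tendsto (fun n : ℕ => 2 * Real.log (1 + a) / n + (birkhoffSum S.σ W n ω / n -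
        birkhoffSum S.σ W (τ n) ω / τ n * (τ n / n))) atTop
        (𝓝 (0 + ((∫ ω, W ω ∂m) - (∫ ω, W ω ∂m) * 1))) :=
      (tendsto_const_div_atTop_nhds_zero_nat _).add (hWlim.sub ((hWlim.comp hτtop).mul hτ1))
    rw [mul_one, sub_self, add_zero] at h1
    refine h1.congr' ?_
    filter_upwards [hτtop.eventually_gt_atTop 0] with n hn
    have h2 : (0 : ℝ) < τ n := by exact_mod_cast hn
    have h3 : (0 : ℝ) < n := h2.trans_le (by exact_mod_cast hτle n)
    rw [e]
    field_simp

end RandomMap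

namespace RandomMap

variable {Ω : Type*} [MeasurableSpace Ω] {S : RandomMap Ω} {H : Ω → Set ℝ} {m : Measure Ω}
  {b ξ : Ω → ℝ}

/-! ### Measurability of quantities depending on finitely many coordinates -/

/-- The data over the first `n` points of the orbits of `ω` and `ω'` coincide. -/
def Agree (S : RandomMap Ω) (H : Ω → Set ℝ) (n : ℕ) (ω ω' : Ω) : Prop :=
  ∀ j < n, S.T (S.σ^[j] ω) = S.T (S.σ^[j] ω') ∧ H (S.σ^[j] ω) = H (S.σ^[j] ω') ∧
    S.g (S.σ^[j] ω) = S.g (S.σ^[j] ω')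

theorem Agree.mono {n k : ℕ} {ω ω' : Ω} (h : S.Agree H n ω ω') (hk : k ≤ n) : S.Agree H k ω ω' :=
  fun j hj => h j (hj.trans_le hk)

theorem Agree.iter_eq {n : ℕ} {ω ω' : Ω} (h : S.Agree H n ω ω') : S.iter n ω = S.iter n ω' := by
  induction n with
  | zero => rfl
  | succ n ih => rw [iter_succ, iter_succ, ih (h.mono n.le_succ), (h n n.lt_succ_self).1]

theorem Agree.survivor_eq {n : ℕ} {ω ω' : Ω} (h : S.Agree H n ω ω') :
    S.survivor H n ω = S.survivor H n ω' := by
  ext x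
  refine and_congr_right fun _ => forall₂_congr fun j hj => ?_
  rw [(h.mono hj.le).iter_eq, (h j hj).2.1]

theorem Agree.gprod_eq {n : ℕ} {ω ω' : Ω} (h : S.Agree H n ω ω') :
    S.gprod n ω = S.gprod n ω' := by
  ext x
  refine Finset.prod_congr rfl fun j hj => ?_
  have hj := Finset.mem_range.1 hj
  rw [(h.mono hj.le).iter_eq, (h j hj).2.2]

theorem Agree.branches_eq {n : ℕ} {ω ω' : Ω} (h : S.Agree H n ω ω') :
    S.branches H n ω = S.branches H n ω' := by
  rw [branches, branches, h.survivor_eq, h.iter_eq]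

theorem Agree.fullBranches_eq {n : ℕ} {ω ω' : Ω} (h : S.Agree H n ω ω') :
    S.fullBranches H n ω = S.fullBranches H n ω' := by
  rw [fullBranches, fullBranches, h.branches_eq, h.iter_eq]

theorem Agree.iterate {n k : ℕ} {ω ω' : Ω} (h : S.Agree H (n + k) ω ω') :
    S.Agree H k (S.σ^[n] ω) (S.σ^[n] ω') := fun j hj => by
  rw [← Function.iterate_add_apply, ← Function.iterate_add_apply]
  exact h _ (by omega)

theorem Agree.transferIter_eq {n : ℕ} {ω ω' : Ω} (h : S.Agree H n ω ω') (f : ℝ → ℝ) :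
    S.transferIter H n ω f = S.transferIter H n ω' f := by
  induction n with
  | zero => rfl
  | succ n ih =>
    have h1 : S.Agree H 1 (S.σ^[n] ω) (S.σ^[n] ω') := h.iterate
    show S.transfer H (S.σ^[n] ω) (S.transferIter H n ω f) =
      S.transfer H (S.σ^[n] ω') (S.transferIter H n ω' f)
    ext x
    simp only [transfer]
    rw [ih (h.mono n.le_succ), h1.branches_eq, (h n n.lt_succ_self).1, (h n n.lt_succ_self).2.2]

/-- Such a function factors through the itinerary in the countable partition, a measurable map to a
countable discrete space. -/
theorem IsRandomOpenMap.measurable_of_agree (hS : S.IsRandomOpenMap H) (n : ℕ) {f : Ω → ℝ}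
    (h : ∀ ω ω', S.Agree H n ω ω' → f ω = f ω') : Measurable f := by
  obtain ⟨idx, hidx, hidx'⟩ := hS.countable_partition
  set φ : Ω → Fin n → ℕ := fun ω j => idx (S.σ^[j] ω) with hφ
  have hφm : Measurable φ := measurable_pi_lambda _ fun j =>
    hidx.comp (S.σ.measurable.iterate j)
  have hfac : Function.FactorsThrough f φ := fun ω ω' hωω' => h ω ω' fun j hj =>
    hidx' _ _ (congrFun hωω' ⟨j, hj⟩)
  have : f = Function.extend φ f 0 ∘ φ := by
    ext ω
    exact (hfac.extend_apply 0 ω).symm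
  rw [this]
  exact (measurable_of_countable _).comp hφm

variable [IsProbabilityMeasure m]

/-! ### The Lyapunov exponent as a growth rate -/

theorem IsAdmissible.ae_multiplier_bounds (hA : S.IsAdmissible m H b ξ) :
    ∀ᵐ ω ∂m, 0 < S.multiplier H ω ∧
      Real.log (S.einf (S.g ω)) ≤ Real.log (S.multiplier H ω) ∧
      Real.log (S.multiplier H ω) ≤ S.logCard H ω + Real.log (S.supNorm (S.g ω)) := by
  filter_upwards [hA.ae_isGoodFibre] with ω hω
  have h0 : 0 < S.einf (S.g ω) := (hω 0).einf_pos 0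
  obtain ⟨h1, h2⟩ := hA.map.multiplier_mem_Icc (ω := ω) (hω 0).einf_pos (hω 1)
  refine ⟨h0.trans_le h1, Real.log_le_log h0 h1, ?_⟩
  rw [logCard, ← Real.log_mul (by exact_mod_cast (hA.map.ncard_branches_pos ω).ne')
    (h0.trans_le (hA.map.einf_le_supNorm _)).ne']
  exact Real.log_le_log (h0.trans_le h1) h2

/-- The multiplier is the almost sure limit of ratios of essential infima that depend on finitely
many points of the orbit. -/
theorem IsAdmissible.aemeasurable_multiplier (hA : S.IsAdmissible m H b ξ) :
    AEMeasurable (S.multiplier H) m := by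
  have hS := hA.map
  refine aemeasurable_of_tendsto_metrizable_ae atTop
    (f := fun (n : ℕ) ω => S.einf (S.transferIter H (1 + n) ω fun _ => 1) /
      S.einf (S.transferIter H n (S.σ ω) fun _ => 1)) (fun n => ?_) ?_
  · refine (hS.measurable_of_agree (1 + n) fun ω ω' h => ?_).aemeasurable
    have h1 : S.Agree H n (S.σ ω) (S.σ ω') := h.iterate
    rw [h.transferIter_eq, h1.transferIter_eq]
  · filter_upwards [hA.ae_isGoodFibre] with ω hω
    have hone : S.IsBV fun _ => 1 := inCone_one.isBV (a := 1) hS.lo_lt_hi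
    have h1 : S.IsGoodFibre H (S.σ ω) := hω 1
    have h2 := (hS.hasLim_integral (hS.isLimMeasure_conformalMeasure h1) h1.contracting
      (hS.isBV_transferIter (ω := ω) 1 (hω 0).einf_pos hone)).2
    have h3 := hS.tendsto_einf_ratio h1.einf_pos h2 (hS.transferIter_nonneg 1 ω
      (Eventually.of_forall fun _ => zero_le_one))
    simp only [transferIter_add]
    exact h3

theorem IsAdmissible.integrable_log_multiplier (hA : S.IsAdmissible m H b ξ) :
    Integrable (fun ω => Real.log (S.multiplier H ω)) m := by
  refine Integrable.mono' (hA.int_inf.abs.add (hA.int_card.add hA.int_sup).abs)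
    hA.aemeasurable_multiplier.log.aestronglyMeasurable ?_
  filter_upwards [hA.ae_multiplier_bounds] with ω ⟨_, h1, h2⟩
  simp only [Pi.add_apply, Real.norm_eq_abs]
  rw [abs_le]
  constructor
  · linarith [neg_abs_le (Real.log (S.einf (S.g ω))),
      abs_nonneg (S.logCard H ω + Real.log (S.supNorm (S.g ω)))]
  · linarith [le_abs_self (S.logCard H ω + Real.log (S.supNorm (S.g ω))),
      abs_nonneg (Real.log (S.einf (S.g ω)))]

theorem IsRandomOpenMap.integral_conformalMeasure_one (hS : S.IsRandomOpenMap H) {ω : Ω}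
    (hω : S.IsGoodFibre H ω) : ∫ _, (1 : ℝ) ∂(S.conformalMeasure H ω) = 1 := by
  have := (hS.isLimMeasure_conformalMeasure hω).prob
  simp

theorem IsAdmissible.ae_prod_multiplier (hA : S.IsAdmissible m H b ξ) :
    ∀ᵐ ω ∂m, ∀ n, 0 < ∏ j ∈ Finset.range n, S.multiplier H (S.σ^[j] ω) ∧
      Real.log (∏ j ∈ Finset.range n, S.multiplier H (S.σ^[j] ω)) =
        birkhoffSum S.σ (fun ω => Real.log (S.multiplier H ω)) n ω := by
  filter_upwards [ae_all_iterate hA.erg hA.ae_multiplier_bounds] with ω hω n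
  exact ⟨Finset.prod_pos fun j _ => (hω j).1, Real.log_prod fun j _ => (hω j).1.ne'⟩

/-- Every sequence between the bounds for the iterates of the constant function `1` grows at the
rate given by the Lyapunov exponent. -/
theorem IsAdmissible.ae_lyapunov (hA : S.IsAdmissible m H b ξ) :
    ∀ᵐ ω ∂m, ∃ lw up : ℕ → ℝ, (∀ n, 0 < lw n) ∧ (∀ n, ∀ᶠ x in S.cc,
      lw n ≤ S.transferIter H n ω (fun _ => 1) x ∧ S.transferIter H n ω (fun _ => 1) x ≤ up n) ∧
      ∀ v : ℕ → ℝ, (∀ n, v n ∈ Icc (lw n) (up n)) →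
        Tendsto (fun n : ℕ => Real.log (v n) / n) atTop (𝓝 (S.lyapunov m H)) := by
  have hS := hA.map
  filter_upwards [hA.ae_growth, hA.ae_isGoodFibre, hA.ae_prod_multiplier,
    hA.ae_tendsto hA.integrable_log_multiplier] with ω ⟨lw, up, h0, hb, hlim⟩ hω hprod hbirk
  refine ⟨lw, up, h0, hb, fun v hv => ?_⟩
  have hone : S.IsBV fun _ => 1 := inCone_one.isBV (a := 1) hS.lo_lt_hi
  -- The product of the multipliers is the integral of the iterate of `1` against a probability
  -- measure, so it obeys the same bounds as `v n`.
  have hmem : ∀ n, ∏ j ∈ Finset.range n, S.multiplier H (S.σ^[j] ω) ∈ Icc (lw n) (up n) := by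
    intro n
    have h1 := hS.integral_transferIter hω n hone
    rw [hS.integral_conformalMeasure_one (ω := ω) (hω 0), mul_one] at h1
    rw [← h1]
    exact hS.integral_mem_Icc (hω n) (hS.isBV_transferIter n (hω 0).einf_pos hone)
      ((hb n).mono fun x hx => hx.1) ((hb n).mono fun x hx => hx.2)
  have hdiff : Tendsto (fun n : ℕ => (Real.log (v n) - Real.log
      (∏ j ∈ Finset.range n, S.multiplier H (S.σ^[j] ω))) / n) atTop (𝓝 0) := by
    refine squeeze_zero_norm (fun n => ?_) hlim
    have hl := Real.log_le_log (h0 n) (hv n).1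
    have hu := Real.log_le_log ((h0 n).trans_le (hv n).1) (hv n).2
    have hl' := Real.log_le_log (h0 n) (hmem n).1
    have hu' := Real.log_le_log ((h0 n).trans_le (hmem n).1) (hmem n).2
    rw [norm_div, Real.norm_natCast, Real.norm_eq_abs]
    refine div_le_div_of_nonneg_right ?_ (Nat.cast_nonneg n)
    rw [abs_le]
    constructor <;> linarith
  have := hdiff.add hbirk
  rw [zero_add] at this
  refine this.congr fun n => ?_
  rw [← add_div, (hprod n).2, sub_add_cancel]

theorem IsAdmissible.ae_tendsto_log_einf (hA : S.IsAdmissible m H b ξ) :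
    ∀ᵐ ω ∂m, (∀ n, 0 < S.einf (S.transferIter H n ω fun _ => 1)) ∧ Tendsto
      (fun n : ℕ => 1 / (n : ℝ) * Real.log (S.einf (S.transferIter H n ω (fun _ => 1))))
      atTop (𝓝 (S.lyapunov m H)) := by
  filter_upwards [hA.ae_lyapunov] with ω ⟨lw, up, h0, hb, h⟩
  have hmem : ∀ n, S.einf (S.transferIter H n ω fun _ => 1) ∈ Icc (lw n) (up n) := fun n => by
    have h1 := ae_of_eventually_cc ((hb n).mono fun x hx => hx.1)
    have h2 := ae_of_eventually_cc ((hb n).mono fun x hx => hx.2)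
    exact ⟨le_einf hA.map.lo_lt_hi h1 h2, einf_le_of_ae_le hA.map.lo_lt_hi h1 h2⟩
  refine ⟨fun n => (h0 n).trans_le (hmem n).1, (h _ hmem).congr fun n => ?_⟩
  rw [one_div_mul_eq_div]

/-- Both exponents are growth rates of essential infima at a common generic `ω`, where the operators
are ordered for every `n`. -/
theorem IsAdmissible.lyapunov_anti {H' : Ω → Set ℝ} {b' ξ' : Ω → ℝ} (hA : S.IsAdmissible m H b ξ)
    (hA' : S.IsAdmissible m H' b' ξ') (h : ∀ ω, H' ω ⊆ H ω) :
    S.lyapunov m H ≤ S.lyapunov m H' := by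
  have := hA.erg
  obtain ⟨ω, ⟨h0, h1⟩, ⟨-, h2⟩, h3, h3'⟩ := (hA.ae_tendsto_log_einf.and
    (hA'.ae_tendsto_log_einf.and (hA.ae_isGoodFibre.and hA'.ae_isGoodFibre))).exists
  refine le_of_tendsto_of_tendsto' h1 h2 fun n => ?_
  refine mul_le_mul_of_nonneg_left (Real.log_le_log (h0 n) ?_) (by positivity)
  refine le_einf hA.map.lo_lt_hi ?_
    (ae_of_eventually_cc (hA'.map.transferIter_one_le n (h3' 0).einf_pos))
  filter_upwards [ae_einf_le (ae_of_eventually_cc (hA.map.le_transferIter_one n (h3 0).einf_pos)),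
    ae_of_eventually_cc (hA.map.transferIter_anti hA'.map h n ω (f := fun _ => 1)
      (Eventually.of_forall fun _ => zero_le_one))] with x e1 e2
  exact e1.trans e2

theorem isBV_finset_sum (R : Finset (Set ℝ)) (h : ∀ Z ∈ R, Z.OrdConnected) :
    S.IsBV fun x => ∑ Z ∈ R, Z.indicator (fun _ => 1) x := by
  classical
  induction R using Finset.induction_on with
  | empty => exact .of_boundedVariationOn (by simp [BoundedVariationOn, eVariationOn_const])
  | insert Z R hZ ih =>
    have h1 := (isBV_indicator (S := S) (h Z (Finset.mem_insert_self Z R))).linear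
      (ih fun W hW => h W (Finset.mem_insert_of_mem hW)) 1 1
    simpa only [Finset.sum_insert hZ, one_mul] using h1

theorem IsRandomOpenMap.isBV_indicator_survivor (hS : S.IsRandomOpenMap H) (n : ℕ) (ω : Ω) :
    S.IsBV ((S.survivor H n ω).indicator fun _ => 1) ∧
      ∀ᶠ x in S.cc, x ∈ S.survivor H n ω ↔ x ∈ ⋃₀ S.pieces H n ω := by
  classical
  have hiff : ∀ᶠ x in S.cc, x ∈ S.survivor H n ω ↔ x ∈ ⋃₀ S.pieces H n ω := by
    filter_upwards [eventually_cc_notMem (hS.countable_diff_pieces n ω)] with x hx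
    refine ⟨fun h => by by_contra hn; exact hx ⟨h, hn⟩, ?_⟩
    rintro ⟨Z, hZ, hxZ⟩
    exact (hS.isMonoInterval_of_mem_pieces hZ).1.2.2.2.1 hxZ
  refine ⟨?_, hiff⟩
  set R := (hS.finite_pieces n ω).toFinset
  have hR : ∀ Z ∈ R, Z ∈ S.pieces H n ω := fun Z hZ => (hS.finite_pieces n ω).mem_toFinset.1 hZ
  obtain ⟨u, hu1, hu2⟩ := isBV_finset_sum (S := S) R
    fun Z hZ => (hS.isMonoInterval_of_mem_pieces (hR Z hZ)).1.2.1
  refine ⟨u, ?_, hu2⟩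
  filter_upwards [hu1, hiff] with x h1 h2
  rw [← h1]
  have h3 := congrFun (Finset.indicator_biUnion R (fun Z => Z) (f := fun _ : ℝ => (1 : ℝ))
    fun Z hZ Z' hZ' hne => disjoint_pieces (hR Z hZ) (hR Z' hZ') hne) x
  rw [← h3]
  have h4 : x ∈ (⋃ Z ∈ R, Z) ↔ x ∈ ⋃₀ S.pieces H n ω := by
    simp [R, mem_sUnion]
  by_cases hx : x ∈ S.survivor H n ω
  · rw [indicator_of_mem hx, indicator_of_mem (h4.2 (h2.1 hx))]
  · rw [indicator_of_notMem hx, indicator_of_notMem fun h => hx (h2.2 (h4.1 h))]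

/-- The survivor set is replaced by the open union of its pieces, from which it differs by a set
negligible for `ν`. -/
theorem IsRandomOpenMap.integral_indicator_survivor {H' : Ω → Set ℝ} (hS : S.IsRandomOpenMap H)
    {n : ℕ} {ω : Ω} {ν : Measure ℝ} (hν : S.IsLimMeasure H' ω ν) :
    ∫ x, (S.survivor H n ω).indicator (fun _ => (1 : ℝ)) x ∂ν = ν.real (S.survivor H n ω) := by
  have := hν.prob
  have h := hν.ae_of_eventually_cc (hS.isBV_indicator_survivor n ω).2
  have hmeas : MeasurableSet (⋃₀ S.pieces H n ω) :=
    (isOpen_sUnion fun Z hZ => (hS.isMonoInterval_of_mem_pieces hZ).1.1).measurableSet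
  have h1 : (S.survivor H n ω).indicator (fun _ => (1 : ℝ)) =ᵐ[ν]
      (⋃₀ S.pieces H n ω).indicator (fun _ => (1 : ℝ)) := by
    filter_upwards [h] with x hx
    by_cases hxs : x ∈ S.survivor H n ω
    · rw [indicator_of_mem hxs, indicator_of_mem (hx.1 hxs)]
    · rw [indicator_of_notMem hxs, indicator_of_notMem fun h => hxs (hx.2 h)]
  rw [integral_congr_ae h1, integral_indicator hmeas, measureReal_congr
    (eventuallyEq_set.2 h)]
  simp

/-- Equivariance for `H'`, applied to the indicator of the survivor set of `H`, shows that its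
measure times the product of the multipliers of `H'` is the integral of the iterate of `1` for `H`.
This lies between the bounds of `ae_lyapunov`; take logarithms. -/
theorem IsAdmissible.ae_escape {H' : Ω → Set ℝ} {b' ξ' : Ω → ℝ} (hA : S.IsAdmissible m H b ξ)
    (hA' : S.IsAdmissible m H' b' ξ') (h : ∀ ω, H' ω ⊆ H ω) : ∀ᵐ ω ∂m,
    (∀ n : ℕ, 0 < (S.conformalMeasure H' ω).real (S.survivor H n ω)) ∧
    Tendsto (fun n : ℕ => -(1 / (n : ℝ) *
      Real.log ((S.conformalMeasure H' ω).real (S.survivor H n ω))))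
      atTop (𝓝 (S.lyapunov m H' - S.lyapunov m H)) := by
  filter_upwards [hA.ae_lyapunov, hA'.ae_isGoodFibre, hA'.ae_prod_multiplier,
    hA'.ae_tendsto hA'.integrable_log_multiplier] with ω ⟨lw, up, h0, hb, hv⟩ hω hprod hbirk
  have hmem : ∀ n, (∏ j ∈ Finset.range n, S.multiplier H' (S.σ^[j] ω)) *
      (S.conformalMeasure H' ω).real (S.survivor H n ω) ∈ Icc (lw n) (up n) := by
    intro n
    have hbv := (hA.map.isBV_indicator_survivor n ω).1
    rw [← hA.map.integral_indicator_survivor (hA'.map.isLimMeasure_conformalMeasure (ω := ω) (hω 0)),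
      ← hA'.map.integral_transferIter hω n hbv]
    have heq := hA.map.transferIter_indicator_survivor hA'.map h n ω (fun _ => 1)
    refine hA'.map.integral_mem_Icc (hω n)
      (hA'.map.isBV_transferIter (ω := ω) n (hω 0).einf_pos hbv) ?_ ?_
    · filter_upwards [heq, hb n] with x e1 e2
      rw [e1]; exact e2.1
    · filter_upwards [heq, hb n] with x e1 e2
      rw [e1]; exact e2.2
  have hpos : ∀ n, 0 < (S.conformalMeasure H' ω).real (S.survivor H n ω) := fun n =>
    pos_of_mul_pos_right ((h0 n).trans_le (hmem n).1) (hprod n).1.le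
  refine ⟨hpos, (hbirk.sub (hv _ hmem)).congr fun n => ?_⟩
  rw [Real.log_mul (hprod n).1.ne' (hpos n).ne', (hprod n).2]
  ring

end RandomMap

namespace RandomMap

variable {Ω : Type*} [MeasurableSpace Ω] {S : RandomMap Ω} {H : Ω → Set ℝ} {m : Measure Ω}
  {b ξ : Ω → ℝ}

/-! ### Counting branches -/

/-- A full branch remains maximal when the hole shrinks. -/
theorem IsRandomOpenMap.numFull_one_anti {H' : Ω → Set ℝ} (hS' : S.IsRandomOpenMap H') {ω : Ω}
    (h : H' ω ⊆ H ω) : S.numFull H 1 ω ≤ S.numFull H' 1 ω := by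
  refine ncard_le_ncard (fun Z hZ => ?_) ((hS'.finite_branches_one ω).subset (sep_subset _ _))
  rw [mem_fullBranches_one] at hZ ⊢
  have h1 := hZ.1.1
  refine ⟨IsMonoInterval.mem_monoIntervals_of_full ⟨h1.1, h1.2.1, h1.2.2.1,
    h1.2.2.2.1.trans (sdiff_subset_sdiff_right h), h1.2.2.2.2⟩
    ((hS'.mapsTo ω).mono_left sdiff_subset) hZ.2, hZ.2⟩

theorem IsRandomOpenMap.numFull_one_le (hS : S.IsRandomOpenMap H) (ω : Ω) :
    S.numFull H 1 ω ≤ (S.branches H 1 ω).ncard :=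
  ncard_le_ncard (sep_subset _ _) (hS.finite_branches_one ω)

/-- Sort the non-full branches by the number of full branches to their left: there is one class more
than full branches, and no class is separated by a full branch. -/
theorem IsRandomOpenMap.ncard_branches_one_le (hS : S.IsRandomOpenMap H) (ω : Ω) :
    (S.branches H 1 ω).ncard ≤
      S.numFull H 1 ω + S.maxContiguous H 1 ω * (S.numFull H 1 ω + 1) := by
  classical
  have hfin := hS.finite_branches_one ω
  have hF : (S.fullBranches H 1 ω).Finite := hfin.subset (sep_subset _ _)
  have hP : (S.partialBranches H 1 ω).Finite := hfin.subset sdiff_subset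
  have hFs : S.fullBranches H 1 ω ⊆ S.branches H 1 ω := sep_subset _ _
  have hne : ∀ Z ∈ S.branches H 1 ω, Z.Nonempty := fun Z hZ => hZ.1.2.2.1
  have hcard : (S.branches H 1 ω).ncard = S.numFull H 1 ω + hP.toFinset.card := by
    rw [← ncard_eq_toFinset_card _ hP, partialBranches, ncard_sdiff hFs hF, numFull]
    have := ncard_le_ncard hFs hfin
    omega
  rw [hcard]
  refine Nat.add_le_add_left ?_ _
  set c : Set ℝ → ℕ := fun W => (hF.toFinset.filter fun Z => SetBefore Z W).card with hc
  have hmaps : ∀ W ∈ hP.toFinset, c W ∈ Finset.range (S.numFull H 1 ω + 1) := fun W _ => by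
    rw [Finset.mem_range, Nat.lt_succ_iff, numFull, ncard_eq_toFinset_card _ hF]
    exact Finset.card_filter_le _ _
  have := Finset.card_le_mul_card_image_of_maps_to hmaps (S.maxContiguous H 1 ω) fun i _ => by
    refine hS.card_le_of_maxContiguous (fun W hW => hP.mem_toFinset.1 (Finset.mem_filter.1 hW).1) ?_
    rintro Z hZ W hW W' hW' ⟨h1, h2⟩
    obtain ⟨hWP, hWi⟩ := Finset.mem_filter.1 hW
    obtain ⟨hWP', hWi'⟩ := Finset.mem_filter.1 hW'
    have hWne := hne W (hP.mem_toFinset.1 hWP).1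
    have hZne := hne Z (hFs hZ)
    have hlt : c W < c W' := by
      refine Finset.card_lt_card (Finset.ssubset_iff_subset_ne.2 ⟨fun Y hY => ?_, fun heq => ?_⟩)
      · obtain ⟨hY1, hY2⟩ := Finset.mem_filter.1 hY
        exact Finset.mem_filter.2 ⟨hY1, (hY2.trans h1 hWne).trans h2 hZne⟩
      · have hZ' : Z ∈ hF.toFinset.filter fun Z => SetBefore Z W' :=
          Finset.mem_filter.2 ⟨hF.mem_toFinset.2 hZ, h2⟩
        rw [← heq] at hZ'
        obtain ⟨w, hw⟩ := hWne
        obtain ⟨z, hz⟩ := hZne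
        exact lt_asymm (h1 w hw z hz) ((Finset.mem_filter.1 hZ').2 z hz w hw)
    omega
  rwa [Finset.card_range] at this

/-- Holes can create branches, but only non-full ones in groups of at most `ξ`, while full ones do
not become more numerous. The term `log (2 + ξ)` is recovered from the excess, with `log b` bounded
by the logarithmic branch count for `H'`. -/
theorem IsRandomOpenMap.logCard_le {H' : Ω → Set ℝ} (hS : S.IsRandomOpenMap H)
    (hS' : S.IsRandomOpenMap H') (h : ∀ ω, H' ω ⊆ H ω) (hb : ∀ ω, 0 < b ω) (hξ : ∀ ω, 0 < ξ ω)
    (hb_le : ∀ ω, b ω ≤ S.numFull H 1 ω) (hle_ξ : ∀ ω, S.maxContiguous H 1 ω ≤ ξ ω) (ω : Ω) :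
    S.logCard H ω ≤ Real.log 2 + 2 * S.logCard H' ω + (S.excess b ξ ω -
      Real.log (S.supNorm (S.g ω)) + Real.log (S.einf (S.g ω))) := by
  have hn0 : (0 : ℝ) < (S.branches H 1 ω).ncard := by exact_mod_cast hS.ncard_branches_pos ω
  have hn1 : (1 : ℝ) ≤ (S.branches H' 1 ω).ncard := by exact_mod_cast hS'.ncard_branches_pos ω
  have h1 : (S.numFull H 1 ω : ℝ) ≤ (S.branches H' 1 ω).ncard := by
    exact_mod_cast (hS'.numFull_one_anti (h ω)).trans (hS'.numFull_one_le ω)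
  have h2 : ((S.branches H 1 ω).ncard : ℝ) ≤
      S.numFull H 1 ω + S.maxContiguous H 1 ω * (S.numFull H 1 ω + 1) := by
    exact_mod_cast hS.ncard_branches_one_le ω
  have h3 := hξ ω
  have h4 : ((S.branches H 1 ω).ncard : ℝ) ≤ 2 * (S.branches H' 1 ω).ncard * (2 + ξ ω) := by
    calc _ ≤ _ := h2
      _ ≤ (S.branches H' 1 ω).ncard + ξ ω * ((S.branches H' 1 ω).ncard + 1) := by
          gcongr
          exact hle_ξ ω
      _ ≤ _ := by nlinarith
  have h5 : Real.log (b ω) ≤ S.logCard H' ω := Real.log_le_log (hb ω) ((hb_le ω).trans h1)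
  have h6 := Real.log_le_log hn0 h4
  rw [Real.log_mul (by positivity) (by positivity), Real.log_mul (by norm_num) (by positivity)]
    at h6
  rw [logCard, excess]
  rw [logCard] at h5 ⊢
  linarith

theorem IsRandomOpenMap.measurable_logCard (hS : S.IsRandomOpenMap H) :
    Measurable (S.logCard H) :=
  hS.measurable_of_agree 1 fun ω ω' h => by rw [logCard, logCard, h.branches_eq]

theorem IsRandomOpenMap.integrable_logCard {H' : Ω → Set ℝ} (hS : S.IsRandomOpenMap H)
    (hS' : S.IsRandomOpenMap H') (h : ∀ ω, H' ω ⊆ H ω) (hb : ∀ ω, 0 < b ω) (hξ : ∀ ω, 0 < ξ ω)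
    (hb_le : ∀ ω, b ω ≤ S.numFull H 1 ω) (hle_ξ : ∀ ω, S.maxContiguous H 1 ω ≤ ξ ω)
    [IsFiniteMeasure m] (hcard : Integrable (S.logCard H') m)
    (hsup : Integrable (fun ω => Real.log (S.supNorm (S.g ω))) m)
    (hinf : Integrable (fun ω => Real.log (S.einf (S.g ω))) m)
    (hex : Integrable (S.excess b ξ) m) : Integrable (S.logCard H) m := by
  refine Integrable.mono' (((integrable_const (Real.log 2)).add (hcard.const_mul 2)).add
    ((hex.sub hsup).add hinf)) hS.measurable_logCard.aestronglyMeasurable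
    (Eventually.of_forall fun ω => ?_)
  rw [Real.norm_of_nonneg (hS.logCard_nonneg ω)]
  exact hS.logCard_le hS' h hb hξ hb_le hle_ξ ω

/-! ### The contraction constant -/

theorem IsRandomOpenMap.einfOn_survivor_bounds (hS : S.IsRandomOpenMap H) (n : ℕ) {ω : Ω}
    (h : ∀ j, 0 < S.einf (S.g (S.σ^[j] ω))) :
    ∏ j ∈ Finset.range n, S.einf (S.g (S.σ^[j] ω)) ≤
      einfOn (S.survivor H n ω) (S.gprod n ω) ∧
    einfOn (S.survivor H n ω) (S.gprod n ω) ≤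
      ∏ j ∈ Finset.range n, S.supNorm (S.g (S.σ^[j] ω)) := by
  obtain ⟨G, hG1, hG2, -⟩ := hS.exists_regular_gprod n h
  have hsub : ⋃₀ S.pieces H n ω ⊆ S.survivor H n ω := sUnion_subset fun Z hZ =>
    (hS.isMonoInterval_of_mem_pieces hZ).1.2.2.2.1
  have hopen : IsOpen (⋃₀ S.pieces H n ω) :=
    isOpen_sUnion fun Z hZ => (hS.isMonoInterval_of_mem_pieces hZ).1.1
  have hcount := hS.countable_diff_pieces n ω
  have hmeas : MeasurableSet (S.survivor H n ω) := by
    rw [← union_sdiff_cancel hsub]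
    exact hopen.measurableSet.union hcount.measurableSet
  have hne : (ae (volume.restrict (S.survivor H n ω))).NeBot := by
    rw [MeasureTheory.ae_neBot, Ne, Measure.restrict_eq_zero]
    obtain ⟨Z, hZ⟩ := nonempty_of_ncard_ne_zero (hS.ncard_fullPieces_pos n ω).ne'
    have hZp := hS.isMonoInterval_of_mem_pieces hZ.1
    exact ((hZp.1.1.measure_pos volume hZp.1.2.2.1).trans_le
      (measure_mono hZp.1.2.2.2.1)).ne'
  have hae : ∀ᵐ x ∂volume.restrict (S.survivor H n ω),
      ∏ j ∈ Finset.range n, S.einf (S.g (S.σ^[j] ω)) ≤ S.gprod n ω x ∧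
      S.gprod n ω x ≤ ∏ j ∈ Finset.range n, S.supNorm (S.g (S.σ^[j] ω)) := by
    rw [ae_restrict_iff' hmeas]
    filter_upwards [hG1.ae_notMem volume, hcount.ae_notMem volume] with x h1 h2 h3
    have h4 : G x = S.gprod n ω x := by
      by_contra hcon
      exact h1 ⟨h3, hcon⟩
    have h5 : x ∈ ⋃₀ S.pieces H n ω := by
      by_contra hcon
      exact h2 ⟨h3, hcon⟩
    obtain ⟨Z, hZ, hxZ⟩ := h5
    rw [← h4]
    exact hG2 Z hZ x hxZ
  constructor
  · have hb : IsBoundedUnder (· ≤ ·) (ae (volume.restrict (S.survivor H n ω))) (S.gprod n ω) :=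
      ⟨_, by simpa using hae.mono fun x hx => hx.2⟩
    exact le_liminf_of_le hb.isCoboundedUnder_ge (hae.mono fun x hx => hx.1)
  · have hb : ∀ᵐ x ∂volume.restrict (S.survivor H n ω),
        einfOn (S.survivor H n ω) (S.gprod n ω) ≤ S.gprod n ω x :=
      ae_essInf_le ⟨_, by simpa using hae.mono fun x hx => hx.1⟩
    obtain ⟨x, h1, h2⟩ := (hb.and hae).exists
    exact h1.trans h2.2

/-- The logarithm of the contraction constant lies between integrable functions. -/
theorem IsRandomOpenMap.log_contractionConst_bounds (hS : S.IsRandomOpenMap H)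
    (hb : ∀ ω, 0 < b ω) (hξ : ∀ ω, 0 < ξ ω) (hb_le : ∀ ω, b ω ≤ S.numFull H 1 ω)
    (hle_ξ : ∀ ω, S.maxContiguous H 1 ω ≤ ξ ω) {n : ℕ} (hn : 0 < n) {ω : Ω}
    (h : ∀ j, 0 < S.einf (S.g (S.σ^[j] ω))) :
    -birkhoffSum S.σ (S.logCard H) n ω ≤ Real.log (S.contractionConst H n ω) ∧
    Real.log (S.contractionConst H n ω) ≤ Real.log 3 + Real.log n + Real.log (1 + 4 * n) + 1 / n +
      birkhoffSum S.σ S.relVar n ω / n + birkhoffSum S.σ (S.excess b ξ) n ω := by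
  have hn0 : (0 : ℝ) < n := by exact_mod_cast hn
  have hgl0 : 0 < ∏ j ∈ Finset.range n, S.einf (S.g (S.σ^[j] ω)) := Finset.prod_pos fun j _ => h j
  have hgs0 : 0 < ∏ j ∈ Finset.range n, S.supNorm (S.g (S.σ^[j] ω)) :=
    Finset.prod_pos fun j _ => (h j).trans_le (hS.einf_le_supNorm _)
  have hv0 : 0 ≤ ∑ j ∈ Finset.range n, S.var (S.g (S.σ^[j] ω)) / S.supNorm (S.g (S.σ^[j] ω)) :=
    Finset.sum_nonneg fun j _ =>
      div_nonneg (var_nonneg _) ((h j).trans_le (hS.einf_le_supNorm _)).le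
  have hvs : ∑ j ∈ Finset.range n, S.var (S.g (S.σ^[j] ω)) / S.supNorm (S.g (S.σ^[j] ω)) ≤
      birkhoffSum S.σ S.relVar n ω :=
    Finset.sum_le_sum fun j _ => by rw [relVar]; linarith
  obtain ⟨he1, he2⟩ := hS.einfOn_survivor_bounds n h
  have hmc := (hS.maxContiguous_le (hS.isContigBound hle_ξ n ω))
  have hX := one_add_mul_prod_le (S := S) hξ n ω
  have hBp : ∏ j ∈ Finset.range n, b (S.σ^[j] ω) ≤ S.numFull H n ω := by
    calc _ ≤ ∏ j ∈ Finset.range n, (S.numFull H 1 (S.σ^[j] ω) : ℝ) :=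
          Finset.prod_le_prod (fun j _ => (hb _).le) fun j _ => hb_le _
      _ ≤ _ := by exact_mod_cast hS.prod_numFull_le_numFull n ω
  have hBp0 : 0 < ∏ j ∈ Finset.range n, b (S.σ^[j] ω) := Finset.prod_pos fun j _ => hb _
  have hnf : (S.numFull H n ω : ℝ) ≤ Real.exp (birkhoffSum S.σ (S.logCard H) n ω) := by
    rw [hS.exp_birkhoffSum_logCard]
    exact_mod_cast hS.numFull_le n ω
  have hex := hS.exp_birkhoffSum_excess hb hξ n h
  have hX0 : 0 < ∏ j ∈ Finset.range n, (2 + ξ (S.σ^[j] ω)) :=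
    Finset.prod_pos fun j _ => by linarith [hξ (S.σ^[j] ω)]
  rw [contractionConst]
  have hmc0 : (0 : ℝ) ≤ S.maxContiguous H n ω := Nat.cast_nonneg _
  set v := ∑ j ∈ Finset.range n, S.var (S.g (S.σ^[j] ω)) / S.supNorm (S.g (S.σ^[j] ω))
  set gl := ∏ j ∈ Finset.range n, S.einf (S.g (S.σ^[j] ω))
  set gs := ∏ j ∈ Finset.range n, S.supNorm (S.g (S.σ^[j] ω))
  set e := einfOn (S.survivor H n ω) (S.gprod n ω)
  set X := ∏ j ∈ Finset.range n, (2 + ξ (S.σ^[j] ω))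
  set Bp := ∏ j ∈ Finset.range n, b (S.σ^[j] ω)
  set mc := (S.maxContiguous H n ω : ℝ)
  set nf := (S.numFull H n ω : ℝ)
  have he0 : 0 < e := hgl0.trans_le he1
  have hnf0 : 0 < nf := hBp0.trans_le hBp
  have hc0 : 0 < (3 + 3 * v) * (1 + 2 * mc) * gs / (nf * e) := by positivity
  constructor
  · rw [Real.le_log_iff_exp_le hc0, Real.exp_neg, le_div_iff₀ (by positivity)]
    calc _ ≤ (Real.exp (birkhoffSum S.σ (S.logCard H) n ω))⁻¹ *
          (Real.exp (birkhoffSum S.σ (S.logCard H) n ω) * gs) := by gcongr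
      _ = 1 * 1 * gs := by
          rw [inv_mul_cancel_left₀ (Real.exp_pos _).ne']; ring
      _ ≤ _ := by gcongr <;> linarith
  · rw [Real.log_le_iff_le_exp hc0]
    have hs : 1 + v ≤ Real.exp (1 / n + birkhoffSum S.σ S.relVar n ω / n) * n := by
      rw [← div_le_iff₀ hn0]
      have h1 := Real.add_one_le_exp (1 / n + birkhoffSum S.σ S.relVar n ω / n)
      have h2 : (1 + v) / n ≤ 1 / n + birkhoffSum S.σ S.relVar n ω / n := by
        rw [← add_div]; gcongr
      linarith
    have hE : Real.exp (Real.log 3 + Real.log n + Real.log (1 + 4 * n) + 1 / n +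
        birkhoffSum S.σ S.relVar n ω / n + birkhoffSum S.σ (S.excess b ξ) n ω) =
        3 * (Real.exp (1 / n + birkhoffSum S.σ S.relVar n ω / n) * n) * (1 + 4 * n) *
          Real.exp (birkhoffSum S.σ (S.excess b ξ) n ω) := by
      rw [add_assoc (Real.log 3 + Real.log n + Real.log (1 + 4 * n)), Real.exp_add, Real.exp_add,
        Real.exp_add, Real.exp_add, Real.exp_log (by norm_num), Real.exp_log hn0,
        Real.exp_log (by positivity)]
      ring
    rw [hE, div_le_iff₀ (by positivity)]
    calc (3 + 3 * v) * (1 + 2 * mc) * gs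
        ≤ (3 * (Real.exp (1 / n + birkhoffSum S.σ S.relVar n ω / n) * n)) * ((1 + 4 * n) * X) *
          gs := by
          gcongr
          · linarith
          · linarith
      _ = 3 * (Real.exp (1 / n + birkhoffSum S.σ S.relVar n ω / n) * n) * (1 + 4 * n) *
          (gs * X) := by ring
      _ = 3 * (Real.exp (1 / n + birkhoffSum S.σ S.relVar n ω / n) * n) * (1 + 4 * n) *
          (Real.exp (birkhoffSum S.σ (S.excess b ξ) n ω) * (gl * Bp)) := by rw [hex]
      _ ≤ 3 * (Real.exp (1 / n + birkhoffSum S.σ S.relVar n ω / n) * n) * (1 + 4 * n) *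
          (Real.exp (birkhoffSum S.σ (S.excess b ξ) n ω) * (e * nf)) := by gcongr
      _ = _ := by ring

theorem IsRandomOpenMap.measurable_log_contractionConst (hS : S.IsRandomOpenMap H) (n : ℕ) :
    Measurable fun ω => Real.log (S.contractionConst H n ω) := by
  refine hS.measurable_of_agree n fun ω ω' h => ?_
  have h1 : S.maxContiguous H n ω = S.maxContiguous H n ω' := by
    rw [maxContiguous, maxContiguous, partialBranches, partialBranches, h.branches_eq,
      h.fullBranches_eq]
  have h2 : ∀ j ∈ Finset.range n, S.g (S.σ^[j] ω) = S.g (S.σ^[j] ω') := fun j hj =>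
    (h j (Finset.mem_range.1 hj)).2.2
  rw [contractionConst, contractionConst, numFull, numFull, h.fullBranches_eq, h.survivor_eq,
    h.gprod_eq, h1, Finset.sum_congr rfl fun j hj => by rw [h2 j hj],
    Finset.prod_congr rfl fun j hj => by rw [h2 j hj]]

theorem birkhoffSum_integral {σ : Ω → Ω} (hσ : Ergodic σ m) {f : Ω → ℝ} (hf : Integrable f m)
    (n : ℕ) : Integrable (birkhoffSum σ f n) m ∧
      ∫ ω, birkhoffSum σ f n ω ∂m = n * ∫ ω, f ω ∂m := by
  have hj := fun j => hσ.toMeasurePreserving.iterate j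
  have h1 : ∀ j, Integrable (fun ω => f (σ^[j] ω)) m := fun j =>
    ((hj j).integrable_comp hf.aestronglyMeasurable).2 hf
  have h2 : ∀ j, ∫ ω, f (σ^[j] ω) ∂m = ∫ ω, f ω ∂m := fun j => by
    have := integral_map (f := f) (hj j).measurable.aemeasurable
      (by rw [(hj j).map_eq]; exact hf.aestronglyMeasurable)
    rw [(hj j).map_eq] at this
    exact this.symm
  refine ⟨integrable_finsetSum _ fun j _ => h1 j, ?_⟩
  simp only [birkhoffSum]
  rw [integral_finsetSum _ fun j _ => h1 j]
  simp [h2]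

variable [IsProbabilityMeasure m]

/-- The mean of the upper bound for the logarithm is `n` times the mean excess plus `O(log n)`. The
lower bound is needed for integrability, without which the integral would be `0` by convention. -/
theorem IsAdmissible.exists_contracting (hA : S.IsAdmissible m H b ξ) :
    ∃ n : ℕ, 0 < n ∧ ∫ ω, Real.log (S.contractionConst H n ω) ∂m < 0 := by
  have hqi := integrable_of_integral_neg hA.neg
  have t : Tendsto (fun n : ℕ => Real.log 3 / n + Real.log n / n + Real.log (1 + 4 * n) / n +
      (1 + ∫ ω, S.relVar ω ∂m) / n + ∫ ω, S.excess b ξ ω ∂m) atTop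
      (𝓝 (0 + 0 + 0 + 0 + ∫ ω, S.excess b ξ ω ∂m)) :=
    ((((tendsto_const_div_atTop_nhds_zero_nat _).add tendsto_log_natCast_div).add
      tendsto_log_one_add_mul_div).add
      (tendsto_const_div_atTop_nhds_zero_nat _)).add tendsto_const_nhds
  have hlt : 0 + 0 + 0 + 0 + ∫ ω, S.excess b ξ ω ∂m < 0 := by linarith [hA.neg]
  obtain ⟨n, hn1, hn⟩ := ((t.eventually_lt_const hlt).and (eventually_gt_atTop 0)).exists
  have hn0 : (1 : ℝ) ≤ n := by exact_mod_cast hn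
  refine ⟨n, hn, ?_⟩
  obtain ⟨i1, e1⟩ := birkhoffSum_integral hA.erg hA.int_var n
  obtain ⟨i2, e2⟩ := birkhoffSum_integral hA.erg hqi n
  obtain ⟨i3, -⟩ := birkhoffSum_integral hA.erg hA.int_card n
  have hbd := (ae_all_iterate hA.erg hA.einf_pos).mono fun ω hω =>
    hA.map.log_contractionConst_bounds hA.b_pos hA.ξ_pos hA.b_le hA.le_ξ hn hω
  set C := Real.log 3 + Real.log n + Real.log (1 + 4 * n) + 1 / n with hC
  have iU : Integrable (fun ω => C + birkhoffSum S.σ S.relVar n ω / n +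
      birkhoffSum S.σ (S.excess b ξ) n ω) m :=
    ((integrable_const C).add (i1.div_const _)).add i2
  have hint : Integrable (fun ω => Real.log (S.contractionConst H n ω)) m := by
    refine Integrable.mono' (i3.abs.add iU.abs)
      (hA.map.measurable_log_contractionConst n).aestronglyMeasurable ?_
    filter_upwards [hbd] with ω ⟨h1, h2⟩
    simp only [Pi.add_apply, Real.norm_eq_abs]
    rw [abs_le]
    constructor
    · linarith [le_abs_self (birkhoffSum S.σ (S.logCard H) n ω),
        abs_nonneg (C + birkhoffSum S.σ S.relVar n ω / n + birkhoffSum S.σ (S.excess b ξ) n ω)]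
    · linarith [le_abs_self (C + birkhoffSum S.σ S.relVar n ω / n +
        birkhoffSum S.σ (S.excess b ξ) n ω), abs_nonneg (birkhoffSum S.σ (S.logCard H) n ω)]
  have hle := integral_mono_ae hint iU (hbd.mono fun ω hω => hω.2)
  have hU : ∫ ω, (C + birkhoffSum S.σ S.relVar n ω / n + birkhoffSum S.σ (S.excess b ξ) n ω) ∂m =
      C + (∫ ω, S.relVar ω ∂m) + n * ∫ ω, S.excess b ξ ω ∂m := by
    rw [integral_add (f := fun ω => C + birkhoffSum S.σ S.relVar n ω / n)
      ((integrable_const C).add (i1.div_const _)) i2, integral_add (integrable_const C)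
      (i1.div_const _), integral_div, e1, e2]
    have : (n : ℝ) ≠ 0 := by positivity
    simp [this]
  rw [hU] at hle
  have hn2 : (Real.log 3 / n + Real.log n / n + Real.log (1 + 4 * n) / n +
      (1 + ∫ ω, S.relVar ω ∂m) / n + ∫ ω, S.excess b ξ ω ∂m) * n =
      Real.log 3 + Real.log n + Real.log (1 + 4 * n) + 1 + (∫ ω, S.relVar ω ∂m) +
        n * ∫ ω, S.excess b ξ ω ∂m := by
    have : (n : ℝ) ≠ 0 := by positivity
    field_simp
    ring
  have hn3 := mul_neg_of_neg_of_pos hn1 (show (0 : ℝ) < n by linarith)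
  rw [hn2] at hn3
  have : 1 / (n : ℝ) ≤ 1 := by rw [div_le_one (by linarith)]; exact hn0
  linarith

theorem IsAdmissible.stronglyContracting (hA : S.IsAdmissible m H b ξ) :
    S.StronglyContracting m H where
  einf_pos := hA.einf_pos
  int_card := hA.int_card
  int_sup := hA.int_sup
  int_inf := hA.int_inf
  int_var := (hA.int_var.sub (integrable_const 1)).congr
    (Eventually.of_forall fun _ => add_sub_cancel_right _ _)
  contracting := hA.exists_contracting

end RandomMap

/-! ### The theorem: all the systems are admissible with the same `b` and `ξ`. -/

theorem mainTheorem6 {Ω : Type*} [MeasurableSpace Ω] (m : Measure Ω) [IsProbabilityMeasure m]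
    [m.IsComplete] (S : RandomMap Ω) (hσ : Ergodic S.σ m)
    (hclosed : S.StronglyContracting m (fun _ => ∅))
    (ε₀ : ℝ) (hε₀ : 0 < ε₀) (H : ℝ → Ω → Set ℝ)
    (hmap : ∀ ε ∈ Icc 0 ε₀, S.IsRandomOpenMap (H ε))
    (hH_zero : ∀ ω, H 0 ω = ∅)
    (hH_mono : ∀ ω, ∀ ε' ∈ Icc 0 ε₀, ∀ ε ∈ Icc 0 ε₀, ε' < ε → H ε' ω ⊆ H ε ω)
    (b ξ : Ω → ℝ) (hb : ∀ ω, 0 < b ω) (hξ : ∀ ω, 0 < ξ ω)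
    (hb_le : ∀ ε ∈ Icc 0 ε₀, ∀ ω, b ω ≤ (S.numFull (H ε) 1 ω : ℝ))
    (hle_ξ : ∀ ε ∈ Icc 0 ε₀, ∀ ω, (S.maxContiguous (H ε) 1 ω : ℝ) ≤ ξ ω)
    -- a negative Bochner integral is the integral of an integrable function
    (hneg : ∫ ω, (Real.log (S.supNorm (S.g ω)) - Real.log (S.einf (S.g ω))
      + Real.log (2 + ξ ω) - Real.log (b ω)) ∂m < 0) :
    -- the potential is strongly contracting for every open system
    (∀ ε ∈ Ioc 0 ε₀, S.StronglyContracting m (H ε)) ∧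
    -- the conformal measures, the multipliers and the Lyapunov exponent are well defined
    (∀ ε ∈ Icc 0 ε₀,
      (∀ᵐ ω ∂m, S.IsConformalMeasure (H ε) ω (S.conformalMeasure (H ε) ω) ∧
        ∀ ν, S.IsConformalMeasure (H ε) ω ν → ν = S.conformalMeasure (H ε) ω) ∧
      (∀ᵐ ω ∂m, 0 < S.multiplier (H ε) ω ∧
        ∀ f : ℝ → ℝ, BoundedVariationOn f S.I →
          ∫ x, S.transfer (H ε) ω f x ∂(S.conformalMeasure (H ε) (S.σ ω)) =
            S.multiplier (H ε) ω * ∫ x, f x ∂(S.conformalMeasure (H ε) ω)) ∧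
      Integrable (fun ω => Real.log (S.multiplier (H ε) ω)) m ∧
      (∀ᵐ ω ∂m, Tendsto
        (fun n : ℕ => 1 / (n : ℝ) * Real.log (S.einf (S.transferIter (H ε) n ω (fun _ => 1))))
        atTop (𝓝 (S.lyapunov m (H ε))))) ∧
    -- the Lyapunov exponent is non-increasing in the size of the holes
    AntitoneOn (fun ε => S.lyapunov m (H ε)) (Icc 0 ε₀) ∧
    -- the escape rate of the conformal measure at level ε' through the holes at level ε
    (∀ ε' ∈ Icc 0 ε₀, ∀ ε ∈ Icc 0 ε₀, ε' < ε → ∀ᵐ ω ∂m,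
      (∀ n : ℕ, 0 < (S.conformalMeasure (H ε') ω).real (S.survivor (H ε) n ω)) ∧
      Tendsto
        (fun n : ℕ => -(1 / (n : ℝ) *
          Real.log ((S.conformalMeasure (H ε') ω).real (S.survivor (H ε) n ω))))
        atTop (𝓝 (S.lyapunov m (H ε') - S.lyapunov m (H ε)))) := by
  have h0 : (0 : ℝ) ∈ Icc 0 ε₀ := ⟨le_rfl, hε₀.le⟩
  have hH0 : H 0 = fun _ => ∅ := funext hH_zero
  have hsub : ∀ ε ∈ Icc 0 ε₀, ∀ ε' ∈ Icc 0 ε₀, ε' ≤ ε → ∀ ω, H ε' ω ⊆ H ε ω :=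
    fun ε hε ε' hε' hle ω => hle.lt_or_eq.elim (hH_mono ω ε' hε' ε hε) fun h => by rw [h]
  have hvar : Integrable S.relVar m := hclosed.int_var.add (integrable_const 1)
  have hA : ∀ ε ∈ Icc 0 ε₀, S.IsAdmissible m (H ε) b ξ := fun ε hε =>
    { map := hmap ε hε
      erg := hσ
      b_pos := hb
      ξ_pos := hξ
      b_le := hb_le ε hε
      le_ξ := hle_ξ ε hε
      einf_pos := hclosed.einf_pos
      int_card := (hmap ε hε).integrable_logCard (hmap 0 h0) (hsub ε hε 0 h0 hε.1) hb hξ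
        (hb_le ε hε) (hle_ξ ε hε) (hH0 ▸ hclosed.int_card) hclosed.int_sup hclosed.int_inf
        (RandomMap.integrable_of_integral_neg hneg)
      int_sup := hclosed.int_sup
      int_inf := hclosed.int_inf
      int_var := hvar
      neg := hneg }
  refine ⟨fun ε hε => (hA ε ⟨hε.1.le, hε.2⟩).stronglyContracting, fun ε hε => ⟨?_, ?_,
    (hA ε hε).integrable_log_multiplier, (hA ε hε).ae_tendsto_log_einf.mono fun ω h => h.2⟩, ?_, ?_⟩
  · filter_upwards [(hA ε hε).ae_isGoodFibre] with ω hω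
    have hS := hmap ε hε
    have h1 := hS.isConformalMeasure (hω 0) (hS.isLimMeasure_conformalMeasure (hω 0))
    exact ⟨h1, fun ν hν => hν.eq hS.lo_lt_hi h1⟩
  · filter_upwards [(hA ε hε).ae_isGoodFibre, (hA ε hε).ae_multiplier_bounds] with ω hω hlam
    exact ⟨hlam.1, fun f hf => (hmap ε hε).integral_transfer (hω 0) (hω 1)
      (.of_boundedVariationOn hf)⟩
  · exact fun ε' hε' ε hε hle => (hA ε hε).lyapunov_anti (hA ε' hε') (hsub ε hε ε' hε' hle)
  · exact fun ε' hε' ε hε hlt => (hA ε hε).ae_escape (hA ε' hε') (hsub ε hε ε' hε' hlt.le)
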